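/- **Setting.** Identify $\mathbb H^n\cong\mathbb R^{4n}$, $q_l=x_{4l}+\mathbf i x_{4l+1}+\mathbf j x_{4l+2}+\mathbf k x_{4l+3}$ ($0\le l<n$), with Lebesgue measure $dV$. Let $\omega^0,\dots,\omega^{2n-1}$ be a basis of $\mathbb C^{2n}$, $\Omega_{2n}=\omega^0\wedge\dots\wedge\omega^{2n-1}$, $\beta_n=\sum_{l=0}^{n-1}\omega^{2l}\wedge\omega^{2l+1}$. Put $$\begin{pmatrix}\nabla_{(2l)0}&\nabla_{(2l)1}\\ \nabla_{(2l+1)0}&\nabla_{(2l+1)1}\end{pmatrix}=\begin{pmatrix}\partial_{x_{4l}}+\mathbf i\partial_{x_{4l+1}}&-\partial_{x_{4l+2}}-\mathbf i\partial_{x_{4l+3}}\\ \partial_{x_{4l+2}}-\mathbf i\partial_{x_{4l+3}}&\partial_{x_{4l}}-\mathbf i\partial_{x_{4l+1}}\end{pmatrix},$$ $d_\alpha\big(\sum_I f_I\omega^I\big)=\sum_{k,I}\nabla_{k\alpha}f_I\,\omega^k\wedge\omega^I$ for $\alpha=0,1$, and $\triangle=d_0d_1$. For a quaternion $a=a^0+a^1\mathbf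 i+a^2\mathbf j+a^3\mathbf k$ let $\tau(a)=\begin{pmatrix}a^0-\mathbf i a^1&-a^2+\mathbf i a^3\\ a^2+\mathbf i a^3&a^0+\mathbf i a^1\end{pmatrix}$. For a right $\mathbb H$-linear map $\eta(q)=\sum_l a_lq_l$ from $\mathbb H^n$ to $\mathbb H$ put $\eta^*\widetilde\omega^p=\sum_{l}\sum_{s=0,1}\tau(a_l)_{ps}\,\omega^{2l+s}$, $p=0,1$. The cone $SP^{2m}\mathbb C^{2n}$ of strongly positive elements consists of the finite combinations, with nonnegative coefficients, of the elements $\eta_1^*\widetilde\omega^0\wedge\eta_1^*\widetilde\omega^1\wedge\dots\wedge\eta_m^*\widetilde\omega^0\wedge\eta_m^*\widetilde\omega^1$ with $\eta_1,\dots,\eta_m$ linearly independent. A function on an open set $\Omega\subseteq\mathbb H^n$ is plurisubharmonic ($PSH$) if it is upper semicontinuous and subharmonic on each right quaternionic line $\{a+bt:t\in\mathbb H\}$. A $2k$-current $T$ on $\Omega$ is a continuous linear functional on the smooth compactly supported $(2n-2k)$-forms in $\Omega$; it is positive if $T(\eta)\ge0$ whenever $\eta$ has values in $SP^{2n-2k}\mathbb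 C^{2n}$; $(\triangle T)(\eta):=T(\triangle\eta)$; and if $T=\sum_I T_I\omega^I$ has (complex Radon) measure coefficients and $u$ is a locally bounded Borel function, $uT:=\sum_I(uT_I)\omega^I$. For $u_1,\dots,u_k\in PSH\cap C^2(\Omega)$, $\triangle u_1\wedge\dots\wedge\triangle u_k$ is the pointwise product, and $\|\triangle u_1\wedge\dots\wedge\triangle u_k\|_L:=\int_L f\,dV$ where $\triangle u_1\wedge\dots\wedge\triangle u_k\wedge\beta_n^{n-k}=f\,\Omega_{2n}$. For $u_1,\dots,u_k\in PSH\cap L^\infty_{loc}(\Omega)$, $\triangle u_1\wedge\dots\wedge\triangle u_k$ is the current defined inductively by $\triangle u_1\wedge\dots\wedge\triangle u_k:=\triangle(u_1\,\triangle u_2\wedge\dots\wedge\triangle u_k)$, starting from the constant $0$-current $1$; and $\|T\|_L:=\nu(L)$ if $T$ is a positive $2k$-current and $\nu$ is the Radon measure on $\Omega$ with $T\wedge\beta_n^{n-k}=\nu\,\Omega_{2n}$, i.e. $T(f\beta_n^{n-k})=\int f\,d\nu$ for all test functions $f$. **Statement.** Let $K,L\subset\mathbb H^n$ be compact with $L\subset\operatorname{int}K$.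 There is a constant $C>0$, depending only on $K$ and $L$, such that for every open set $\Omega\supseteq K$ and all $k\le n$: 1. for all $u_1,\dots,u_k\in PSH\cap C^2(\Omega)$, $$0\le\|\triangle u_1\wedge\dots\wedge\triangle u_k\|_L\le C\prod_{i=1}^k\|u_i\|_{L^\infty(K)};$$ 2. for all $u_1,\dots,u_k\in PSH\cap L^\infty_{loc}(\Omega)$, the current $\triangle u_1\wedge\dots\wedge\triangle u_k$ is a positive current with measure coefficients, and $$\|\triangle u_1\wedge\dots\wedge\triangle u_k\|_L\le C\prod_{i=1}^k\|u_i\|_{L^\infty(K)}.$$ -/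

import Mathlib

open MeasureTheory TopologicalSpace Set
open scoped Distributions ENNReal NNReal ComplexOrder

noncomputable section

namespace QPlurisubharmonic

/-! ### The flat quaternionic space -/

/-- The quaternionic space `ℍⁿ ≅ ℝ⁴ⁿ`, with its Euclidean norm and Lebesgue measure.  The point `x`
has quaternionic coordinates `q_l = x (l,0) + x (l,1) i + x (l,2) j + x (l,3) k`. -/
abbrev HSpace (n : ℕ) : Type := EuclideanSpace ℝ (Fin n × Fin 4)

/-- The point of `ℍⁿ` with given quaternionic coordinates. -/
def ofQuat {n : ℕ} (q : Fin n → Quaternion ℝ) : HSpace n :=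
  WithLp.toLp 2 fun p => ![(q p.1).re, (q p.1).imI, (q p.1).imJ, (q p.1).imK] p.2

/-- A quaternion from its four real coordinates. -/
def quatOf (t : EuclideanSpace ℝ (Fin 4)) : Quaternion ℝ := ⟨t 0, t 1, t 2, t 3⟩

/-- The parametrization `t ↦ a + b t` of a right quaternionic line of `ℍⁿ`. -/
def rightLine {n : ℕ} (a b : Fin n → Quaternion ℝ) (t : EuclideanSpace ℝ (Fin 4)) : HSpace n :=
  ofQuat fun l => a l + b l * quatOf t

/-! ### Plurisubharmonic functions -/

/-- Real-valued subharmonic functions on an open subset `D` of a Euclidean space: upper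
semicontinuous, with the sub-mean value inequality on every closed ball contained in `D`.
(An upper semicontinuous function is bounded above on a closed ball, so its mean over the ball is
always defined in `[-∞, ∞)`; the inequality forces it to be finite, i.e. the function to be
integrable on the ball.) -/
structure IsSubharmonicOn {ι : Type*} [Fintype ι] (v : EuclideanSpace ℝ ι → ℝ)
    (D : Set (EuclideanSpace ℝ ι)) : Prop where
  usc : UpperSemicontinuousOn v D
  integrableOn : ∀ x r, 0 < r → Metric.closedBall x r ⊆ D →
    IntegrableOn v (Metric.closedBall x r) volume
  le_average : ∀ x r, 0 < r → Metric.closedBall x r ⊆ D →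
    v x ≤ ⨍ y in Metric.closedBall x r, v y ∂volume

/-- Real-valued quaternionic plurisubharmonic functions on the open set `Ω ⊆ ℍⁿ`: upper
semicontinuous and subharmonic on each right quaternionic line. -/
structure IsPSH {n : ℕ} (Ω : Opens (HSpace n)) (u : HSpace n → ℝ) : Prop where
  usc : UpperSemicontinuousOn u Ω
  subharmonic : ∀ a b : Fin n → Quaternion ℝ,
    IsSubharmonicOn (fun t => u (rightLine a b t)) {t | rightLine a b t ∈ Ω}

/-- `u ∈ L^∞_loc(Ω)`. -/
def IsLocallyBounded {n : ℕ} (Ω : Opens (HSpace n)) (u : HSpace n → ℝ) : Prop :=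
  ∀ K : Set (HSpace n), IsCompact K → K ⊆ Ω → MemLp u ∞ (volume.restrict K)

/-- The norm `‖u‖_{L^∞(K)}`. -/
def supNorm {n : ℕ} (K : Set (HSpace n)) (u : HSpace n → ℝ) : ℝ :=
  (eLpNorm u ∞ (volume.restrict K)).toReal

/-! ### The exterior algebra of `ℂ²ⁿ` -/

/-- The exterior algebra `∧ ℂ²ⁿ`.  The index `2l + s` (with `s = 0, 1`) of `Fin (n * 2)` has
`divNat = l` and `modNat = s`. -/
abbrev Ext (n : ℕ) : Type := ExteriorAlgebra ℂ (Fin (n * 2) → ℂ)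

/-- Coefficient vectors `(f_I)_I`, `I ⊆ {0, …, 2n-1}`, of elements of `∧ ℂ²ⁿ`. -/
abbrev Coeff (n : ℕ) : Type := Finset (Fin (n * 2)) → ℂ

/-- The basis element `ω^j` of `ℂ²ⁿ`. -/
def omega {n : ℕ} (j : Fin (n * 2)) : Ext n := ExteriorAlgebra.ι ℂ (Pi.single j 1)

/-- The identification of `∑_I f_I ω^I` with `(f_I)_I`, where
`ω^I = ω^{i₁} ∧ … ∧ ω^{i_p}` for `I = {i₁ < … < i_p}`. -/
def coeff (n : ℕ) : Ext n ≃ₗ[ℂ] Coeff n := (Pi.basisFun ℂ (Fin (n * 2))).ExteriorAlgebra.equivFun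

/-- The coefficient of `Ω_{2n} = ω^0 ∧ ω^1 ∧ … ∧ ω^{2n-1}`. -/
def topCoeff {n : ℕ} (w : Ext n) : ℂ := coeff n w Finset.univ

/-- `β_n = ∑_l ω^{2l} ∧ ω^{2l+1}`. -/
def beta (n : ℕ) : Ext n :=
  ∑ l : Fin n, omega (finProdFinEquiv (l, 0)) * omega (finProdFinEquiv (l, 1))

/-- Exterior multiplication `a ∧ ·` by `a`, on coefficient vectors. -/
def wedgeLeft {n : ℕ} (a : Ext n) : Coeff n →L[ℂ] Coeff n :=
  LinearMap.toContinuousLinearMap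
    ((coeff n).toLinearMap ∘ₗ LinearMap.mulLeft ℂ a ∘ₗ (coeff n).symm.toLinearMap)

/-- The pairing `(φ, ψ) ↦` coefficient of `Ω_{2n}` in `ψ ∧ φ`, on coefficient vectors. -/
def topPairing (n : ℕ) : Coeff n →L[ℂ] Coeff n →L[ℂ] ℂ :=
  LinearMap.toContinuousLinearMap
    (LinearMap.toContinuousLinearMap.toLinearMap ∘ₗ
      LinearMap.mk₂ ℂ
        (fun φ ψ : Coeff n => topCoeff ((coeff n).symm ψ * (coeff n).symm φ))
        (by intros; simp [topCoeff, mul_add]) (by intros; simp [topCoeff])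
        (by intros; simp [topCoeff, add_mul]) (by intros; simp [topCoeff]))

theorem topPairing_apply {n : ℕ} (φ ψ : Coeff n) :
    topPairing n φ ψ = topCoeff ((coeff n).symm ψ * (coeff n).symm φ) := rfl

/-! ### Strongly positive elements -/

/-- The complex `2 × 2` matrix `τ(q)` of a quaternion `q`. -/
def tau (q : Quaternion ℝ) : Matrix (Fin 2) (Fin 2) ℂ :=
  !![(q.re : ℂ) - Complex.I * q.imI, -(q.imJ : ℂ) + Complex.I * q.imK;
     (q.imJ : ℂ) + Complex.I * q.imK, (q.re : ℂ) + Complex.I * q.imI]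

/-- The pull-back `η^* ω̃^p = ∑_j τ(η)_{pj} ω^j` under the right `ℍ`-linear map
`η : ℍⁿ → ℍ`, `η(q) = ∑_l η_l q_l`. -/
def pullback {n : ℕ} (η : Fin n → Quaternion ℝ) (p : Fin 2) : Ext n :=
  ∑ j : Fin (n * 2), tau (η j.divNat) p j.modNat • omega j

/-- Elementary strongly positive `2m`-elements
`η_1^* ω̃^0 ∧ η_1^* ω̃^1 ∧ … ∧ η_m^* ω̃^0 ∧ η_m^* ω̃^1`, where `η_1, …, η_m : ℍⁿ → ℍ` are
linearly independent right `ℍ`-linear maps (these maps form a left `ℍ`-module, the module of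
their rows). -/
def IsElementarySP (n m : ℕ) (w : Ext n) : Prop :=
  ∃ η : Fin m → Fin n → Quaternion ℝ, LinearIndependent (Quaternion ℝ) η ∧
    w = (List.ofFn fun i => pullback (η i) 0 * pullback (η i) 1).prod

/-- The convex cone `SP^{2m} ℂ²ⁿ` of strongly positive elements: finite combinations of elementary
strongly positive ones with nonnegative real coefficients. -/
def SP (n m : ℕ) : Submodule ℝ≥0 (Ext n) := Submodule.span ℝ≥0 {w | IsElementarySP n m w}

/-! ### The operators `d₀`, `d₁` and the Baston operator on functions -/

/-- The coefficients of `∇_{jα}` for `j = 2l + s` with respect to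
`∂_{x_{4l}}, ∂_{x_{4l+1}}, ∂_{x_{4l+2}}, ∂_{x_{4l+3}}`. -/
def nablaCoeff (s α : Fin 2) : Fin 4 → ℂ :=
  ![![![1, Complex.I, 0, 0], ![0, 0, -1, -Complex.I]],
    ![![0, 0, 1, -Complex.I], ![1, -Complex.I, 0, 0]]] s α

/-- The coordinate direction of `x_{4l+m}` in `ℍⁿ`. -/
def dir {n : ℕ} (l : Fin n) (m : Fin 4) : HSpace n := EuclideanSpace.single (l, m) 1

/-- `∇_{jα}`, acting coefficientwise on form-valued functions. -/
def nabla {n : ℕ} (j : Fin (n * 2)) (α : Fin 2) (F : HSpace n → Coeff n) (x : HSpace n) : Coeff n :=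
  ∑ m : Fin 4, nablaCoeff j.modNat α m • fderiv ℝ F x (dir j.divNat m)

/-- `d_α F = ∑_{k,I} ∇_{kα} f_I ω^k ∧ ω^I` for `F = ∑_I f_I ω^I`. -/
def dForm {n : ℕ} (α : Fin 2) (F : HSpace n → Coeff n) (x : HSpace n) : Coeff n :=
  ∑ j : Fin (n * 2), wedgeLeft (omega j) (nabla j α F x)

/-- A scalar function as a `0`-form. -/
def zeroForm {n : ℕ} (u : HSpace n → ℝ) (x : HSpace n) : Coeff n :=
  coeff n (algebraMap ℂ (Ext n) (u x))

/-- The `2`-form `△u = d₀ d₁ u`. -/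
def baston {n : ℕ} (u : HSpace n → ℝ) (x : HSpace n) : Ext n :=
  (coeff n).symm (dForm 0 (dForm 1 (zeroForm u)) x)

/-- The `2k`-form `△u_1 ∧ … ∧ △u_k` for `C²` functions. -/
def bastonWedge {n k : ℕ} (u : Fin k → HSpace n → ℝ) (x : HSpace n) : Ext n :=
  (List.ofFn fun i => baston (u i) x).prod

/-- `‖F‖_L = ∫_L F ∧ β_n^p` for a (continuous) form `F` of degree `2n - 2p`. -/
def formMass {n : ℕ} (L : Set (HSpace n)) (p : ℕ) (F : HSpace n → Ext n) : ℂ :=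
  ∫ x in L, topCoeff (F x * beta n ^ p) ∂volume

/-! ### Currents -/

/-- Test forms on `Ω`: smooth compactly supported functions with values in `∧ ℂ²ⁿ`, of all
degrees simultaneously (written through their coefficients). -/
abbrev TestForm {n : ℕ} (Ω : Opens (HSpace n)) : Type := 𝓓(Ω, Coeff n)

/-- Currents on `Ω`: the topological dual of the space of test forms.  A `p`-current is a current
that only depends on the component of degree `2n - p` of the test form. -/
abbrev Current {n : ℕ} (Ω : Opens (HSpace n)) : Type := TestForm Ω →L[ℂ] ℂ

/-- `∇_{jα}` on test forms. -/
def nablaTest {n : ℕ} (Ω : Opens (HSpace n)) (j : Fin (n * 2)) (α : Fin 2) :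
    TestForm Ω →L[ℂ] TestForm Ω :=
  ∑ m : Fin 4,
    TestFunction.postcompCLM (nablaCoeff j.modNat α m • ContinuousLinearMap.id ℂ (Coeff n)) ∘L
      TestFunction.lineDerivCLM ℂ (dir j.divNat m)

/-- `d_α` on test forms. -/
def dTest {n : ℕ} (Ω : Opens (HSpace n)) (α : Fin 2) : TestForm Ω →L[ℂ] TestForm Ω :=
  ∑ j : Fin (n * 2), TestFunction.postcompCLM (wedgeLeft (omega j)) ∘L nablaTest Ω j α

theorem dTest_apply {n : ℕ} (Ω : Opens (HSpace n)) (α : Fin 2) (η : TestForm Ω) (x : HSpace n) :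
    dTest Ω α η x = dForm α (fun y => η y) x := by
  have hs : ∀ {ι : Type} (s : Finset ι) (A : ι → TestForm Ω), (∑ i ∈ s, A i : TestForm Ω) x =
      ∑ i ∈ s, A i x := by
    intro ι s A
    classical
    induction s using Finset.induction_on with
    | empty => simp
    | insert a s ha ih => rw [Finset.sum_insert ha, Finset.sum_insert ha, ← ih]; rfl
  have h1 : ∀ j, nablaTest Ω j α η x = nabla j α (fun y => η y) x := by
    intro j
    rw [nablaTest, sum_apply, hs]
    refine Finset.sum_congr rfl fun m _ => ?_
    show nablaCoeff j.modNat α m •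
      (TestFunction.lineDerivCLM ℂ (dir j.divNat m) η : TestForm Ω) x = _
    rw [TestFunction.lineDerivCLM_eq_fderivCLM, TestFunction.fderivCLM_apply_of_le _ (by simp)]
  rw [dTest, sum_apply, hs]
  refine Finset.sum_congr rfl fun j _ => ?_
  rw [← h1 j]
  rfl

variable {n : ℕ} {Ω : Opens (HSpace n)}

/-- `△T`, defined by `(△T)(η) = T(△η)` with `△η = d₀ d₁ η`. -/
def Current.baston (T : Current Ω) : Current Ω := T ∘L dTest Ω 0 ∘L dTest Ω 1

/-- The current `φ ↦ ∫ ψ ∧ φ`, for `ψ = ∑_I (h_I μ) ω^I` a form with measure coefficients `h_I μ`,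
where `μ` is a positive measure and the densities `h_I` are locally `μ`-integrable in `Ω`. -/
def Current.ofMeasure (Ω : Opens (HSpace n)) (μ : Measure (HSpace n)) (h : HSpace n → Coeff n) :
    Current Ω :=
  TestFunction.integralAgainstBilinCLM (topPairing n) μ h

/-- `T = ∑_I T_I ω^I` with complex Radon measures `T_I = h_I μ` on `Ω`. -/
def Current.HasMeasureRep (T : Current Ω) (μ : Measure (HSpace n)) (h : HSpace n → Coeff n) :
    Prop :=
  LocallyIntegrableOn h Ω μ ∧ T = Current.ofMeasure Ω μ h

/-- `T` has measure coefficients, i.e. is of order zero. -/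
def Current.HasMeasureCoeff (T : Current Ω) : Prop :=
  ∃ (μ : Measure (HSpace n)) (h : HSpace n → Coeff n), T.HasMeasureRep μ h

open Classical in
/-- The product `u T = ∑_I (u T_I) ω^I` of a locally bounded Borel function `u` and a current
`T = ∑_I T_I ω^I` with measure coefficients (which does not depend on how the measures `T_I` are
written as `h_I μ`).  For other currents the value is the dummy `0`. -/
def Current.mulFun (u : HSpace n → ℝ) (T : Current Ω) : Current Ω :=
  if H : T.HasMeasureCoeff then
    Current.ofMeasure Ω H.choose fun x => (u x : ℂ) • H.choose_spec.choose x
  else 0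

/-- The `0`-current `φ ↦ ∫_Ω φ` given by the constant function `1`. -/
def Current.one (Ω : Opens (HSpace n)) : Current Ω :=
  Current.ofMeasure Ω volume fun _ => coeff n 1

/-- The current `△u_1 ∧ … ∧ △u_k`, defined inductively by
`△u_1 ∧ … ∧ △u_k = △(u_1 △u_2 ∧ … ∧ △u_k)`. -/
def bastonProduct (Ω : Opens (HSpace n)) : List (HSpace n → ℝ) → Current Ω
  | [] => Current.one Ω
  | u :: us => ((bastonProduct Ω us).mulFun u).baston

/-- A current `T` is positive in degree `2k` if `T(η) ≥ 0` for every test form `η` with values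
in `SP^{2n-2k} ℂ²ⁿ`. -/
def Current.IsPositive (k : ℕ) (T : Current Ω) : Prop :=
  ∀ η : TestForm Ω, (∀ x, (coeff n).symm (η x) ∈ SP n (n - k)) → 0 ≤ T η

/-- The test form `f w`, for a scalar test function `f` and a constant element `w` of `∧ ℂ²ⁿ`. -/
def constTestForm (w : Ext n) (f : 𝓓(Ω, ℂ)) : TestForm Ω :=
  TestFunction.postcompCLM
    (ContinuousLinearMap.smulRight (1 : ℂ →L[ℂ] ℂ) (coeff n w)) f

/-- The `2n`-current `T ∧ β_n^p` is `ν Ω_{2n}`, for the positive Radon measure `ν` on `Ω`.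
By the Riesz representation theorem, `ν` is unique on `Ω`; then `‖T‖_L = ∫_L T ∧ β_n^p = ν(L)`
for all compact `L ⊆ Ω`. -/
structure Current.IsMassMeasure (T : Current Ω) (p : ℕ) (ν : Measure (HSpace n)) : Prop where
  finite : ∀ K : Set (HSpace n), IsCompact K → K ⊆ Ω → ν K < ∞
  eq_integral : ∀ f : 𝓓(Ω, ℂ), T (constTestForm (beta n ^ p) f) = ∫ x, f x ∂ν

end QPlurisubharmonic

end

noncomputable section

namespace QPlurisubharmonic

/-! ### Quaternionic determinants -/

/-! This is the Chern–Levine–Nirenberg estimate. Let `T` be a closed positive current of degree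
`2k`, let `m = n - k - 1`, and let `χ` be a cutoff supported in the interior of `K`. Testing `△(uT)`
on `χ β^m` puts both derivatives on `χ` and gives `T(u △χ ∧ β^m)`. Since `△χ` is bounded and
vanishes off the support of `χ`, a second cutoff `χ'`, equal to `1` near that support, makes `A χ' β
± △χ` strongly positive. Hence the value is at most `A ‖u‖ T(χ' β^(m+1))`
(`mulFun_baston_cutoffForm_le`). Removing the functions one by one leaves the integral of a cutoff.
All cutoffs and constants are chosen from `K` and `L` alone, before `Ω` and the functions.

The argument needs `△u₁ ∧ … ∧ △u_k` to be positive, closed and of order zero. Algebraically, `△u` is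
a linear image `hessForm` of the real Hessian. It sends a rank-one matrix `v vᵀ` to an elementary
strongly positive element, and it depends only on the average of the Hessian over right
multiplications by `1, i, j, k`. Subharmonicity on right lines says exactly that this average is
positive semidefinite (`hessForm_mem_SP`). In top degree, positivity reduces to the determinant of
the complex matrix of a quaternionic matrix being nonnegative (`det_tauMatrix_nonneg`).

Analytically, a bounded plurisubharmonic `u` is approximated by mollifications `v_j`, and for closed
`T` the current `△(uT)` is the limit of `△v_j ∧ T`. The coefficient measures of `T` may charge
Lebesgue-null sets, so `v_j → u` is needed at every point. This holds because every point is a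
Lebesgue point of `u` (`IsPSH.exists_lintegral_enorm_sub_le`). A positive current has measure
coefficients because the strongly positive elements span the forms of each even degree and positive
functionals are measures (`Current.IsPositive.hasMeasureCoeff`).

For `C²` functions the inductively defined current is the pointwise product
(`bastonProduct_eq_ofMeasure`), so the first estimate is a case of the second. -/

theorem tau_mul (a b : Quaternion ℝ) : tau (a * b) = tau a * tau b := by
  ext i j
  fin_cases i <;> fin_cases j <;>
    simp [tau, Matrix.mul_apply, Fin.sum_univ_two] <;>
    ring_nf <;> simp [Complex.I_sq] <;> ring

theorem tau_add (a b : Quaternion ℝ) : tau (a + b) = tau a + tau b := by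
  ext i j
  fin_cases i <;> fin_cases j <;> simp [tau] <;> ring

theorem tau_zero : tau 0 = 0 := by
  have h (a : ℝ) : tau (a : Quaternion ℝ) = Matrix.diagonal fun _ => (a : ℂ) := by
    ext i j
    fin_cases i <;> fin_cases j <;> simp [tau]
  simpa using h 0

theorem tau_one : tau 1 = 1 := by
  have h (a : ℝ) : tau (a : Quaternion ℝ) = Matrix.diagonal fun _ => (a : ℂ) := by
    ext i j
    fin_cases i <;> fin_cases j <;> simp [tau]
  simpa using h 1

theorem tau_smul (c : ℝ) (a : Quaternion ℝ) : tau (c • a) = (c : ℂ) • tau a := by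
  ext i j
  fin_cases i <;> fin_cases j <;> simp [tau] <;> ring

theorem tau_sub (a b : Quaternion ℝ) : tau (a - b) = tau a - tau b := by
  ext i j
  fin_cases i <;> fin_cases j <;> simp [tau] <;> ring

theorem det_tau (a : Quaternion ℝ) : (tau a).det = ((Quaternion.normSq a : ℝ) : ℂ) := by
  rw [Matrix.det_fin_two]
  simp [tau, Quaternion.normSq_def']
  ring_nf
  simp [Complex.I_sq]
  ring

/-- The complex matrix of a quaternionic matrix. -/
def tauMatrix {m : ℕ} (A : Matrix (Fin m) (Fin m) (Quaternion ℝ)) :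
    Matrix (Fin m × Fin 2) (Fin m × Fin 2) ℂ :=
  fun i j => tau (A i.1 j.1) i.2 j.2

/-- Block elimination: the pivot block contributes `|A 0 0|²`, and since `τ` is multiplicative the
Schur complement is the complex matrix of the quaternionic Schur complement, to which the induction
hypothesis applies. -/
theorem det_tauMatrix_nonneg_of_pivot {m : ℕ}
    (ih : ∀ A : Matrix (Fin m) (Fin m) (Quaternion ℝ), 0 ≤ (tauMatrix A).det)
    (A : Matrix (Fin (m + 1)) (Fin (m + 1)) (Quaternion ℝ)) (h : A 0 0 ≠ 0) :
    0 ≤ (tauMatrix A).det := by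
  let e : Fin 2 ⊕ (Fin m × Fin 2) ≃ Fin (m + 1) × Fin 2 :=
    { toFun := Sum.elim (fun s => (0, s)) (fun p => (p.1.succ, p.2))
      invFun := fun p => Fin.cases (motive := fun _ => Fin 2 ⊕ (Fin m × Fin 2))
        (Sum.inl p.2) (fun i => Sum.inr (i, p.2)) p.1
      left_inv := by rintro (s | ⟨i, s⟩) <;> rfl
      right_inv := by
        rintro ⟨i, s⟩
        refine Fin.cases ?_ (fun i => ?_) i <;> rfl }
  have hinv : tau (A 0 0) * tau (A 0 0)⁻¹ = 1 := by
    rw [← tau_mul, mul_inv_cancel₀ h, tau_one]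
  have hinv' : tau (A 0 0)⁻¹ * tau (A 0 0) = 1 := by
    rw [← tau_mul, inv_mul_cancel₀ h, tau_one]
  let : Invertible (tau (A 0 0)) := ⟨_, hinv', hinv⟩
  have hi : ⅟(tau (A 0 0)) = tau (A 0 0)⁻¹ := rfl
  rw [← Matrix.det_submatrix_equiv_self e]
  have hb : (tauMatrix A).submatrix e e = Matrix.fromBlocks (tau (A 0 0))
      (.of fun s p => tau (A 0 p.1.succ) s p.2) (.of fun p s => tau (A p.1.succ 0) p.2 s)
      (tauMatrix fun i j => A i.succ j.succ) := by
    ext (s | ⟨i, s⟩) (t | ⟨j, t⟩) <;> rfl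
  rw [hb, Matrix.det_fromBlocks₁₁, det_tau]
  refine mul_nonneg (by exact_mod_cast Quaternion.normSq_nonneg) ?_
  convert ih fun i j => A i.succ j.succ - A i.succ 0 * (A 0 0)⁻¹ * A 0 j.succ using 2
  ext ⟨i, s⟩ ⟨j, t⟩
  simp only [Matrix.sub_apply, tauMatrix, hi, tau_sub, tau_mul, Matrix.mul_apply,
    Matrix.of_apply]

theorem det_tauMatrix_nonneg {m : ℕ} (A : Matrix (Fin m) (Fin m) (Quaternion ℝ)) :
    0 ≤ (tauMatrix A).det := by
  induction m with
  | zero => simp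
  | succ m ih =>
    by_cases h : ∃ i, A i 0 ≠ 0
    · obtain ⟨i, hi⟩ := h
      have h1 := det_tauMatrix_nonneg_of_pivot ih (A.submatrix (Equiv.swap 0 i) id) (by simpa)
      have h2 : tauMatrix (A.submatrix (Equiv.swap 0 i) id) = (tauMatrix A).submatrix
          (Equiv.prodCongrLeft fun _ : Fin 2 => Equiv.swap 0 i) id := rfl
      -- A quaternionic row swap swaps two pairs of complex rows, so its sign is a square and the
      -- determinant is unchanged.
      rw [h2, Matrix.det_permute, Equiv.Perm.sign_prodCongrLeft] at h1
      rcases Int.units_eq_one_or (Equiv.Perm.sign (Equiv.swap 0 i)) with h3 | h3 <;>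
        simpa [h3] using h1
    · push Not at h
      rw [Matrix.det_eq_zero_of_column_eq_zero (0, 0)]
      rintro ⟨i, s⟩
      simp [tauMatrix, h i, tau_zero]

/-! ### The exterior algebra -/

theorem omega_eq_basis {n : ℕ} (v : Fin (n * 2) → ℂ) :
    ExteriorAlgebra.ι ℂ v = ∑ j, v j • omega (n := n) j := by
  simp only [omega, ← map_smul, ← map_sum]
  congr 1
  ext j
  simp [Finset.sum_apply, Pi.single_apply]

/-- The vector `η^* ω̃^p` of `ℂ²ⁿ`. -/
def pullbackVec {n : ℕ} (η : Fin n → Quaternion ℝ) (p : Fin 2) : Fin (n * 2) → ℂ :=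
  fun j => tau (η j.divNat) p j.modNat

theorem pullback_eq {n : ℕ} (η : Fin n → Quaternion ℝ) (p : Fin 2) :
    pullback η p = ExteriorAlgebra.ι ℂ (pullbackVec η p) := by
  rw [omega_eq_basis]; rfl

/-- The elementary element `η^* ω̃^0 ∧ η^* ω̃^1`. -/
def elem {n : ℕ} (η : Fin n → Quaternion ℝ) : Ext n := pullback η 0 * pullback η 1

theorem ι_mul_ι_swap {n : ℕ} (v w : Fin (n * 2) → ℂ) :
    (ExteriorAlgebra.ι ℂ v * ExteriorAlgebra.ι ℂ w : Ext n) =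
      -(ExteriorAlgebra.ι ℂ w * ExteriorAlgebra.ι ℂ v) :=
  eq_neg_of_add_eq_zero_left (ExteriorAlgebra.ι_add_mul_swap v w)

/-- Degree-two products are central: passing a vector changes the sign twice. -/
theorem commute_ι_mul_ι {n : ℕ} (v w : Fin (n * 2) → ℂ) (x : Ext n) :
    Commute (ExteriorAlgebra.ι ℂ v * ExteriorAlgebra.ι ℂ w : Ext n) x := by
  induction x using ExteriorAlgebra.induction with
  | algebraMap r => exact Algebra.commute_algebraMap_right _ _
  | ι z =>
    rw [Commute, SemiconjBy, mul_assoc, ι_mul_ι_swap w z, mul_neg, ← mul_assoc, ι_mul_ι_swap v z,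
      neg_mul, neg_neg, mul_assoc]
  | mul a b ha hb => exact ha.mul_right hb
  | add a b ha hb => exact ha.add_right hb

theorem commute_elem {n : ℕ} (η : Fin n → Quaternion ℝ) (x : Ext n) : Commute (elem η) x := by
  rw [elem, pullback_eq, pullback_eq]; exact commute_ι_mul_ι _ _ _

theorem pullback_mul_self {n : ℕ} (η : Fin n → Quaternion ℝ) (p : Fin 2) :
    pullback η p * pullback η p = 0 := by
  rw [pullback_eq, ExteriorAlgebra.ι_sq_zero]

theorem pullback_mul_elem {n : ℕ} (η : Fin n → Quaternion ℝ) (p : Fin 2) :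
    pullback η p * elem η = 0 := by
  fin_cases p
  · change pullback η 0 * _ = 0
    rw [elem, ← mul_assoc, pullback_mul_self, zero_mul]
  · change pullback η 1 * _ = 0
    rw [← (commute_elem η _).eq, elem, mul_assoc, pullback_mul_self, mul_zero]

theorem pullback_mul_left {n : ℕ} (c : Quaternion ℝ) (η : Fin n → Quaternion ℝ) (p : Fin 2) :
    pullback (c • η) p = ∑ s, tau c p s • pullback η s := by
  simp only [pullback, Finset.smul_sum, smul_smul]
  rw [Finset.sum_comm]
  refine Finset.sum_congr rfl fun j _ => ?_
  rw [← Finset.sum_smul]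
  simp [tau_mul, Matrix.mul_apply]

theorem pullback_add {n : ℕ} (η ζ : Fin n → Quaternion ℝ) (p : Fin 2) :
    pullback (η + ζ) p = pullback η p + pullback ζ p := by
  simp [pullback, tau_add, add_smul, Finset.sum_add_distrib]

theorem pullback_zero {n : ℕ} (p : Fin 2) : pullback (n := n) 0 p = 0 := by
  simp [pullback, tau_zero]

theorem pullback_smul {n : ℕ} (c : ℝ) (η : Fin n → Quaternion ℝ) (p : Fin 2) :
    pullback (c • η) p = (c : ℂ) • pullback η p := by
  simp [pullback, tau_smul, Finset.smul_sum, smul_smul]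

theorem pullback_sum {n : ℕ} {ι : Type*} (s : Finset ι) (f : ι → Fin n → Quaternion ℝ)
    (p : Fin 2) : pullback (∑ i ∈ s, f i) p = ∑ i ∈ s, pullback (f i) p := by
  classical
  induction s using Finset.induction_on with
  | empty => simp [pullback_zero]
  | insert a s ha ih => rw [Finset.sum_insert ha, Finset.sum_insert ha, pullback_add, ih]

/-- Left multiplication by `c` transforms the pair of pull-backs by the matrix `τ(c)`, so their
wedge is scaled by `det τ(c) = |c|²`. -/
theorem elem_mul_left {n : ℕ} (c : Quaternion ℝ) (η : Fin n → Quaternion ℝ) :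
    elem (c • η) = ((Quaternion.normSq c : ℝ) : ℂ) • elem η := by
  have h : pullback η 1 * pullback η 0 = -(pullback η 0 * pullback η 1) := by
    rw [pullback_eq, pullback_eq, ι_mul_ι_swap]
  rw [← det_tau, Matrix.det_fin_two]
  simp only [elem, pullback_mul_left, Fin.sum_univ_two, add_mul, mul_add, smul_mul_assoc,
    mul_smul_comm, pullback_mul_self, h]
  module

/-! ### The cone of strongly positive elements -/

/-- Elementary elements demand independent maps; this shows that dependent ones contribute zero, so
the cone is stable under products without any independence condition. -/
theorem elem_mul_prod_eq_zero {n m : ℕ} (η : Fin n → Quaternion ℝ)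
    (ζ : Fin m → Fin n → Quaternion ℝ) (h : η ∈ Submodule.span (Quaternion ℝ) (range ζ)) :
    elem η * (List.ofFn fun i => elem (ζ i)).prod = 0 := by
  have key : ∀ i p, pullback (ζ i) p * (List.ofFn fun i => elem (ζ i)).prod = 0 := by
    intro i p
    obtain ⟨a, b, hab⟩ := List.append_of_mem
      ((List.mem_ofFn' (fun i => elem (ζ i)) _).2 ⟨i, rfl⟩)
    rw [hab, List.prod_append, List.prod_cons, ← mul_assoc _ (elem _), ← (commute_elem _ _).eq,
      ← mul_assoc, ← mul_assoc, pullback_mul_elem, zero_mul, zero_mul]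
  obtain ⟨c, rfl⟩ := (Submodule.mem_span_range_iff_exists_fun _).1 h
  rw [elem, mul_assoc]
  have : pullback (∑ i, c i • ζ i) 1 * (List.ofFn fun i => elem (ζ i)).prod = 0 := by
    rw [pullback_sum, Finset.sum_mul]
    refine Finset.sum_eq_zero fun i _ => ?_
    rw [pullback_mul_left, Finset.sum_mul]
    refine Finset.sum_eq_zero fun s _ => ?_
    rw [smul_mul_assoc, key, smul_zero]
  rw [this, mul_zero]

theorem elem_mul_mem_SP {n m : ℕ} (η : Fin n → Quaternion ℝ) {w : Ext n} (hw : w ∈ SP n m) :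
    elem η * w ∈ SP n (m + 1) := by
  induction hw using Submodule.span_induction with
  | mem w hw =>
    obtain ⟨ζ, hζ, rfl⟩ := hw
    by_cases h : η ∈ Submodule.span (Quaternion ℝ) (range ζ)
    · have := elem_mul_prod_eq_zero η ζ h
      simp only [elem] at this ⊢
      rw [this]
      exact zero_mem _
    · refine Submodule.subset_span ⟨Fin.cons η ζ, linearIndependent_finCons.2 ⟨hζ, h⟩, ?_⟩
      simp [List.ofFn_succ, elem]
  | zero => simp
  | add a b _ _ ha hb => rw [mul_add]; exact add_mem ha hb
  | smul c a _ ha => rw [mul_smul_comm]; exact Submodule.smul_mem _ _ ha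

theorem one_mem_SP (n : ℕ) : (1 : Ext n) ∈ SP n 0 :=
  Submodule.subset_span ⟨Fin.elim0, linearIndependent_empty_type, by simp⟩

theorem elem_mem_SP {n : ℕ} (η : Fin n → Quaternion ℝ) : elem η ∈ SP n 1 := by
  simpa using elem_mul_mem_SP η (one_mem_SP n)

theorem SP_one_eq (n : ℕ) : SP n 1 = Submodule.span ℝ≥0 (range (elem (n := n))) := by
  refine le_antisymm (Submodule.span_le.2 ?_) (Submodule.span_le.2 ?_)
  · rintro w ⟨ζ, -, rfl⟩
    refine Submodule.subset_span ⟨ζ 0, ?_⟩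
    simp [List.ofFn_succ, elem]
  · rintro _ ⟨η, rfl⟩
    exact elem_mem_SP η

theorem SP_one_mul_mem {n m : ℕ} {v w : Ext n} (hv : v ∈ SP n 1) (hw : w ∈ SP n m) :
    v * w ∈ SP n (m + 1) := by
  rw [SP_one_eq] at hv
  induction hv using Submodule.span_induction with
  | mem v hv => obtain ⟨η, rfl⟩ := hv; exact elem_mul_mem_SP η hw
  | zero => simp
  | add a b _ _ ha hb => rw [add_mul]; exact add_mem ha hb
  | smul c a _ ha => rw [smul_mul_assoc]; exact Submodule.smul_mem _ _ ha

theorem commute_SP_one {n : ℕ} {v : Ext n} (hv : v ∈ SP n 1) (x : Ext n) : Commute v x := by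
  rw [SP_one_eq] at hv
  induction hv using Submodule.span_induction with
  | mem v hv => obtain ⟨η, rfl⟩ := hv; exact commute_elem η x
  | zero => exact Commute.zero_left x
  | add a b _ _ ha hb => exact ha.add_left hb
  | smul c a _ ha => rw [Commute, SemiconjBy, smul_mul_assoc, ha.eq, mul_smul_comm]

theorem pow_mem_SP {n : ℕ} {v : Ext n} (hv : v ∈ SP n 1) (m : ℕ) : v ^ m ∈ SP n m := by
  induction m with
  | zero => simpa using one_mem_SP n
  | succ m ih => rw [pow_succ']; exact SP_one_mul_mem hv ih

theorem list_prod_mul_mem_SP {n m : ℕ} (l : List (Ext n)) (hl : ∀ v ∈ l, v ∈ SP n 1) {w : Ext n}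
    (hw : w ∈ SP n m) : l.prod * w ∈ SP n (m + l.length) := by
  induction l with
  | nil => simpa using hw
  | cons v l ih =>
    rw [List.prod_cons, mul_assoc, List.length_cons, ← add_assoc]
    exact SP_one_mul_mem (hl v (by simp)) (ih fun v hv => hl v (by simp [hv]))

theorem real_smul_mem_SP {n m : ℕ} {c : ℝ} (hc : 0 ≤ c) {w : Ext n} (hw : w ∈ SP n m) :
    (c : ℂ) • w ∈ SP n m := by
  obtain ⟨r, rfl⟩ : ∃ r : ℝ≥0, (r : ℝ) = c := ⟨⟨c, hc⟩, rfl⟩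
  have := (SP n m).smul_mem r hw
  rw [← algebraMap_smul ℂ r w] at this
  exact this

theorem pullback_single {n : ℕ} (l : Fin n) (a : Quaternion ℝ) (p : Fin 2) :
    pullback (Pi.single l a) p = ∑ s, tau a p s • omega (finProdFinEquiv (l, s)) := by
  rw [pullback, ← finProdFinEquiv.sum_comp, Fintype.sum_prod_type, Finset.sum_eq_single l]
  · refine Finset.sum_congr rfl fun s _ => ?_
    have h1 : (finProdFinEquiv (l, s)).divNat = l := congrArg Prod.fst (finProdFinEquiv.symm_apply_apply (l, s))
    have h2 : (finProdFinEquiv (l, s)).modNat = s := congrArg Prod.snd (finProdFinEquiv.symm_apply_apply (l, s))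
    rw [h1, h2, Pi.single_eq_same]
  · intro b _ hb
    refine Finset.sum_eq_zero fun s _ => ?_
    have h1 : (finProdFinEquiv (b, s)).divNat = b := congrArg Prod.fst (finProdFinEquiv.symm_apply_apply (b, s))
    rw [h1, Pi.single_eq_of_ne hb, tau_zero]
    simp
  · simp

theorem pullback_single_one {n : ℕ} (l : Fin n) (p : Fin 2) :
    pullback (Pi.single l 1) p = omega (finProdFinEquiv (l, p)) := by
  rw [pullback_single, tau_one]
  simp [Matrix.one_apply, ite_smul]

theorem beta_eq (n : ℕ) : beta n = ∑ l : Fin n, elem (Pi.single l 1) := by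
  simp [beta, elem, pullback_single_one]

theorem beta_mem_SP (n : ℕ) : beta n ∈ SP n 1 := by
  rw [beta_eq]; exact Submodule.sum_mem _ fun l _ => elem_mem_SP _

theorem beta_pow_mem_SP (n m : ℕ) : beta n ^ m ∈ SP n m := pow_mem_SP (beta_mem_SP n) m

end QPlurisubharmonic

end

/-! ### Top-degree positivity, complex span of the strongly positive cone, duality and degree. -/

noncomputable section

namespace QPlurisubharmonic

/-- The basis `ω^I` of `∧ ℂ²ⁿ`. -/
def extBasis (n : ℕ) : Module.Basis (Finset (Fin (n * 2))) ℂ (Ext n) :=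
  (Pi.basisFun ℂ (Fin (n * 2))).ExteriorAlgebra

theorem coeff_extBasis {n : ℕ} (I : Finset (Fin (n * 2))) :
    coeff n (extBasis n I) = Pi.single I 1 := by
  classical
  ext J
  rw [coeff, extBasis, Module.Basis.equivFun_self, Pi.single_apply]
  simp [eq_comm]

theorem coeff_symm_single {n : ℕ} (I : Finset (Fin (n * 2))) (c : ℂ) :
    (coeff n).symm (Pi.single I c) = c • extBasis n I := by
  rw [LinearEquiv.symm_apply_eq, map_smul, coeff_extBasis, ← Pi.single_smul, smul_eq_mul, mul_one]

theorem extBasis_eq_prod {n p : ℕ} (s : Set.powersetCard (Fin (n * 2)) p) :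
    extBasis n s = (List.ofFn fun i => omega (Set.powersetCard.ofFinEmbEquiv.symm s i)).prod := by
  rw [extBasis, ExteriorAlgebra.basis_apply_powersetCard, ExteriorAlgebra.ιMulti_family,
    ExteriorAlgebra.ιMulti_apply]
  simp [omega]

theorem extBasis_univ (n : ℕ) :
    extBasis n Finset.univ = (List.ofFn fun i : Fin (n * 2) => omega i).prod := by
  have h := extBasis_eq_prod (n := n) (p := n * 2) ⟨Finset.univ, by simp⟩
  convert h using 5 with i
  have : Set.powersetCard.ofFinEmbEquiv.symm (⟨Finset.univ, by simp⟩ :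
      Set.powersetCard (Fin (n * 2)) (n * 2)) = RelEmbedding.refl _ := by
    rw [Equiv.symm_apply_eq]
    ext j
    refine iff_of_true (Finset.mem_univ j) ?_
    exact (Set.powersetCard.mem_ofFinEmbEquiv_iff_mem_range _ j).2 ⟨j, rfl⟩
  rw [this]; rfl

theorem topCoeff_extBasis {n : ℕ} (I : Finset (Fin (n * 2))) :
    topCoeff (extBasis n I) = if I = Finset.univ then 1 else 0 := by
  rw [topCoeff, coeff_extBasis, Pi.single_apply]
  simp [eq_comm]

/-- `topCoeff` as a linear map. -/
def topCoeffₗ (n : ℕ) : Ext n →ₗ[ℂ] ℂ := LinearMap.proj Finset.univ ∘ₗ (coeff n).toLinearMap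

theorem topCoeffₗ_apply {n : ℕ} (w : Ext n) : topCoeffₗ n w = topCoeff w := rfl

/-- Both sides are alternating in `2n` vectors of a space of dimension `2n`, hence proportional; the
standard basis fixes the factor. -/
theorem topCoeff_ιMulti {n : ℕ} (v : Fin (n * 2) → Fin (n * 2) → ℂ) :
    topCoeff (ExteriorAlgebra.ιMulti ℂ (n * 2) v : Ext n) = (Matrix.of v).det := by
  have h := AlternatingMap.eq_smul_basis_det (Pi.basisFun ℂ (Fin (n * 2)))
    ((topCoeffₗ n).compAlternatingMap (ExteriorAlgebra.ιMulti ℂ (n * 2)))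
  have h1 := congrArg (fun f => f v) h
  simp only [LinearMap.compAlternatingMap_apply, AlternatingMap.smul_apply] at h1
  rw [topCoeffₗ_apply, topCoeffₗ_apply, ExteriorAlgebra.ιMulti_apply (⇑(Pi.basisFun ℂ _))] at h1
  have h2 : (List.ofFn fun i : Fin (n * 2) =>
      ExteriorAlgebra.ι ℂ (Pi.basisFun ℂ (Fin (n * 2)) i)).prod = extBasis n Finset.univ := by
    rw [extBasis_univ]
    simp [omega]
  rw [h2, topCoeff_extBasis, if_pos rfl, Pi.basisFun_det_apply, one_smul] at h1
  exact h1

theorem topCoeff_prod_elem {n : ℕ} (η : Fin n → Fin n → Quaternion ℝ) :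
    topCoeff (List.ofFn fun i => elem (η i)).prod = (tauMatrix η).det := by
  have h : (List.ofFn fun i => elem (η i)).prod = ExteriorAlgebra.ιMulti ℂ (n * 2)
      (fun j : Fin (n * 2) => pullbackVec (η j.divNat) j.modNat) := by
    rw [ExteriorAlgebra.ιMulti_apply, List.ofFn_mul, List.prod_flatten, List.map_ofFn]
    congr 2
    ext i
    have h1 : ∀ s : Fin 2, (⟨i.1 * 2 + s.1, by omega⟩ : Fin (n * 2)) = finProdFinEquiv (i, s) := by
      intro s; ext; simp [finProdFinEquiv]; ring
    have h2 : ∀ s : Fin 2, (finProdFinEquiv (i, s)).divNat = i := fun s =>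
      congrArg Prod.fst (finProdFinEquiv.symm_apply_apply (i, s))
    have h3 : ∀ s : Fin 2, (finProdFinEquiv (i, s)).modNat = s := fun s =>
      congrArg Prod.snd (finProdFinEquiv.symm_apply_apply (i, s))
    simp only [Function.comp_apply, h1, h2, h3]
    simp [elem, pullback_eq]
  rw [h, topCoeff_ιMulti, ← Matrix.det_submatrix_equiv_self finProdFinEquiv]
  congr 1
  ext ⟨i, s⟩ ⟨j, t⟩
  have h2 : ∀ (i : Fin n) (s : Fin 2), (finProdFinEquiv (i, s)).divNat = i := fun i s =>
    congrArg Prod.fst (finProdFinEquiv.symm_apply_apply (i, s))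
  have h3 : ∀ (i : Fin n) (s : Fin 2), (finProdFinEquiv (i, s)).modNat = s := fun i s =>
    congrArg Prod.snd (finProdFinEquiv.symm_apply_apply (i, s))
  simp [pullbackVec, tauMatrix, h2, h3]

theorem topCoeff_nonneg_of_mem_SP {n : ℕ} {w : Ext n} (hw : w ∈ SP n n) : 0 ≤ topCoeff w := by
  rw [← topCoeffₗ_apply]
  induction hw using Submodule.span_induction with
  | mem w hw =>
    obtain ⟨η, -, rfl⟩ := hw
    have h := det_tauMatrix_nonneg η
    rw [← topCoeff_prod_elem] at h
    exact h
  | zero => simp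
  | add a b _ _ ha hb => rw [map_add]; exact add_nonneg ha hb
  | smul c a _ ha =>
    rw [← algebraMap_smul ℂ c a, map_smul]
    exact mul_nonneg (show (0 : ℂ) ≤ ((c : ℝ) : ℂ) by exact_mod_cast c.2) ha

/-! ### Complex combinations of strongly positive elements -/

/-- The complex span of the strongly positive elements of degree `2m`. -/
def spanSP (n m : ℕ) : Submodule ℂ (Ext n) := Submodule.span ℂ (SP n m)

theorem elem_mem_spanSP {n : ℕ} (η : Fin n → Quaternion ℝ) : elem η ∈ spanSP n 1 :=
  Submodule.subset_span (elem_mem_SP η)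

theorem elem_add {n : ℕ} (η ζ : Fin n → Quaternion ℝ) :
    elem (η + ζ) = elem η + elem ζ + (pullback η 0 * pullback ζ 1 + pullback ζ 0 * pullback η 1) := by
  simp only [elem, pullback_add, add_mul, mul_add]
  abel

/-- Polarization of the quadratic map `elem`; it provides the mixed products needed to reach every
`ω^i ∧ ω^j`. -/
theorem polar_mem_spanSP {n : ℕ} (η ζ : Fin n → Quaternion ℝ) :
    pullback η 0 * pullback ζ 1 + pullback ζ 0 * pullback η 1 ∈ spanSP n 1 := by
  have : pullback η 0 * pullback ζ 1 + pullback ζ 0 * pullback η 1 =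
      elem (η + ζ) - elem η - elem ζ := by rw [elem_add]; abel
  rw [this]
  exact sub_mem (sub_mem (elem_mem_spanSP _) (elem_mem_spanSP _)) (elem_mem_spanSP _)

theorem polar_single {n : ℕ} (l m : Fin n) (a : Quaternion ℝ) :
    tau a 0 0 • (omega (finProdFinEquiv (l, 0)) * omega (finProdFinEquiv (m, 1))) +
      tau a 0 1 • (omega (finProdFinEquiv (l, 1)) * omega (finProdFinEquiv (m, 1))) +
      tau a 1 0 • (omega (finProdFinEquiv (m, 0)) * omega (finProdFinEquiv (l, 0))) +
      tau a 1 1 • (omega (finProdFinEquiv (m, 0)) * omega (finProdFinEquiv (l, 1))) ∈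
        spanSP n 1 := by
  have h := polar_mem_spanSP (Pi.single l a) (Pi.single m 1)
  simp only [pullback_single_one] at h
  simp only [pullback_single, Fin.sum_univ_two, add_mul, mul_add, smul_mul_assoc,
    mul_smul_comm] at h
  convert h using 1
  abel

theorem omega_mul_omega_mem {n : ℕ} (i j : Fin (n * 2)) : omega i * omega j ∈ spanSP n 1 := by
  obtain ⟨⟨l, s⟩, rfl⟩ := finProdFinEquiv.surjective i
  obtain ⟨⟨m, t⟩, rfl⟩ := finProdFinEquiv.surjective j
  have hI : Complex.I * Complex.I = -1 := Complex.I_mul_I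
  have swap : ∀ i j : Fin (n * 2), omega i * omega j = -(omega j * omega i) := fun i j =>
    ι_mul_ι_swap _ _
  have h1 := fun l m : Fin n => polar_single l m ⟨1, 0, 0, 0⟩
  have h2 := fun l m : Fin n => Submodule.smul_mem _ Complex.I (polar_single l m ⟨0, 1, 0, 0⟩)
  have h3 := fun l m : Fin n => polar_single l m ⟨0, 0, 1, 0⟩
  have h4 := fun l m : Fin n => Submodule.smul_mem _ Complex.I (polar_single l m ⟨0, 0, 0, 1⟩)
  simp only [tau, Matrix.of_apply, Matrix.cons_val_zero, Matrix.cons_val_one] at h1 h2 h3 h4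
  -- The units `1, i` have diagonal `τ` and `j, k` off-diagonal `τ`. Within each pair, multiplying
  -- the second relation by the complex unit and adding or subtracting leaves a single product `ω ∧
  -- ω`.
  have h01 : ∀ l m : Fin n, omega (finProdFinEquiv (l, 0)) * omega (finProdFinEquiv (m, 1)) ∈
      spanSP n 1 := by
    intro l m
    convert Submodule.smul_mem _ (1 / 2 : ℂ) (add_mem (h1 l m) (h2 l m)) using 1
    simp only [smul_add, smul_smul]
    simp [hI]
    module
  have h11 : ∀ l m : Fin n, omega (finProdFinEquiv (l, 1)) * omega (finProdFinEquiv (m, 1)) ∈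
      spanSP n 1 := by
    intro l m
    convert Submodule.smul_mem _ (-1 / 2 : ℂ) (add_mem (h3 l m) (h4 l m)) using 1
    simp only [smul_add, smul_smul]
    simp [hI]
    module
  have h00 : ∀ l m : Fin n, omega (finProdFinEquiv (l, 0)) * omega (finProdFinEquiv (m, 0)) ∈
      spanSP n 1 := by
    intro l m
    convert Submodule.smul_mem _ (1 / 2 : ℂ) (sub_mem (h3 m l) (h4 m l)) using 1
    simp only [smul_add, smul_smul, smul_sub]
    simp [hI]
    module
  fin_cases s <;> fin_cases t
  · exact h00 l m
  · exact h01 l m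
  · change omega (finProdFinEquiv (l, 1)) * omega (finProdFinEquiv (m, 0)) ∈ _
    rw [swap]
    exact neg_mem (h01 m l)
  · exact h11 l m

theorem spanSP_one_mul_mem {n m : ℕ} {v w : Ext n} (hv : v ∈ spanSP n 1) (hw : w ∈ spanSP n m) :
    v * w ∈ spanSP n (m + 1) := by
  induction hv using Submodule.span_induction with
  | mem v hv =>
    induction hw using Submodule.span_induction with
    | mem w hw => exact Submodule.subset_span (SP_one_mul_mem hv hw)
    | zero => simp
    | add a b _ _ ha hb => rw [mul_add]; exact add_mem ha hb
    | smul c a _ ha => rw [mul_smul_comm]; exact Submodule.smul_mem _ _ ha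
  | zero => simp
  | add a b _ _ ha hb => rw [add_mul]; exact add_mem ha hb
  | smul c a _ ha => rw [smul_mul_assoc]; exact Submodule.smul_mem _ _ ha

theorem prod_omega_mem_spanSP {n : ℕ} (m : ℕ) (l : List (Fin (n * 2))) (hl : l.length = 2 * m) :
    (l.map omega).prod ∈ spanSP n m := by
  induction m generalizing l with
  | zero =>
    rw [List.length_eq_zero_iff.1 hl]
    exact Submodule.subset_span (by simpa using one_mem_SP n)
  | succ m ih =>
    match l, hl with
    | i :: j :: l, hl =>
      rw [List.map_cons, List.map_cons, List.prod_cons, List.prod_cons, ← mul_assoc]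
      exact spanSP_one_mul_mem (omega_mul_omega_mem i j)
        (ih l (by simp only [List.length_cons] at hl; omega))

/-- This lets positivity control every coefficient of a current: a form of even degree is a complex
combination of strongly positive ones. -/
theorem extBasis_mem_spanSP {n m : ℕ} (I : Finset (Fin (n * 2))) (hI : I.card = 2 * m) :
    extBasis n I ∈ spanSP n m := by
  rw [show I = ((⟨I, hI⟩ : Set.powersetCard (Fin (n * 2)) (2 * m)) : Finset _) from rfl,
    extBasis_eq_prod]
  have := prod_omega_mem_spanSP m (List.ofFn fun i =>
    Set.powersetCard.ofFinEmbEquiv.symm (⟨I, hI⟩ : Set.powersetCard (Fin (n * 2)) (2 * m)) i)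
    (by simp)
  rwa [List.map_ofFn] at this

/-! ### Duality and degree -/

/-- The witness is `± ω^J` with `J` the complement of `I`: its product with any other basis element
either vanishes or misses top degree. The sign is its own inverse. It represents coordinate
functionals by `topPairing`, the form in which currents with measure coefficients are written. -/
theorem exists_dual_basis {n : ℕ} (I : Finset (Fin (n * 2))) :
    ∃ ψ : Coeff n, ∀ φ : Coeff n, topPairing n φ ψ = φ I := by
  classical
  let s : Set.powersetCard (Fin (n * 2)) Iᶜ.card := ⟨Iᶜ, rfl⟩
  let t : Set.powersetCard (Fin (n * 2)) I.card := ⟨I, rfl⟩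
  have hd : Disjoint s.val t.val := disjoint_compl_left
  obtain ⟨ε, hε⟩ : ∃ ε : ℤˣ, extBasis n Iᶜ * extBasis n I = ε • extBasis n Finset.univ := by
    refine ⟨(Set.powersetCard.permOfDisjoint hd).sign, ?_⟩
    have := ExteriorAlgebra.basis_mul_of_disjoint (Pi.basisFun ℂ (Fin (n * 2))) s t hd
    refine this.trans ?_
    congr 2
    rw [Set.powersetCard.coe_disjUnion]
    ext i
    simp only [Finset.mem_disjUnion, Finset.mem_univ, iff_true, s, t]
    rw [Finset.mem_compl]
    exact (em (i ∈ I)).symm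
  have hoff : ∀ J, J ≠ I → topCoeff (extBasis n Iᶜ * extBasis n J) = 0 := by
    intro J hJ
    let t' : Set.powersetCard (Fin (n * 2)) J.card := ⟨J, rfl⟩
    by_cases h : Disjoint s.val t'.val
    · have h1 := ExteriorAlgebra.basis_mul_of_disjoint (Pi.basisFun ℂ (Fin (n * 2))) s t' h
      change extBasis n Iᶜ * extBasis n J = _ • extBasis n _ at h1
      rw [h1, Units.smul_def, ← topCoeffₗ_apply, map_zsmul, topCoeffₗ_apply, topCoeff_extBasis,
        if_neg, smul_zero]
      intro h2
      apply hJ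
      have h3 : J ⊆ I := by
        have := h.symm.le_compl_right
        simpa [s, t'] using this
      refine h3.antisymm fun i hi => ?_
      have h4 : i ∈ (Finset.univ : Finset (Fin (n * 2))) := Finset.mem_univ i
      rw [← h2, Set.powersetCard.coe_disjUnion, Finset.mem_disjUnion] at h4
      rcases h4 with h4 | h4
      · exact absurd hi (Finset.mem_compl.1 h4)
      · exact h4
    · have h1 := ExteriorAlgebra.basis_mul_of_not_disjoint (Pi.basisFun ℂ (Fin (n * 2))) s t' h
      change extBasis n Iᶜ * extBasis n J = _ at h1
      rw [h1, ← topCoeffₗ_apply, map_zero]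
  refine ⟨((ε : ℤ) : ℂ) • coeff n (extBasis n Iᶜ), fun φ => ?_⟩
  rw [map_smul, topPairing_apply, LinearEquiv.symm_apply_apply]
  have hφ : (coeff n).symm φ = ∑ J, φ J • extBasis n J := by
    rw [LinearEquiv.symm_apply_eq, map_sum]
    ext J
    simp [coeff_extBasis, Finset.sum_apply, Pi.single_apply]
  rw [hφ, Finset.mul_sum, ← topCoeffₗ_apply, map_sum, Finset.sum_eq_single I]
  · rw [mul_smul_comm, map_smul, hε, Units.smul_def, map_zsmul, topCoeffₗ_apply,
      topCoeff_extBasis, if_pos rfl, zsmul_eq_mul, mul_one, smul_eq_mul, smul_eq_mul,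
      mul_left_comm, ← Int.cast_mul, Int.units_coe_mul_self, Int.cast_one, mul_one]
  · intro J _ hJ
    rw [mul_smul_comm, map_smul, topCoeffₗ_apply, hoff J hJ, smul_zero]
  · simp

/-- The elements of `∧ ℂ²ⁿ` without component of degree `p`. -/
def degCompl (n p : ℕ) : Submodule ℂ (Ext n) :=
  Submodule.span ℂ (extBasis n '' {I | I.card ≠ p})

/-- Test forms carry all degrees at once, so the degree of a current is tracked through the absence
of one degree in the test form. -/
theorem omega_mul_mem_degCompl {n p : ℕ} (j : Fin (n * 2)) {w : Ext n} (hw : w ∈ degCompl n p) :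
    omega j * w ∈ degCompl n (p + 1) := by
  classical
  induction hw using Submodule.span_induction with
  | mem w hw =>
    obtain ⟨I, hI, rfl⟩ := hw
    let s : Set.powersetCard (Fin (n * 2)) 1 := ⟨{j}, by simp⟩
    let t : Set.powersetCard (Fin (n * 2)) I.card := ⟨I, rfl⟩
    have hj : omega j = extBasis n s := by
      rw [extBasis_eq_prod]
      simp only [List.ofFn_succ, List.ofFn_zero, List.prod_singleton]
      congr 1
      have := (Set.powersetCard.mem_range_ofFinEmbEquiv_symm_iff_mem s j).2 (by simp [s])
      obtain ⟨a, ha⟩ := this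
      rw [← ha, Subsingleton.elim a 0]
    rw [hj]
    by_cases h : Disjoint s.val t.val
    · have h1 := ExteriorAlgebra.basis_mul_of_disjoint (Pi.basisFun ℂ (Fin (n * 2))) s t h
      change extBasis n s * extBasis n I = _ • extBasis n _ at h1
      rw [h1, Units.smul_def]
      refine zsmul_mem (Submodule.subset_span (mem_image_of_mem _ ?_)) _
      have hc := (Set.powersetCard.disjUnion h).2
      rw [Set.powersetCard.mem_iff] at hc
      rw [mem_ofPred_eq, hc]
      simp only [mem_ofPred_eq] at hI
      omega
    · have h1 := ExteriorAlgebra.basis_mul_of_not_disjoint (Pi.basisFun ℂ (Fin (n * 2))) s t h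
      change extBasis n s * extBasis n I = _ at h1
      rw [h1]
      exact zero_mem _
  | zero => simp
  | add a b _ _ ha hb => rw [mul_add]; exact add_mem ha hb
  | smul c a _ ha => rw [mul_smul_comm]; exact Submodule.smul_mem _ _ ha

theorem ι_mul_mem_degCompl {n p : ℕ} (v : Fin (n * 2) → ℂ) {w : Ext n} (hw : w ∈ degCompl n p) :
    ExteriorAlgebra.ι ℂ v * w ∈ degCompl n (p + 1) := by
  rw [omega_eq_basis, Finset.sum_mul]
  refine Submodule.sum_mem _ fun j _ => ?_
  rw [smul_mul_assoc]
  exact Submodule.smul_mem _ _ (omega_mul_mem_degCompl j hw)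

theorem topCoeff_eq_zero_of_mem_degCompl {n : ℕ} {w : Ext n} (hw : w ∈ degCompl n (2 * n)) :
    topCoeff w = 0 := by
  rw [← topCoeffₗ_apply]
  induction hw using Submodule.span_induction with
  | mem w hw =>
    obtain ⟨I, hI, rfl⟩ := hw
    rw [topCoeffₗ_apply, topCoeff_extBasis, if_neg]
    rintro rfl
    simp [mul_comm] at hI
  | zero => simp
  | add a b _ _ ha hb => rw [map_add, ha, hb, add_zero]
  | smul c a _ ha => rw [map_smul, ha, smul_zero]

end QPlurisubharmonic

end

/-! ### The Baston operator as a linear image of the real Hessian. -/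

noncomputable section

namespace QPlurisubharmonic

theorem wedgeLeft_apply {n : ℕ} (a : Ext n) (φ : Coeff n) :
    wedgeLeft a φ = coeff n (a * (coeff n).symm φ) := rfl

theorem wedgeLeft_wedgeLeft {n : ℕ} (a b : Ext n) (φ : Coeff n) :
    wedgeLeft a (wedgeLeft b φ) = wedgeLeft (a * b) φ := by
  simp [wedgeLeft_apply, mul_assoc]

theorem wedgeLeft_neg {n : ℕ} (a : Ext n) (φ : Coeff n) :
    wedgeLeft (-a) φ = -wedgeLeft a φ := by
  simp [wedgeLeft_apply]

theorem wedgeLeft_smul {n : ℕ} (c : ℂ) (a : Ext n) (φ : Coeff n) :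
    wedgeLeft (c • a) φ = c • wedgeLeft a φ := by
  simp [wedgeLeft_apply]

theorem wedgeLeft_sum {n : ℕ} {ι : Type*} (s : Finset ι) (a : ι → Ext n) (φ : Coeff n) :
    wedgeLeft (∑ i ∈ s, a i) φ = ∑ i ∈ s, wedgeLeft (a i) φ := by
  simp [wedgeLeft_apply, Finset.sum_mul]

/-! ### Quaternionic Hessians -/

/-- The quaternions `1, i, j, k`. -/
def unitQ (m : Fin 4) : Quaternion ℝ :=
  ![⟨1, 0, 0, 0⟩, ⟨0, 1, 0, 0⟩, ⟨0, 0, 1, 0⟩, ⟨0, 0, 0, 1⟩] m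

/-- The right `ℍ`-linear map `q ↦ ē q_l`, `e` being the `m`-th quaternion unit, for `p = (l, m)`. -/
def covec {n : ℕ} (p : Fin n × Fin 4) : Fin n → Quaternion ℝ :=
  Pi.single p.1 (star (unitQ p.2))

theorem re_unitQ (m : Fin 4) : (unitQ m).re = ![1, 0, 0, 0] m := by fin_cases m <;> rfl

theorem imI_unitQ (m : Fin 4) : (unitQ m).imI = ![0, 1, 0, 0] m := by fin_cases m <;> rfl

theorem imJ_unitQ (m : Fin 4) : (unitQ m).imJ = ![0, 0, 1, 0] m := by fin_cases m <;> rfl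

theorem imK_unitQ (m : Fin 4) : (unitQ m).imK = ![0, 0, 0, 1] m := by fin_cases m <;> rfl

/-- The link between the table defining `∇` and pull-backs: it makes `d_α` equal to `∑_p (pull-back
of covec p) ∧ ∂_p` over real coordinates, the form used from here on. -/
theorem nablaCoeff_eq (s α : Fin 2) (m : Fin 4) :
    nablaCoeff s α m = tau (star (unitQ m)) α s := by
  fin_cases s <;> fin_cases α <;> fin_cases m <;>
    simp [nablaCoeff, tau, re_unitQ, imI_unitQ, imJ_unitQ, imK_unitQ]

theorem dForm_eq {n : ℕ} (α : Fin 2) (F : HSpace n → Coeff n) (x : HSpace n) :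
    dForm α F x = ∑ p : Fin n × Fin 4,
      wedgeLeft (pullback (covec p) α) (fderiv ℝ F x (EuclideanSpace.single p 1)) := by
  rw [dForm, ← finProdFinEquiv.sum_comp, Fintype.sum_prod_type, Fintype.sum_prod_type]
  refine Finset.sum_congr rfl fun l _ => ?_
  have h2 : ∀ s : Fin 2, (finProdFinEquiv (l, s)).divNat = l := fun s =>
    congrArg Prod.fst (finProdFinEquiv.symm_apply_apply (l, s))
  have h3 : ∀ s : Fin 2, (finProdFinEquiv (l, s)).modNat = s := fun s =>
    congrArg Prod.snd (finProdFinEquiv.symm_apply_apply (l, s))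
  simp only [nabla, h2, h3, map_sum, covec, pullback_single, wedgeLeft_sum, wedgeLeft_smul,
    map_smul, nablaCoeff_eq, dir]
  rw [Finset.sum_comm]

/-- The `2`-form `∑ A_{pq} (∇_0 x_p) ∧ (∇_1 x_q)` attached to a Hessian matrix `A`. -/
def hessForm {n : ℕ} (A : Matrix (Fin n × Fin 4) (Fin n × Fin 4) ℝ) : Ext n :=
  ∑ p, ∑ q, (A p q : ℂ) • (pullback (covec p) 0 * pullback (covec q) 1)

theorem hessForm_add {n : ℕ} (A B : Matrix (Fin n × Fin 4) (Fin n × Fin 4) ℝ) :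
    hessForm (A + B) = hessForm A + hessForm B := by
  simp [hessForm, add_smul, Finset.sum_add_distrib]

theorem hessForm_smul {n : ℕ} (c : ℝ) (A : Matrix (Fin n × Fin 4) (Fin n × Fin 4) ℝ) :
    hessForm (c • A) = (c : ℂ) • hessForm A := by
  simp only [hessForm, Finset.smul_sum, smul_smul, Matrix.smul_apply, smul_eq_mul,
    Complex.ofReal_mul]

theorem hessForm_zero {n : ℕ} :
    hessForm (0 : Matrix (Fin n × Fin 4) (Fin n × Fin 4) ℝ) = 0 := by
  simp [hessForm]

theorem hessForm_sum {n : ℕ} {ι : Type*} (s : Finset ι)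
    (A : ι → Matrix (Fin n × Fin 4) (Fin n × Fin 4) ℝ) :
    hessForm (∑ i ∈ s, A i) = ∑ i ∈ s, hessForm (A i) := by
  classical
  induction s using Finset.induction_on with
  | empty => simp [hessForm_zero]
  | insert a s ha ih => rw [Finset.sum_insert ha, Finset.sum_insert ha, hessForm_add, ih]

/-- The right linear map `q ↦ ∑ v̄_l q_l`. -/
def conjQ {n : ℕ} (v : Fin n × Fin 4 → ℝ) : Fin n → Quaternion ℝ := ∑ p, v p • covec p

theorem hessForm_vecMulVec {n : ℕ} (v : Fin n × Fin 4 → ℝ) :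
    hessForm (Matrix.vecMulVec v v) = elem (conjQ v) := by
  simp only [elem, conjQ, pullback_sum, pullback_smul, Finset.sum_mul, Finset.mul_sum, hessForm]
  rw [Finset.sum_comm]
  refine Finset.sum_congr rfl fun p _ => Finset.sum_congr rfl fun q _ => ?_
  rw [smul_mul_smul_comm, Matrix.vecMulVec_apply, Complex.ofReal_mul]

/-- The matrix of the right multiplication by the `m`-th quaternion unit. -/
def rmulMatrix (n : ℕ) (m : Fin 4) : Matrix (Fin n × Fin 4) (Fin n × Fin 4) ℝ :=
  fun r p => ofQuat (fun l => (Pi.single p.1 (unitQ p.2) : Fin n → Quaternion ℝ) l * unitQ m) r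

/-- The transpose of right multiplication by a unit `e` is right multiplication by its conjugate;
`covec` involves conjugated units, and conjugation turns this into left multiplication by `e`. -/
theorem sum_rmulMatrix_smul_covec {n : ℕ} (m : Fin 4) (r : Fin n × Fin 4) :
    ∑ p, rmulMatrix n m r p • covec p = unitQ m • covec r := by
  rw [Fintype.sum_prod_type, Finset.sum_eq_single r.1]
  · obtain ⟨l, a⟩ := r
    have : ∀ b, covec (l, b) = star (unitQ b) • (Pi.single l 1 : Fin n → Quaternion ℝ) := by
      intro b
      rw [covec]
      ext i : 1
      by_cases h : i = l
      · subst h; simp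
      · simp [Pi.single_eq_of_ne h]
    simp only [this, smul_smul, ← smul_assoc, ← Finset.sum_smul]
    congr 1
    simp only [rmulMatrix, ofQuat, Pi.single_eq_same]
    ext <;> fin_cases m <;> fin_cases a <;> 
      simp [Fin.sum_univ_four, re_unitQ, imI_unitQ, imJ_unitQ, imK_unitQ]
  · intro l _ hl
    refine Finset.sum_eq_zero fun b _ => ?_
    have : rmulMatrix n m r (l, b) = 0 := by
      obtain ⟨i, a⟩ := r
      simp only [rmulMatrix, ofQuat]
      rw [Pi.single_eq_of_ne (by exact fun h => hl h.symm), zero_mul]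
      fin_cases a <;> rfl
    rw [this, zero_smul]
  · simp

theorem conjQ_vecMul {n : ℕ} (m : Fin 4) (v : Fin n × Fin 4 → ℝ) :
    conjQ (Matrix.vecMul v (rmulMatrix n m)) = unitQ m • conjQ v := by
  simp only [conjQ, Matrix.vecMul, dotProduct, Finset.sum_smul, Finset.smul_sum]
  rw [Finset.sum_comm]
  refine Finset.sum_congr rfl fun r _ => ?_
  rw [smul_comm, ← sum_rmulMatrix_smul_covec, Finset.smul_sum]
  simp [smul_smul]

theorem normSq_unitQ (m : Fin 4) : Quaternion.normSq (unitQ m) = 1 := by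
  rw [Quaternion.normSq_def', re_unitQ, imI_unitQ, imJ_unitQ, imK_unitQ]
  fin_cases m <;> simp

/-- The sum of the pull-backs of a bilinear form under the right multiplications by the quaternion
units. -/
def rightSum {n : ℕ} (A : Matrix (Fin n × Fin 4) (Fin n × Fin 4) ℝ) :
    Matrix (Fin n × Fin 4) (Fin n × Fin 4) ℝ :=
  ∑ m, (rmulMatrix n m).transpose * A * rmulMatrix n m

/-- Pulling back by a right unit multiplies `conjQ v` on the left by a quaternion of norm one, which
leaves its elementary element unchanged; there are four units. -/
theorem hessForm_rightSum_vecMulVec {n : ℕ} (v : Fin n × Fin 4 → ℝ) :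
    hessForm (rightSum (Matrix.vecMulVec v v)) = 4 • hessForm (Matrix.vecMulVec v v) := by
  have h : ∀ m, (rmulMatrix n m).transpose * Matrix.vecMulVec v v * rmulMatrix n m =
      Matrix.vecMulVec (Matrix.vecMul v (rmulMatrix n m)) (Matrix.vecMul v (rmulMatrix n m)) := by
    intro m
    rw [Matrix.mul_vecMulVec, Matrix.vecMulVec_mul, Matrix.mulVec_transpose]
  simp only [rightSum, h, hessForm_sum, hessForm_vecMulVec, conjQ_vecMul, elem_mul_left,
    normSq_unitQ, Complex.ofReal_one, one_smul]
  simp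

/-- Polarization reduces linear identities on symmetric matrices to the rank-one case. -/
theorem symm_eq_sum_vecMulVec {ι : Type*} [Fintype ι] [DecidableEq ι] (A : Matrix ι ι ℝ)
    (hA : A.IsSymm) : A = ∑ p, ∑ q, (A p q / 2 : ℝ) • 
      (Matrix.vecMulVec (Pi.single p (1 : ℝ) + Pi.single q 1) (Pi.single p 1 + Pi.single q 1) +
        (-1 : ℝ) • Matrix.vecMulVec (Pi.single p (1 : ℝ)) (Pi.single p 1) +
        (-1 : ℝ) • Matrix.vecMulVec (Pi.single q (1 : ℝ)) (Pi.single q 1) : Matrix ι ι ℝ) := by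
  have h : ∀ p q : ι, Matrix.vecMulVec (Pi.single p (1 : ℝ) + Pi.single q 1)
      (Pi.single p 1 + Pi.single q 1) +
        (-1 : ℝ) • Matrix.vecMulVec (Pi.single p (1 : ℝ)) (Pi.single p 1) +
        (-1 : ℝ) • Matrix.vecMulVec (Pi.single q (1 : ℝ)) (Pi.single q 1) =
      Matrix.single p q 1 + Matrix.single q p 1 := by
    intro p q
    rw [Matrix.add_vecMulVec, Matrix.vecMulVec_add, Matrix.vecMulVec_add]
    simp only [← Matrix.single_eq_single_vecMulVec_single]
    module
  simp only [h]
  have h1 : A = ∑ p, ∑ q, A p q • Matrix.single p q (1 : ℝ) := by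
    conv_lhs => rw [Matrix.matrix_eq_sum_single A]
    simp [Matrix.smul_single]
  have h2 : A = ∑ p, ∑ q, A p q • Matrix.single q p (1 : ℝ) := by
    conv_lhs => rw [h1, Finset.sum_comm]
    simp only [hA.apply]
  have h3 : ∑ p, ∑ q, (A p q / 2) • (Matrix.single p q (1 : ℝ) + Matrix.single q p 1) =
      (1 / 2 : ℝ) • ∑ p, ∑ q, A p q • Matrix.single p q (1 : ℝ) +
      (1 / 2 : ℝ) • ∑ p, ∑ q, A p q • Matrix.single q p (1 : ℝ) := by
    simp only [Finset.smul_sum, ← Finset.sum_add_distrib]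
    refine Finset.sum_congr rfl fun p _ => Finset.sum_congr rfl fun q _ => ?_
    module
  rw [h3, ← h1, ← h2]
  module

theorem rightSum_add {n : ℕ} (A B : Matrix (Fin n × Fin 4) (Fin n × Fin 4) ℝ) :
    rightSum (A + B) = rightSum A + rightSum B := by
  simp [rightSum, Matrix.mul_add, Matrix.add_mul, Finset.sum_add_distrib]

theorem rightSum_smul {n : ℕ} (c : ℝ) (A : Matrix (Fin n × Fin 4) (Fin n × Fin 4) ℝ) :
    rightSum (c • A) = c • rightSum A := by
  simp [rightSum, Finset.smul_sum]

theorem rightSum_sum {n : ℕ} {ι : Type*} (s : Finset ι)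
    (A : ι → Matrix (Fin n × Fin 4) (Fin n × Fin 4) ℝ) :
    rightSum (∑ i ∈ s, A i) = ∑ i ∈ s, rightSum (A i) := by
  classical
  induction s using Finset.induction_on with
  | empty => simp [rightSum]
  | insert a s ha ih => rw [Finset.sum_insert ha, Finset.sum_insert ha, rightSum_add, ih]

theorem hessForm_rightSum {n : ℕ} {A : Matrix (Fin n × Fin 4) (Fin n × Fin 4) ℝ} (hA : A.IsSymm) :
    hessForm (rightSum A) = 4 • hessForm A := by
  rw [symm_eq_sum_vecMulVec A hA]
  simp only [rightSum_sum, rightSum_add, rightSum_smul, hessForm_sum, hessForm_add, hessForm_smul,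
    hessForm_rightSum_vecMulVec, Finset.smul_sum]
  refine Finset.sum_congr rfl fun p _ => Finset.sum_congr rfl fun q _ => ?_
  module

open scoped MatrixOrder in
-- Writing `A = Bᵀ B` makes `A` the sum of the squares of the rows of `B`, and each square gives an
-- elementary element.
theorem hessForm_mem_SP_of_posSemidef {n : ℕ} {A : Matrix (Fin n × Fin 4) (Fin n × Fin 4) ℝ}
    (hA : A.PosSemidef) : hessForm A ∈ SP n 1 := by
  obtain ⟨B, rfl⟩ : ∃ B : Matrix (Fin n × Fin 4) (Fin n × Fin 4) ℝ, A = B.conjTranspose * B :=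
    CStarAlgebra.nonneg_iff_eq_star_mul_self.1 hA.nonneg
  have : B.conjTranspose * B = ∑ i, Matrix.vecMulVec (B i) (B i) := by
    ext p q
    simp [Matrix.mul_apply, Matrix.sum_apply, Matrix.vecMulVec_apply]
  rw [this, hessForm_sum]
  refine Submodule.sum_mem _ fun i _ => ?_
  rw [hessForm_vecMulVec]
  exact elem_mem_SP _

/-- For a Hessian `A`, the sum over `m` is the Laplacian of the function along the right line in
direction `b`. Its nonnegativity makes `rightSum A` positive semidefinite, and `hessForm` sees `A`
only through that average. -/
theorem hessForm_mem_SP {n : ℕ} {A : Matrix (Fin n × Fin 4) (Fin n × Fin 4) ℝ} (hA : A.IsSymm)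
    (h : ∀ b : Fin n × Fin 4 → ℝ, 0 ≤ ∑ m,
      (rmulMatrix n m).mulVec b ⬝ᵥ A.mulVec ((rmulMatrix n m).mulVec b)) :
    hessForm A ∈ SP n 1 := by
  have hQ : (rightSum A).PosSemidef := by
    refine Matrix.PosSemidef.of_dotProduct_mulVec_nonneg ?_ fun b => ?_
    · rw [Matrix.IsHermitian, Matrix.conjTranspose_eq_transpose_of_trivial, rightSum,
        Matrix.transpose_sum]
      refine Finset.sum_congr rfl fun m _ => ?_
      rw [Matrix.transpose_mul, Matrix.transpose_mul, Matrix.transpose_transpose, hA.eq,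
        Matrix.mul_assoc]
    · refine (h b).trans_eq ?_
      rw [rightSum, Matrix.sum_mulVec, dotProduct_sum]
      refine Finset.sum_congr rfl fun m _ => ?_
      rw [← Matrix.mulVec_mulVec, ← Matrix.mulVec_mulVec, Matrix.dotProduct_mulVec _ _ (A.mulVec _),
        Matrix.vecMul_transpose]
      simp
  have h1 := real_smul_mem_SP (c := 1 / 4) (by norm_num) (hessForm_mem_SP_of_posSemidef hQ)
  rw [hessForm_rightSum hA] at h1
  convert h1 using 1
  push_cast
  module

/-- Used to bound arbitrary Hessian forms by multiples of `β_n`. The factor is 4 because the four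
real directions of each quaternionic coordinate give the same elementary element. -/
theorem hessForm_one {n : ℕ} : hessForm (1 : Matrix (Fin n × Fin 4) (Fin n × Fin 4) ℝ) =
    (4 : ℂ) • beta n := by
  have h : (1 : Matrix (Fin n × Fin 4) (Fin n × Fin 4) ℝ) =
      ∑ p, Matrix.vecMulVec (Pi.single p 1) (Pi.single p 1) := by
    simp only [← Matrix.single_eq_single_vecMulVec_single]
    ext p q
    simp [Matrix.sum_apply, Matrix.one_apply, Matrix.single_apply, ite_and]
  have h1 : ∀ p : Fin n × Fin 4, conjQ (Pi.single p 1) = star (unitQ p.2) •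
      (Pi.single p.1 1 : Fin n → Quaternion ℝ) := by
    intro p
    rw [conjQ, Finset.sum_eq_single p]
    · rw [Pi.single_eq_same, one_smul, covec]
      ext i : 1
      by_cases h : i = p.1
      · subst h; simp
      · simp [Pi.single_eq_of_ne h]
    · intro q _ hq
      rw [Pi.single_eq_of_ne hq, zero_smul]
    · simp
  rw [h, hessForm_sum, beta_eq, Fintype.sum_prod_type, Finset.smul_sum]
  refine Finset.sum_congr rfl fun l _ => ?_
  simp [hessForm_vecMulVec, h1, elem_mul_left, Quaternion.normSq_star, normSq_unitQ,
    ← Nat.cast_smul_eq_nsmul ℂ]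

end QPlurisubharmonic

end

/-! ### Calculus on test forms: Leibniz rule, closed currents, degree. -/

noncomputable section

open scoped ContDiff


namespace QPlurisubharmonic

variable {n : ℕ} {Ω : Opens (HSpace n)}

/-- The `p`-th partial derivative. -/
def pd {E : Type*} [NormedAddCommGroup E] [NormedSpace ℝ E] (p : Fin n × Fin 4)
    (F : HSpace n → E) (x : HSpace n) : E :=
  fderiv ℝ F x (EuclideanSpace.single p 1)

theorem contDiff_pd {E : Type*} [NormedAddCommGroup E] [NormedSpace ℝ E] (p : Fin n × Fin 4)
    {F : HSpace n → E} (hF : ContDiff ℝ ∞ F) : ContDiff ℝ ∞ (pd p F) :=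
  (hF.fderiv_right (m := ∞) (by simp)).clm_apply contDiff_const

theorem pd_comm {E : Type*} [NormedAddCommGroup E] [NormedSpace ℝ E] {F : HSpace n → E}
    {x : HSpace n} (hF : ContDiffAt ℝ 2 F x) (p q : Fin n × Fin 4) :
    pd p (pd q F) x = pd q (pd p F) x := by
  have hd : DifferentiableAt ℝ (fderiv ℝ F) x :=
    (hF.fderiv_right (m := 1) (by norm_num)).differentiableAt (by norm_num)
  have h : ∀ v w : HSpace n, fderiv ℝ (fun y => fderiv ℝ F y w) x v = fderiv ℝ (fderiv ℝ F) x v w := by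
    intro v w
    rw [fderiv_clm_apply hd (differentiableAt_const _)]
    simp
  have hs := hF.isSymmSndFDerivAt (by simp)
  change fderiv ℝ (fun y => fderiv ℝ F y _) x _ = fderiv ℝ (fun y => fderiv ℝ F y _) x _
  rw [h, h]
  exact hs.eq _ _

theorem pd_smul {g : HSpace n → ℂ} {F : HSpace n → Coeff n} {x : HSpace n}
    (hg : DifferentiableAt ℝ g x) (hF : DifferentiableAt ℝ F x) (p : Fin n × Fin 4) :
    pd p (fun y => g y • F y) x = pd p g x • F x + g x • pd p F x := by
  have := (hg.hasFDerivAt.smul hF.hasFDerivAt).fderiv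
  simp only [pd]
  rw [show (fun y => g y • F y) = g • F from rfl, this]
  simp [add_comm]

theorem pd_clm {F : HSpace n → Coeff n} {x : HSpace n} {E : Type*} [NormedAddCommGroup E]
    [NormedSpace ℝ E] [NormedSpace ℂ E] [IsScalarTower ℝ ℂ E]
    (L : Coeff n →L[ℂ] E) (hF : DifferentiableAt ℝ F x) (p : Fin n × Fin 4) :
    pd p (fun y => L (F y)) x = L (pd p F x) := by
  have := ((L.restrictScalars ℝ).hasFDerivAt.comp x hF.hasFDerivAt).fderiv
  simp only [pd]
  rw [show (fun y => L (F y)) = (L.restrictScalars ℝ) ∘ F from rfl, this]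
  rfl

theorem dForm_eq_pd (α : Fin 2) (F : HSpace n → Coeff n) (x : HSpace n) :
    dForm α F x = ∑ p, wedgeLeft (pullback (covec p) α) (pd p F x) := dForm_eq α F x

theorem two_le_infty : (2 : WithTop ℕ∞) ≤ ((⊤ : ℕ∞) : WithTop ℕ∞) := by
  exact ENat.LEInfty.out

theorem contDiff_clm_comp {E : Type*} [NormedAddCommGroup E] [NormedSpace ℝ E] [NormedSpace ℂ E]
    [IsScalarTower ℝ ℂ E] (L : Coeff n →L[ℂ] E) {F : HSpace n → Coeff n} (hF : ContDiff ℝ ∞ F) :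
    ContDiff ℝ ∞ fun x => L (F x) :=
  (ContinuousLinearMap.contDiff (L.restrictScalars ℝ)).comp hF

theorem contDiff_smul_coeff {g : HSpace n → ℂ} (hg : ContDiff ℝ ∞ g) {F : HSpace n → Coeff n}
    (hF : ContDiff ℝ ∞ F) : ContDiff ℝ ∞ fun x => g x • F x :=
  contDiff_pi.2 fun I => hg.mul (contDiff_pi.1 hF I)

/-- The product of a test form by a smooth function and a constant element of `∧ ℂ²ⁿ`. -/
def mulTest (g : HSpace n → ℂ) (hg : ContDiff ℝ ∞ g) (w : Ext n) (η : TestForm Ω) : TestForm Ω where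
  toFun x := g x • wedgeLeft w (η x)
  contDiff' := contDiff_smul_coeff hg (contDiff_clm_comp (wedgeLeft w) η.contDiff)
  hasCompactSupport' := η.hasCompactSupport.mono fun x hx h =>
    hx (show g x • wedgeLeft w (η x) = 0 by rw [h, map_zero, smul_zero])
  tsupport_subset' := Subset.trans (closure_mono (Function.support_subset_iff'.2 fun x hx => by
    rw [Function.notMem_support.1 hx, map_zero, smul_zero])) η.tsupport_subset

theorem mulTest_apply (g : HSpace n → ℂ) (hg : ContDiff ℝ ∞ g) (w : Ext n) (η : TestForm Ω)
    (x : HSpace n) : mulTest g hg w η x = g x • wedgeLeft w (η x) := rfl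

theorem testForm_sum_apply {ι : Type*} (s : Finset ι) (A : ι → TestForm Ω) (x : HSpace n) :
    (∑ i ∈ s, A i : TestForm Ω) x = ∑ i ∈ s, A i x := by
  classical
  induction s using Finset.induction_on with
  | empty => simp
  | insert a s ha ih => rw [Finset.sum_insert ha, Finset.sum_insert ha, ← ih]; rfl

theorem differentiableAt_testForm (η : TestForm Ω) (x : HSpace n) : DifferentiableAt ℝ η x :=
  η.contDiff.contDiffAt.differentiableAt (by simp)

theorem dTest_apply_pd (α : Fin 2) (η : TestForm Ω) (x : HSpace n) :
    dTest Ω α η x = ∑ p, wedgeLeft (pullback (covec p) α) (pd p η x) := by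
  rw [dTest_apply, dForm_eq_pd]

theorem dTest_mulTest_one (α : Fin 2) (g : HSpace n → ℂ) (hg : ContDiff ℝ ∞ g) (η : TestForm Ω) :
    dTest Ω α (mulTest g hg 1 η) =
      ∑ p, mulTest (pd p g) (contDiff_pd p hg) (pullback (covec p) α) η +
        mulTest g hg 1 (dTest Ω α η) := by
  ext1 x
  change _ = (∑ p, mulTest (pd p g) (contDiff_pd p hg) (pullback (covec p) α) η : TestForm Ω) x +
    mulTest g hg 1 (dTest Ω α η) x
  have h1 : ∀ φ : Coeff n, wedgeLeft 1 φ = φ := fun φ => by simp [wedgeLeft_apply]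
  have h2 : ((mulTest g hg 1 η : TestForm Ω) : HSpace n → Coeff n) = fun y => g y • η y := by
    ext1 y; rw [mulTest_apply, h1]
  rw [testForm_sum_apply, dTest_apply_pd, h2, mulTest_apply, h1, dTest_apply_pd, Finset.smul_sum,
    ← Finset.sum_add_distrib]
  refine Finset.sum_congr rfl fun p _ => ?_
  rw [pd_smul (hg.contDiffAt.differentiableAt (by simp)) (differentiableAt_testForm η x), map_add, map_smul,
    map_smul, mulTest_apply]

theorem dTest_mulTest_ι (α : Fin 2) (g : HSpace n → ℂ) (hg : ContDiff ℝ ∞ g)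
    (v : Fin (n * 2) → ℂ) (η : TestForm Ω) :
    dTest Ω α (mulTest g hg (ExteriorAlgebra.ι ℂ v) η) =
      ∑ p, mulTest (pd p g) (contDiff_pd p hg) (pullback (covec p) α * ExteriorAlgebra.ι ℂ v) η -
        mulTest g hg (ExteriorAlgebra.ι ℂ v) (dTest Ω α η) := by
  ext1 x
  change _ = (∑ p, mulTest (pd p g) (contDiff_pd p hg)
    (pullback (covec p) α * ExteriorAlgebra.ι ℂ v) η : TestForm Ω) x -
    mulTest g hg (ExteriorAlgebra.ι ℂ v) (dTest Ω α η) x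
  have h2 : ((mulTest g hg (ExteriorAlgebra.ι ℂ v) η : TestForm Ω) : HSpace n → Coeff n) =
      fun y => g y • wedgeLeft (ExteriorAlgebra.ι ℂ v) (η y) := rfl
  rw [testForm_sum_apply, dTest_apply_pd, h2, mulTest_apply, dTest_apply_pd, map_sum,
    Finset.smul_sum, ← Finset.sum_sub_distrib]
  refine Finset.sum_congr rfl fun p _ => ?_
  have hd : DifferentiableAt ℝ (fun y => wedgeLeft (ExteriorAlgebra.ι ℂ v) (η y)) x :=
    ((wedgeLeft (ExteriorAlgebra.ι ℂ v)).restrictScalars ℝ).differentiableAt.comp x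
      (differentiableAt_testForm η x)
  rw [pd_smul (hg.contDiffAt.differentiableAt (by simp)) hd, map_add, map_smul,
    map_smul, mulTest_apply, pd_clm _ (differentiableAt_testForm η x), wedgeLeft_wedgeLeft,
    wedgeLeft_wedgeLeft, wedgeLeft_wedgeLeft, pullback_eq, ι_mul_ι_swap v, wedgeLeft_neg, smul_neg,
    sub_neg_eq_add]

theorem dTest_dTest_apply (α γ : Fin 2) (η : TestForm Ω) (x : HSpace n) :
    dTest Ω α (dTest Ω γ η) x = ∑ p, ∑ q,
      wedgeLeft (pullback (covec p) α * pullback (covec q) γ) (pd p (pd q η) x) := by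
  rw [dTest_apply_pd]
  refine Finset.sum_congr rfl fun p _ => ?_
  have hd : ∀ q, DifferentiableAt ℝ (fun y => wedgeLeft (pullback (covec q) γ) (pd q η y)) x :=
    fun q => ((wedgeLeft (pullback (covec q) γ)).restrictScalars ℝ).differentiableAt.comp x
      ((contDiff_pd q η.contDiff).contDiffAt.differentiableAt (by simp))
  have h1 : pd p (dTest Ω γ η) x =
      ∑ q, pd p (fun y => wedgeLeft (pullback (covec q) γ) (pd q η y)) x := by
    have : ((dTest Ω γ η : TestForm Ω) : HSpace n → Coeff n) =
        fun y => ∑ q, wedgeLeft (pullback (covec q) γ) (pd q η y) :=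
      funext fun y => dTest_apply_pd γ η y
    rw [this, pd, fderiv_fun_sum fun q _ => hd q, sum_apply]
    rfl
  rw [h1, map_sum]
  refine Finset.sum_congr rfl fun q _ => ?_
  rw [pd_clm _ ((contDiff_pd q η.contDiff).contDiffAt.differentiableAt (by simp)),
    wedgeLeft_wedgeLeft]

/-- Second derivatives are symmetric while the wedge of two vectors is alternating. -/
theorem dTest_dTest_swap (α γ : Fin 2) (η : TestForm Ω) :
    dTest Ω α (dTest Ω γ η) = -dTest Ω γ (dTest Ω α η) := by
  ext1 x
  change _ = -(dTest Ω γ (dTest Ω α η) x)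
  rw [dTest_dTest_apply, dTest_dTest_apply, Finset.sum_comm, ← Finset.sum_neg_distrib]
  refine Finset.sum_congr rfl fun p _ => ?_
  rw [← Finset.sum_neg_distrib]
  refine Finset.sum_congr rfl fun q _ => ?_
  rw [pd_comm (η.contDiff.contDiffAt.of_le two_le_infty), pullback_eq, pullback_eq,
    ι_mul_ι_swap, wedgeLeft_neg]

theorem dTest_dTest_self (α : Fin 2) (η : TestForm Ω) : dTest Ω α (dTest Ω α η) = 0 := by
  ext1 x
  have h := DFunLike.congr_fun (dTest_dTest_swap α α η) x
  exact self_eq_neg.1 h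

/-- Closed currents. -/
def Current.IsClosed (T : Current Ω) : Prop := ∀ (α : Fin 2) (η : TestForm Ω), T (dTest Ω α η) = 0

theorem Current.baston_apply (T : Current Ω) (η : TestForm Ω) :
    T.baston η = T (dTest Ω 0 (dTest Ω 1 η)) := rfl

theorem Current.isClosed_baston (T : Current Ω) : T.baston.IsClosed := by
  intro α η
  rw [Current.baston_apply]
  fin_cases α
  · change T (dTest Ω 0 (dTest Ω 1 (dTest Ω 0 η))) = 0
    rw [dTest_dTest_swap 1 0, map_neg, dTest_dTest_self, neg_zero, map_zero]
  · change T (dTest Ω 0 (dTest Ω 1 (dTest Ω 1 η))) = 0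
    rw [dTest_dTest_self, map_zero, map_zero]

/-- The test form `△u ∧ η`. -/
def bastonMul (u : HSpace n → ℝ) (hu : ContDiff ℝ ∞ u) (η : TestForm Ω) : TestForm Ω :=
  ∑ p, ∑ q, mulTest (fun x => ((pd p (pd q u) x : ℝ) : ℂ))
    (Complex.ofRealCLM.contDiff.comp (contDiff_pd p (contDiff_pd q hu)))
    (pullback (covec p) 0 * pullback (covec q) 1) η

theorem pd_ofReal {u : HSpace n → ℝ} {x : HSpace n} (hu : DifferentiableAt ℝ u x)
    (p : Fin n × Fin 4) : pd p (fun y => (u y : ℂ)) x = ((pd p u x : ℝ) : ℂ) := by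
  have := (Complex.ofRealCLM.hasFDerivAt.comp x hu.hasFDerivAt).fderiv
  simp only [pd]
  rw [show (fun y => (u y : ℂ)) = Complex.ofRealCLM ∘ u from rfl, this]
  rfl

theorem mulTest_congr {g g' : HSpace n → ℂ} (hg : ContDiff ℝ ∞ g) (hg' : ContDiff ℝ ∞ g')
    (h : g = g') (w : Ext n) (η : TestForm Ω) : mulTest g hg w η = mulTest g' hg' w η := by
  subst h; rfl

theorem mulTest_neg_right (g : HSpace n → ℂ) (hg : ContDiff ℝ ∞ g) (w : Ext n) (η : TestForm Ω) :
    mulTest g hg (-w) η = -mulTest g hg w η := by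
  ext1 x
  change _ = -(mulTest g hg w η x)
  rw [mulTest_apply, mulTest_apply, wedgeLeft_neg, smul_neg]

/-- The Leibniz rule `u △η = △u ∧ η` against a closed current. -/
theorem Current.IsClosed.apply_mul_baston {T : Current Ω} (hT : T.IsClosed) (u : HSpace n → ℝ)
    (hu : ContDiff ℝ ∞ u) (hu' : ContDiff ℝ ∞ fun x => (u x : ℂ)) (η : TestForm Ω) :
    T (mulTest (fun x => (u x : ℂ)) hu' 1 (dTest Ω 0 (dTest Ω 1 η))) = T (bastonMul u hu η) := by
  have hpd : ∀ p, pd p (fun x => (u x : ℂ)) = fun x => ((pd p u x : ℝ) : ℂ) := fun p =>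
    funext fun x => pd_ofReal (hu.contDiffAt.differentiableAt (by simp)) p
  have hpd2 : ∀ p q, pd p (pd q (fun x => (u x : ℂ))) = fun x => ((pd p (pd q u) x : ℝ) : ℂ) := by
    intro p q
    rw [hpd]
    exact funext fun x => pd_ofReal ((contDiff_pd q hu).contDiffAt.differentiableAt (by simp)) p
  -- Closedness on `d₀(u d₁η)` gives `T(u △η) = -T(d₀u ∧ d₁η)`.
  have h1 := hT 0 (mulTest (fun x => (u x : ℂ)) hu' 1 (dTest Ω 1 η))
  rw [dTest_mulTest_one, map_add, map_sum] at h1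
  have h2 : ∀ p, T (mulTest (pd p fun x => (u x : ℂ)) (contDiff_pd p hu') (pullback (covec p) 0)
      (dTest Ω 1 η)) = -∑ q, T (mulTest (fun x => ((pd p (pd q u) x : ℝ) : ℂ))
        (Complex.ofRealCLM.contDiff.comp (contDiff_pd p (contDiff_pd q hu)))
        (pullback (covec p) 0 * pullback (covec q) 1) η) := by
    intro p
    -- Closedness once more, on `d₁` applied to each term of `d₀u ∧ η`; the sign from moving `d₁`
    -- past a one-form cancels the previous minus sign after the two vectors are swapped.
    have h3 := hT 1 (mulTest (pd p fun x => (u x : ℂ)) (contDiff_pd p hu')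
      (ExteriorAlgebra.ι ℂ (pullbackVec (covec p) 0)) η)
    rw [dTest_mulTest_ι, map_sub, map_sum, sub_eq_zero] at h3
    rw [pullback_eq, ← h3, ← Finset.sum_neg_distrib]
    refine Finset.sum_congr rfl fun q _ => ?_
    rw [pullback_eq (covec q), ι_mul_ι_swap, mulTest_neg_right, map_neg]
    congr 2
    refine mulTest_congr _ _ ?_ _ _
    rw [hpd2]
    ext x
    rw [pd_comm (hu.contDiffAt.of_le two_le_infty)]
  rw [bastonMul, map_sum]
  simp only [map_sum]
  rw [Finset.sum_congr rfl fun p _ => h2 p, Finset.sum_neg_distrib, neg_add_eq_zero] at h1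
  exact h1.symm

/-- The Hessian matrix. -/
def hessMatrix (u : HSpace n → ℝ) (x : HSpace n) : Matrix (Fin n × Fin 4) (Fin n × Fin 4) ℝ :=
  .of fun p q => pd p (pd q u) x

theorem hessMatrix_isSymm {u : HSpace n → ℝ} {x : HSpace n} (hu : ContDiffAt ℝ 2 u x) :
    (hessMatrix u x).IsSymm := by
  ext p q
  exact pd_comm hu q p

theorem bastonMul_apply (u : HSpace n → ℝ) (hu : ContDiff ℝ ∞ u) (η : TestForm Ω) (x : HSpace n) :
    bastonMul u hu η x = wedgeLeft (hessForm (hessMatrix u x)) (η x) := by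
  simp only [bastonMul, testForm_sum_apply, hessForm, wedgeLeft_sum, wedgeLeft_smul]
  rfl

theorem baston_eq_hessForm {u : HSpace n → ℝ} {x : HSpace n} (hu : ContDiffAt ℝ 2 u x) :
    baston u x = hessForm (hessMatrix u x) := by
  let L : ℂ →L[ℂ] Coeff n := ContinuousLinearMap.smulRight (1 : ℂ →L[ℂ] ℂ) (coeff n 1)
  have hL : ∀ c, L c = coeff n (algebraMap ℂ (Ext n) c) := fun c => by
    simp [L, Algebra.algebraMap_eq_smul_one]
  have hz : zeroForm u = fun y => L (u y) := funext fun y => (hL _).symm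
  have hpdL : ∀ (q : Fin n × Fin 4) (g : HSpace n → ℝ) (y : HSpace n), DifferentiableAt ℝ g y →
      pd q (fun y => L (g y)) y = L ((pd q g y : ℝ) : ℂ) := by
    intro q g y hg
    have := (((L.restrictScalars ℝ).comp Complex.ofRealCLM).hasFDerivAt.comp y hg.hasFDerivAt).fderiv
    simp only [pd]
    rw [show (fun y => L (g y)) = ((L.restrictScalars ℝ).comp Complex.ofRealCLM) ∘ g from rfl, this]
    rfl
  -- The formula for `d₁u` is only available near `x`, where `u` is `C²`; this suffices to
  -- differentiate it at `x`.
  have h1 : dForm 1 (zeroForm u) =ᶠ[nhds x] fun y =>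
      ∑ q, wedgeLeft (pullback (covec q) 1) (L ((pd q u y : ℝ) : ℂ)) := by
    filter_upwards [hu.eventually (by simp)] with y hy
    rw [dForm_eq_pd, hz]
    exact Finset.sum_congr rfl fun q _ => by
      rw [hpdL q u y (hy.differentiableAt (by norm_num))]
  have hd : ∀ q, DifferentiableAt ℝ (pd q u) x := fun q =>
    (((hu.fderiv_right (m := 1) (by norm_num)).clm_apply contDiffAt_const).differentiableAt
      (by norm_num))
  have hdL : ∀ q, DifferentiableAt ℝ (fun y => L ((pd q u y : ℝ) : ℂ)) x := fun q =>
    ((L.restrictScalars ℝ).comp Complex.ofRealCLM).differentiableAt.comp x (hd q)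
  have hdL' : ∀ q, DifferentiableAt ℝ (fun y => wedgeLeft (pullback (covec q) 1) (L ((pd q u y : ℝ) : ℂ))) x :=
    fun q => ((wedgeLeft (pullback (covec q) 1)).restrictScalars ℝ).differentiableAt.comp x (hdL q)
  rw [baston, LinearEquiv.symm_apply_eq, dForm_eq_pd, hessForm, map_sum]
  refine Finset.sum_congr rfl fun p _ => ?_
  have h2 : pd p (dForm 1 (zeroForm u)) x =
      ∑ q, wedgeLeft (pullback (covec q) 1) (L ((pd p (pd q u) x : ℝ) : ℂ)) := by
    rw [pd, h1.fderiv_eq, fderiv_fun_sum fun q _ => hdL' q, sum_apply]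
    refine Finset.sum_congr rfl fun q _ => ?_
    rw [← hpdL p _ x (hd q), ← pd_clm _ (hdL q)]
    rfl
  rw [h2, map_sum, map_sum]
  refine Finset.sum_congr rfl fun q _ => ?_
  rw [wedgeLeft_wedgeLeft, wedgeLeft_apply, hL, LinearEquiv.symm_apply_apply,
    Algebra.algebraMap_eq_smul_one, mul_smul_comm, mul_one]
  rfl

/-! ### Degree -/

theorem symm_mem_degCompl_iff {p : ℕ} {φ : Coeff n} :
    (coeff n).symm φ ∈ degCompl n p ↔ ∀ I : Finset (Fin (n * 2)), I.card = p → φ I = 0 := by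
  constructor
  · intro h I hI
    suffices ∀ w ∈ degCompl n p, coeff n w I = 0 by simpa using this _ h
    intro w hw
    induction hw using Submodule.span_induction with
    | mem w hw =>
      obtain ⟨J, hJ, rfl⟩ := hw
      rw [coeff_extBasis, Pi.single_eq_of_ne]
      rintro rfl
      exact hJ hI
    | zero => simp
    | add a b _ _ ha hb => rw [map_add, Pi.add_apply, ha, hb, add_zero]
    | smul c a _ ha => rw [map_smul, Pi.smul_apply, ha, smul_zero]
  · intro h
    have hφ : φ = ∑ I, Pi.single I (φ I) := (Finset.univ_sum_single φ).symm
    rw [hφ, map_sum]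
    refine Submodule.sum_mem _ fun I _ => ?_
    rw [coeff_symm_single]
    by_cases hI : I.card = p
    · rw [h I hI, zero_smul]; exact zero_mem _
    · exact Submodule.smul_mem _ _ (Submodule.subset_span ⟨I, hI, rfl⟩)

theorem dTest_mem_degCompl {p : ℕ} (α : Fin 2) {η : TestForm Ω}
    (hη : ∀ x, (coeff n).symm (η x) ∈ degCompl n p) (x : HSpace n) :
    (coeff n).symm (dTest Ω α η x) ∈ degCompl n (p + 1) := by
  rw [dTest_apply_pd, map_sum]
  refine Submodule.sum_mem _ fun q _ => ?_
  rw [wedgeLeft_apply, LinearEquiv.symm_apply_apply, pullback_eq]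
  refine ι_mul_mem_degCompl _ (symm_mem_degCompl_iff.2 fun I hI => ?_)
  have h1 := (ContinuousLinearMap.proj (R := ℂ) (φ := fun _ : Finset (Fin (n * 2)) => ℂ) I)
  have h2 : pd q (fun y => η y I) x = pd q η x I :=
    pd_clm (ContinuousLinearMap.proj (R := ℂ) (φ := fun _ : Finset (Fin (n * 2)) => ℂ) I)
      (differentiableAt_testForm η x) q
  rw [← h2]
  have h3 : (fun y => η y I) = fun _ => (0 : ℂ) :=
    funext fun y => symm_mem_degCompl_iff.1 (hη y) I hI
  rw [h3]
  simp [pd]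

/-- Currents which only depend on the component of degree `p` of the test form. -/
def Current.HasDim (p : ℕ) (T : Current Ω) : Prop :=
  ∀ η : TestForm Ω, (∀ x, (coeff n).symm (η x) ∈ degCompl n p) → T η = 0

/-- The current of integration is closed. -/
theorem Current.isClosed_one : (Current.one Ω).IsClosed := by
  intro α η
  have hloc : LocallyIntegrableOn (fun _ : HSpace n => coeff n 1) Ω volume :=
    (locallyIntegrable_const _).locallyIntegrableOn _
  rw [Current.one, Current.ofMeasure, TestFunction.integralAgainstBilinCLM_eq_integral hloc]
  let B : Fin n × Fin 4 → Coeff n →L[ℂ] ℂ := fun p =>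
    ((topPairing n).flip (coeff n 1)).comp (wedgeLeft (pullback (covec p) α))
  have h1 : ∀ x, topPairing n (dTest Ω α η x) (coeff n 1) = ∑ p, B p (pd p η x) := by
    intro x
    rw [dTest_apply_pd, map_sum, sum_apply]
    rfl
  have hcd : ∀ p, ContDiff ℝ ∞ fun x => B p (η x) := fun p =>
    contDiff_clm_comp (B p) η.contDiff
  have hcs : ∀ p, HasCompactSupport fun x => B p (η x) := fun p =>
    η.hasCompactSupport.comp_left (g := fun v => B p v) (map_zero _)
  have h2 : ∀ p, (fun x => B p (pd p η x)) = fun x =>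
      fderiv ℝ (fun y => B p (η y)) x (EuclideanSpace.single p 1) := fun p =>
    funext fun x => (pd_clm (B p) (differentiableAt_testForm η x) p).symm
  have hint : ∀ p, Integrable (fun x =>
      fderiv ℝ (fun y => B p (η y)) x (EuclideanSpace.single p 1)) (volume : Measure (HSpace n)) :=
    fun p => (((hcd p).fderiv_right (m := ∞) (by simp)).clm_apply
      contDiff_const).continuous.integrable_of_hasCompactSupport
        ((hcs p).fderiv_apply ℝ _)
  simp only [h1]
  rw [integral_finsetSum _ fun p _ => by rw [h2]; exact hint p]
  refine Finset.sum_eq_zero fun p _ => ?_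
  rw [h2]
  -- Integration by parts against the constant `1`: a derivative of a compactly supported function
  -- has integral zero.
  have := integral_mul_fderiv_eq_neg_fderiv_mul_of_integrable (𝕜 := ℂ)
    (μ := (volume : Measure (HSpace n))) (f := fun _ : HSpace n => (1 : ℂ))
    (g := fun y => B p (η y)) (v := EuclideanSpace.single p 1) (by simp) (by simpa using hint p)
    (by simpa using (hcd p).continuous.integrable_of_hasCompactSupport (hcs p))
    (by fun_prop) fun x _ => (hcd p).differentiable (by simp) x
  simpa using this

end QPlurisubharmonic

end

noncomputable section

open scoped Topology


namespace QPlurisubharmonic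

variable {n : ℕ} {Ω : Opens (HSpace n)}

/-! ### Right multiplication by quaternions -/

/-- The quaternionic coordinates of a point of `ℍⁿ`. -/
def toQuat (x : HSpace n) (l : Fin n) : Quaternion ℝ := ⟨x (l, 0), x (l, 1), x (l, 2), x (l, 3)⟩

theorem ofQuat_toQuat (x : HSpace n) : ofQuat (toQuat x) = x := by
  ext ⟨l, a⟩
  fin_cases a <;> rfl

theorem ofQuat_add (q q' : Fin n → Quaternion ℝ) : ofQuat (q + q') = ofQuat q + ofQuat q' := by
  ext ⟨l, a⟩
  fin_cases a <;> rfl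

theorem ofQuat_smul (c : ℝ) (q : Fin n → Quaternion ℝ) : ofQuat (c • q) = c • ofQuat q := by
  ext ⟨l, a⟩
  fin_cases a <;> rfl

theorem toQuat_add (x y : HSpace n) : toQuat (x + y) = toQuat x + toQuat y := rfl

theorem toQuat_smul (c : ℝ) (x : HSpace n) : toQuat (c • x) = c • toQuat x := rfl

/-- The product `b t` of a point of `ℍⁿ` and a quaternion. -/
def hmul (b : HSpace n) (t : EuclideanSpace ℝ (Fin 4)) : HSpace n :=
  ofQuat fun l => toQuat b l * quatOf t

theorem rightLine_toQuat (x b : HSpace n) (t : EuclideanSpace ℝ (Fin 4)) :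
    rightLine (toQuat x) (toQuat b) t = x + hmul b t := by
  conv_rhs => rw [← ofQuat_toQuat x]
  rw [hmul, ← ofQuat_add]
  rfl

theorem quatOf_add (s t : EuclideanSpace ℝ (Fin 4)) : quatOf (s + t) = quatOf s + quatOf t := rfl

theorem quatOf_smul (c : ℝ) (t : EuclideanSpace ℝ (Fin 4)) : quatOf (c • t) = c • quatOf t := rfl

theorem norm_ofQuat_sq (q : Fin n → Quaternion ℝ) :
    ‖ofQuat q‖ ^ 2 = ∑ l, Quaternion.normSq (q l) := by
  rw [EuclideanSpace.norm_sq_eq, Fintype.sum_prod_type]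
  refine Finset.sum_congr rfl fun l _ => ?_
  simp [Fin.sum_univ_four, ofQuat, Quaternion.normSq_def']

theorem normSq_quatOf (t : EuclideanSpace ℝ (Fin 4)) : Quaternion.normSq (quatOf t) = ‖t‖ ^ 2 := by
  rw [EuclideanSpace.norm_sq_eq, Quaternion.normSq_def']
  simp [Fin.sum_univ_four, quatOf]

theorem norm_hmul (b : HSpace n) (t : EuclideanSpace ℝ (Fin 4)) : ‖hmul b t‖ = ‖b‖ * ‖t‖ := by
  have h : ‖hmul b t‖ ^ 2 = (‖b‖ * ‖t‖) ^ 2 := by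
    rw [hmul, norm_ofQuat_sq, mul_pow, ← normSq_quatOf]
    conv_rhs => rw [← ofQuat_toQuat b, norm_ofQuat_sq, Finset.sum_mul]
    simp
  exact (sq_eq_sq₀ (norm_nonneg _) (by positivity)).1 h

/-- `hmul` as a bilinear map. -/
def hmulₗ (n : ℕ) : HSpace n →ₗ[ℝ] EuclideanSpace ℝ (Fin 4) →ₗ[ℝ] HSpace n :=
  LinearMap.mk₂ ℝ hmul
    (fun b b' t => by
      rw [hmul, hmul, hmul, ← ofQuat_add, toQuat_add]; congr 1; ext l : 1; exact add_mul _ _ _)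
    (fun c b t => by
      rw [hmul, hmul, ← ofQuat_smul, toQuat_smul]; congr 1; ext l : 1; exact smul_mul_assoc c (toQuat b l) (quatOf t))
    (fun b t t' => by
      rw [hmul, hmul, hmul, ← ofQuat_add, quatOf_add]; congr 1; ext l : 1; exact mul_add _ _ _)
    (fun c b t => by
      rw [hmul, hmul, ← ofQuat_smul, quatOf_smul]; congr 1; ext l : 1; exact mul_smul_comm c (toQuat b l) (quatOf t))

/-- `hmul` as a continuous bilinear map. -/
def hmulL (n : ℕ) : HSpace n →L[ℝ] EuclideanSpace ℝ (Fin 4) →L[ℝ] HSpace n :=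
  (hmulₗ n).mkContinuous₂ 1 fun b t => by
    rw [one_mul]; exact (norm_hmul b t).le

theorem hmulL_apply (b : HSpace n) (t : EuclideanSpace ℝ (Fin 4)) : hmulL n b t = hmul b t := rfl

theorem continuous_hmul : Continuous fun p : HSpace n × EuclideanSpace ℝ (Fin 4) =>
    hmul p.1 p.2 :=
  (hmulL n).continuous₂

/-- A point `t ≠ 0` of the unit ball of `ℍ` acts on `ℍⁿ` as a volume decreasing map. -/
theorem lintegral_le_lintegral_hmul {t : EuclideanSpace ℝ (Fin 4)} (ht : t ≠ 0) (ht1 : ‖t‖ ≤ 1)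
    (F : HSpace n → ℝ≥0∞) (hF : Measurable F) :
    ∫⁻ z, F z ∂volume ≤ ∫⁻ b, F (hmul b t) ∂volume := by
  let R : HSpace n →ₗ[ℝ] HSpace n := (hmulₗ n).flip t
  have hR : ∀ b, R b = hmul b t := fun b => rfl
  have hdet : LinearMap.det R ≠ 0 := by
    have hinj : Function.Injective R := by
      rw [← LinearMap.ker_eq_bot, LinearMap.ker_eq_bot']
      intro b hb
      have := norm_hmul b t
      rw [← hR, hb, norm_zero] at this
      rcases mul_eq_zero.1 this.symm with h | h
      · exact norm_eq_zero.1 h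
      · exact absurd (norm_eq_zero.1 h) ht
    exact (LinearEquiv.isUnit_det' (LinearEquiv.ofInjectiveEndo R hinj)).ne_zero
  -- The map sends the unit ball into itself, so it cannot increase volume.
  have hle : ENNReal.ofReal |LinearMap.det R| ≤ 1 := by
    have h1 := Measure.addHaar_image_linearMap volume R (Metric.closedBall 0 1)
    have h2 : volume (R '' Metric.closedBall 0 1) ≤
        volume (Metric.closedBall (0 : HSpace n) 1) := by
      refine measure_mono ?_
      rintro _ ⟨b, hb, rfl⟩
      rw [mem_closedBall_zero_iff] at hb ⊢
      rw [hR, norm_hmul]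
      exact mul_le_one₀ hb (norm_nonneg _) ht1
    have h3 : volume (Metric.closedBall (0 : HSpace n) 1) ≠ 0 :=
      (Metric.measure_closedBall_pos _ _ one_pos).ne'
    have h4 : volume (Metric.closedBall (0 : HSpace n) 1) ≠ ∞ := measure_closedBall_lt_top.ne
    rw [h1] at h2
    by_contra! h5
    have h6 := ENNReal.mul_lt_mul_left h3 h4 h5
    rw [one_mul] at h6
    exact absurd h2 (not_le.2 h6)
  have hmap := Measure.map_linearMap_addHaar_eq_smul_addHaar volume hdet
  have hmeas : Measurable R := R.continuous_of_finiteDimensional.measurable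
  calc ∫⁻ z, F z ∂volume ≤ ENNReal.ofReal |(LinearMap.det R)⁻¹| * ∫⁻ z, F z ∂volume := by
        refine le_mul_of_one_le_left zero_le ?_
        rw [abs_inv, ENNReal.one_le_ofReal]
        rw [ENNReal.ofReal_le_one] at hle
        exact (one_le_inv₀ (abs_pos.2 hdet)).2 hle
    _ = ∫⁻ z, F z ∂(Measure.map R volume) := by rw [hmap, lintegral_smul_measure, smul_eq_mul]
    _ = ∫⁻ b, F (hmul b t) ∂volume := lintegral_map hF hmeas

/-! ### Lebesgue points of plurisubharmonic functions -/

/-- If `f ≤ ε` then `|f| ≤ 2ε - f`, and the nonnegative integral of `f` can be dropped. It turns an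
upper bound plus a sub-mean inequality into an `L¹` bound. -/
theorem lintegral_enorm_le_of_le {α : Type*} [MeasurableSpace α] {ν : Measure α} [IsFiniteMeasure ν]
    {f : α → ℝ} {ε : ℝ} (hf : Integrable f ν) (h : ∀ᵐ x ∂ν, f x ≤ ε) (hε : 0 ≤ ε)
    (h0 : 0 ≤ ∫ x, f x ∂ν) : ∫⁻ x, ‖f x‖ₑ ∂ν ≤ ENNReal.ofReal (2 * ε) * ν univ := by
  rw [← ofReal_integral_norm_eq_lintegral_enorm hf]
  have h1 : ∫ x, ‖f x‖ ∂ν ≤ ∫ x, (2 * ε - f x) ∂ν := by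
    refine integral_mono_ae hf.norm ((integrable_const _).sub hf) ?_
    filter_upwards [h] with x hx
    rw [Real.norm_eq_abs]
    rcases abs_cases (f x) with ⟨h, -⟩ | ⟨h, -⟩ <;> rw [h] <;> linarith
  rw [integral_sub (integrable_const _) hf, integral_const, smul_eq_mul] at h1
  calc ENNReal.ofReal (∫ x, ‖f x‖ ∂ν) ≤ ENNReal.ofReal (2 * ε * ν.real univ) :=
        ENNReal.ofReal_le_ofReal (by linarith [mul_comm (ν.real univ) (2 * ε)])
    _ = ENNReal.ofReal (2 * ε) * ν univ := by
        rw [ENNReal.ofReal_mul (by positivity), ofReal_measureReal]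

theorem IsPSH.measurable_indicator {u : HSpace n → ℝ} (hu : IsPSH Ω u) :
    Measurable (indicator (Ω : Set (HSpace n)) u) := by
  have h1 : Measurable fun x : Ω => u x := by
    refine UpperSemicontinuous.measurable ?_
    exact upperSemicontinuousOn_iff_restrict.2 hu.usc
  refine measurable_of_restrict_of_restrict_compl Ω.isOpen.measurableSet ?_ ?_
  · have h : (Ω : Set (HSpace n)).domRestrict (indicator (Ω : Set (HSpace n)) u) =
        fun x : Ω => u x := funext fun x => indicator_of_mem x.2 u
    rw [h]
    exact h1
  · have h : (Ω : Set (HSpace n))ᶜ.domRestrict (indicator (Ω : Set (HSpace n)) u) =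
        fun _ => 0 := funext fun x => indicator_of_notMem x.2 u
    rw [h]
    exact measurable_const

theorem IsPSH.line_integrable {u : HSpace n → ℝ} (hu : IsPSH Ω u) {x b : HSpace n} {r : ℝ}
    (hb : ‖b‖ ≤ r) (hx : Metric.closedBall x r ⊆ Ω) :
    IntegrableOn (fun t => u (x + hmul b t)) (Metric.closedBall 0 1) volume ∧
      u x ≤ ⨍ t in Metric.closedBall 0 1, u (x + hmul b t) ∂volume := by
  have hsub : Metric.closedBall (0 : EuclideanSpace ℝ (Fin 4)) 1 ⊆
      {t | rightLine (toQuat x) (toQuat b) t ∈ Ω} := by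
    intro t ht
    rw [mem_closedBall_zero_iff] at ht
    refine hx ?_
    rw [rightLine_toQuat, Metric.mem_closedBall, dist_eq_norm, add_sub_cancel_left, norm_hmul]
    calc ‖b‖ * ‖t‖ ≤ ‖b‖ * 1 := by gcongr
      _ ≤ r := by rwa [mul_one]
  have h := hu.subharmonic (toQuat x) (toQuat b)
  have h1 := h.integrableOn 0 1 one_pos hsub
  have h2 := h.le_average 0 1 one_pos hsub
  have h0 : hmul b 0 = 0 := (hmulL n b).map_zero
  simp only [rightLine_toQuat, h0, add_zero] at h1 h2
  exact ⟨h1, h2⟩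

/-- Every point of `Ω` is a Lebesgue point. Semicontinuity gives `u ≤ u x + ε` near `x`; with the
sub-mean inequality this bounds the `L¹` oscillation on each right line through `x` by `2ε`.
Integrating over the directions `b` and comparing `b t` with Lebesgue measure gives the bound on
balls. -/
theorem IsPSH.exists_lintegral_enorm_sub_le (n : ℕ) :
    ∃ C : ℝ, 0 < C ∧ ∀ (Ω : Opens (HSpace n)) (u : HSpace n → ℝ), IsPSH Ω u → ∀ x ∈ Ω, ∀ ε : ℝ,
      0 < ε → ∃ r₀ : ℝ, 0 < r₀ ∧ Metric.closedBall x r₀ ⊆ Ω ∧ ∀ r, 0 < r → r ≤ r₀ →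
        ∫⁻ y in Metric.closedBall x r, ‖u y - u x‖ₑ ∂volume ≤
          ENNReal.ofReal (C * ε) * volume (Metric.closedBall x r) := by
  let B : Set (EuclideanSpace ℝ (Fin 4)) := Metric.closedBall 0 1
  -- On this shell `‖t‖ ≥ 1/2`, so `‖b t‖ ≤ r` forces `‖b‖ ≤ 2r`; and `‖t‖ ≤ 1` keeps `b ↦ b t`
  -- volume decreasing.
  let A : Set (EuclideanSpace ℝ (Fin 4)) := Metric.closedBall 0 1 \ Metric.ball 0 (1 / 2)
  have hB : volume B ≠ ∞ := measure_closedBall_lt_top.ne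
  have hA0 : volume A ≠ 0 := by
    have h1 : Metric.ball (EuclideanSpace.single 0 (3 / 4) : EuclideanSpace ℝ (Fin 4)) (1 / 4) ⊆
        A := by
      intro t ht
      rw [mem_ball_iff_norm] at ht
      have h3 : ‖(EuclideanSpace.single 0 (3 / 4) : EuclideanSpace ℝ (Fin 4))‖ = 3 / 4 := by
        simp
      have h4 := norm_sub_norm_le t (EuclideanSpace.single 0 (3 / 4))
      have h5 := norm_sub_norm_le (EuclideanSpace.single 0 (3 / 4)) t
      rw [norm_sub_rev] at h5
      refine ⟨mem_closedBall_zero_iff.2 (by linarith), fun h => ?_⟩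
      rw [mem_ball_zero_iff] at h
      linarith
    exact fun h => (Metric.measure_ball_pos volume _ (by norm_num)).ne' (measure_mono_null h1 h)
  have hAt : volume A ≠ ∞ := ((measure_mono sdiff_subset).trans_lt hB.lt_top).ne
  let V : ℝ := (volume B / volume A).toReal
  -- The factor 2 comes from the `L¹` bound on lines, `V` is the ratio of the volumes of the ball
  -- and the shell, and the power of 2 is the cost of letting `b` range over radius `2r`. The `+ 1`
  -- makes strict positivity immediate.
  refine ⟨2 * V * 2 ^ (Module.finrank ℝ (HSpace n)) + 1, by positivity, ?_⟩
  intro Ω u hu x hx ε hε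
  obtain ⟨r₁, hr₁, hball⟩ := Metric.isOpen_iff.1 Ω.isOpen x hx
  have husc := hu.usc x hx (u x + ε) (by linarith)
  rw [Filter.Eventually, IsOpen.nhdsWithin_eq Ω.isOpen hx, Metric.mem_nhds_iff] at husc
  obtain ⟨r₂, hr₂, hball₂⟩ := husc
  let R := min r₁ r₂ / 2
  have hR : 0 < R := by positivity
  have hR1 : Metric.closedBall x R ⊆ Ω :=
    (Metric.closedBall_subset_ball (by
      have := min_le_left r₁ r₂; have : 0 < min r₁ r₂ := by positivity
      simp only [R]; linarith)).trans hball
  have hR2 : ∀ y ∈ Metric.closedBall x R, u y < u x + ε := fun y hy =>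
    hball₂ (Metric.closedBall_subset_ball (by
      have := min_le_right r₁ r₂; have : 0 < min r₁ r₂ := by positivity
      simp only [R]; linarith) hy)
  refine ⟨R / 2, by positivity, (Metric.closedBall_subset_closedBall (by linarith)).trans hR1, ?_⟩
  intro r hr hrR
  let w : HSpace n → ℝ := fun y => indicator (Ω : Set (HSpace n)) u y - u x
  have hwm : Measurable w := hu.measurable_indicator.sub_const _
  have hw : ∀ y ∈ Metric.closedBall x R, w y = u y - u x := fun y hy => by
    simp only [w]; rw [indicator_of_mem (hR1 hy)]
  -- the estimate on the lines through `x`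
  have hline : ∀ b ∈ Metric.closedBall (0 : HSpace n) (2 * r),
      ∫⁻ t in B, ‖w (x + hmul b t)‖ₑ ∂volume ≤ ENNReal.ofReal (2 * ε) * volume B := by
    intro b hb
    rw [mem_closedBall_zero_iff] at hb
    have hmem : ∀ t ∈ B, x + hmul b t ∈ Metric.closedBall x R := by
      intro t ht
      rw [mem_closedBall_zero_iff] at ht
      rw [Metric.mem_closedBall, dist_eq_norm, add_sub_cancel_left, norm_hmul]
      calc ‖b‖ * ‖t‖ ≤ (2 * r) * 1 := by gcongr
        _ ≤ R := by linarith
    obtain ⟨h1, h2⟩ := hu.line_integrable (r := R) (by linarith) hR1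
    have hBm : MeasurableSet B := measurableSet_closedBall
    have heq : ∀ t ∈ B, w (x + hmul b t) = u (x + hmul b t) - u x := fun t ht => hw _ (hmem t ht)
    have : IsFiniteMeasure (volume.restrict B) := ⟨by rwa [Measure.restrict_apply_univ, lt_top_iff_ne_top]⟩
    have hBpos : 0 < volume.real B := by
      rw [measureReal_def, ENNReal.toReal_pos_iff]
      exact ⟨Metric.measure_closedBall_pos _ _ one_pos, hB.lt_top⟩
    have hint : IntegrableOn (fun t => w (x + hmul b t)) B volume :=
      ((h1.sub (integrable_const (u x))).congr
        ((ae_restrict_mem hBm).mono fun t ht => (heq t ht).symm))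
    have h3 := lintegral_enorm_le_of_le (ν := volume.restrict B) (ε := ε) hint
      ((ae_restrict_mem hBm).mono fun t ht => by
        rw [heq t ht]; linarith [hR2 _ (hmem t ht)]) hε.le (by
          rw [setIntegral_congr_fun hBm heq, integral_sub h1 (integrable_const _), integral_const,
            sub_nonneg, measureReal_restrict_apply_univ, smul_eq_mul]
          rw [setAverage_eq, smul_eq_mul, ← div_eq_inv_mul, le_div_iff₀ hBpos] at h2
          linarith)
    rwa [Measure.restrict_apply_univ] at h3
  -- integrate over `b` and exchange the integrals
  have hjm : Measurable fun p : HSpace n × EuclideanSpace ℝ (Fin 4) => ‖w (x + hmul p.1 p.2)‖ₑ :=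
    (hwm.comp (continuous_hmul.measurable.const_add x)).enorm
  let S : ℝ≥0∞ := ∫⁻ y in Metric.closedBall x r, ‖u y - u x‖ₑ ∂volume
  have hlow : ∀ t ∈ A, S ≤ ∫⁻ b in Metric.closedBall (0 : HSpace n) (2 * r),
      ‖w (x + hmul b t)‖ₑ ∂volume := by
    intro t ht
    have ht1 : ‖t‖ ≤ 1 := mem_closedBall_zero_iff.1 ht.1
    have ht2 : 1 / 2 ≤ ‖t‖ := not_lt.1 fun h => ht.2 (mem_ball_zero_iff.2 h)
    have ht0 : t ≠ 0 := by rintro rfl; rw [norm_zero] at ht2; norm_num at ht2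
    let F : HSpace n → ℝ≥0∞ := indicator (Metric.closedBall 0 r) fun z => ‖w (x + z)‖ₑ
    have hF : Measurable F :=
      ((hwm.comp (measurable_const_add x)).enorm).indicator measurableSet_closedBall
    calc S = ∫⁻ y in Metric.closedBall x r, ‖w y‖ₑ ∂volume := by
          refine setLIntegral_congr_fun measurableSet_closedBall fun y hy => ?_
          rw [hw y (Metric.closedBall_subset_closedBall (by linarith) hy)]
      _ = ∫⁻ z, F z ∂volume := by
          rw [← lintegral_indicator measurableSet_closedBall,
            ← lintegral_add_left_eq_self _ x]
          refine lintegral_congr fun z => ?_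
          classical
          simp only [F, indicator_apply, Metric.mem_closedBall, dist_eq_norm, add_sub_cancel_left,
            sub_zero]
      _ ≤ ∫⁻ b, F (hmul b t) ∂volume := lintegral_le_lintegral_hmul ht0 ht1 F hF
      _ ≤ _ := by
          rw [← lintegral_indicator measurableSet_closedBall]
          refine lintegral_mono fun b => ?_
          classical
          simp only [F, indicator_apply, mem_closedBall_zero_iff, norm_hmul]
          split_ifs with h1 h2
          · exact le_rfl
          · exfalso
            apply h2
            nlinarith [norm_nonneg b]
          · exact zero_le
          · exact le_rfl
  -- Average the lower bound over `t` in the shell, enlarge the shell to the ball, exchange the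
  -- integrals, and use the bound on each line.
  have hmain : S * volume A ≤ ENNReal.ofReal (2 * ε) * volume B *
      volume (Metric.closedBall (0 : HSpace n) (2 * r)) := by
    calc S * volume A = ∫⁻ t in A, S ∂volume := by rw [setLIntegral_const]
      _ ≤ ∫⁻ t in A, ∫⁻ b in Metric.closedBall (0 : HSpace n) (2 * r),
          ‖w (x + hmul b t)‖ₑ ∂volume ∂volume :=
        setLIntegral_mono' (measurableSet_closedBall.diff measurableSet_ball) hlow
      _ ≤ ∫⁻ t in B, ∫⁻ b in Metric.closedBall (0 : HSpace n) (2 * r),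
          ‖w (x + hmul b t)‖ₑ ∂volume ∂volume := lintegral_mono_set sdiff_subset
      _ = ∫⁻ b in Metric.closedBall (0 : HSpace n) (2 * r), ∫⁻ t in B,
          ‖w (x + hmul b t)‖ₑ ∂volume ∂volume :=
        (lintegral_lintegral_swap hjm.aemeasurable).symm
      _ ≤ ∫⁻ b in Metric.closedBall (0 : HSpace n) (2 * r),
          ENNReal.ofReal (2 * ε) * volume B ∂volume :=
        setLIntegral_mono' measurableSet_closedBall hline
      _ = _ := by rw [setLIntegral_const]
  have hvol : volume (Metric.closedBall (0 : HSpace n) (2 * r)) =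
      ENNReal.ofReal (2 ^ (Module.finrank ℝ (HSpace n))) * volume (Metric.closedBall x r) := by
    rw [Measure.addHaar_closedBall_mul_of_pos _ _ (by norm_num : (0 : ℝ) < 2),
      ← Measure.addHaar_closedBall_center volume x]
  have hVB : volume B = ENNReal.ofReal V * volume A := by
    simp only [V]
    rw [ENNReal.ofReal_toReal (ENNReal.div_ne_top hB hA0), ENNReal.div_mul_cancel hA0 hAt]
  rw [hvol, hVB] at hmain
  have hmain2 : S * volume A ≤ (ENNReal.ofReal ((2 * V * 2 ^ (Module.finrank ℝ (HSpace n)) + 1) * ε)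
      * volume (Metric.closedBall x r)) * volume A := by
    refine hmain.trans ?_
    have h1 : ENNReal.ofReal (2 * ε) * (ENNReal.ofReal V * volume A) *
        (ENNReal.ofReal (2 ^ (Module.finrank ℝ (HSpace n))) * volume (Metric.closedBall x r)) =
        (ENNReal.ofReal (2 * ε * V * 2 ^ (Module.finrank ℝ (HSpace n))) *
          volume (Metric.closedBall x r)) * volume A := by
      have hV : 0 ≤ V := ENNReal.toReal_nonneg
      rw [mul_assoc (2 * ε), ENNReal.ofReal_mul (by positivity : 0 ≤ 2 * ε),
        ENNReal.ofReal_mul hV]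
      ring
    rw [h1]
    refine mul_le_mul_left (mul_le_mul_left (ENNReal.ofReal_le_ofReal ?_) _) _
    nlinarith
  exact (ENNReal.mul_le_mul_iff_left hA0 hAt).1 hmain2

end QPlurisubharmonic

end

noncomputable section

open scoped ContDiff Topology


namespace QPlurisubharmonic

variable {n : ℕ} {Ω : Opens (HSpace n)}

/-! ### Second order Taylor expansion and the sub-mean value inequality -/

/-- Mean value inequality for `f` minus its linear and quadratic parts: by differentiability of
`fderiv ℝ f` at `x`, the derivative of the difference is at most `ε ‖v‖` on the ball of radius
`‖v‖`. -/
theorem exists_abs_taylor_two_le {E : Type*} [NormedAddCommGroup E] [NormedSpace ℝ E] {f : E → ℝ}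
    {x : E} (hf : ContDiffAt ℝ 2 f x) {ε : ℝ} (hε : 0 < ε) :
    ∃ δ > 0, ∀ v : E, ‖v‖ ≤ δ →
      |f (x + v) - f x - fderiv ℝ f x v - 1 / 2 * fderiv ℝ (fderiv ℝ f) x v v| ≤ ε * ‖v‖ ^ 2 := by
  set D := fderiv ℝ (fderiv ℝ f) x with hD
  have hsymm : ∀ v w, D v w = D w v := fun v w => (hf.isSymmSndFDerivAt (by simp)).eq v w
  have hd : HasFDerivAt (fderiv ℝ f) D x :=
    ((hf.fderiv_right (m := 1) (by norm_num)).differentiableAt (by norm_num)).hasFDerivAt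
  have h1 := hd.isLittleO.def hε
  have h2 : ∀ᶠ y in 𝓝 x, DifferentiableAt ℝ f y :=
    (hf.eventually (by simp)).mono fun y hy => hy.differentiableAt (by norm_num)
  obtain ⟨δ, hδ, h⟩ := Metric.eventually_nhds_iff_ball.1 (h1.and h2)
  refine ⟨δ / 2, by positivity, fun v hv => ?_⟩
  let g : E → ℝ := fun y => f y - fderiv ℝ f x (y - x) - 1 / 2 * D (y - x) (y - x)
  have hg : ∀ y ∈ Metric.closedBall x ‖v‖, HasFDerivWithinAt g
      (fderiv ℝ f y - fderiv ℝ f x - D (y - x)) (Metric.closedBall x ‖v‖) y := by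
    intro y hy
    have hy' : y ∈ Metric.ball x δ :=
      Metric.closedBall_subset_ball (by linarith) hy
    have hs : HasFDerivAt (fun y : E => y - x) (ContinuousLinearMap.id ℝ E) y :=
      (hasFDerivAt_id y).sub_const x
    have e1 := (h y hy').2.hasFDerivAt
    have e2 := (fderiv ℝ f x).hasFDerivAt.comp y hs
    have e3 := (D.hasFDerivAt.comp y hs).clm_apply hs
    have e4 := (e1.sub e2).sub (e3.const_mul (1 / 2))
    refine (e4.congr_fderiv ?_).hasFDerivWithinAt
    ext w
    have := hsymm w y
    have := hsymm w x
    simp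
    linarith
  have hb : ∀ y ∈ Metric.closedBall x ‖v‖, ‖fderiv ℝ f y - fderiv ℝ f x - D (y - x)‖ ≤ ε * ‖v‖ := by
    intro y hy
    have hy' : y ∈ Metric.ball x δ := Metric.closedBall_subset_ball (by linarith) hy
    refine ((h y hy').1).trans ?_
    rw [Metric.mem_closedBall, dist_eq_norm] at hy
    gcongr
  have hfin := (convex_closedBall x ‖v‖).norm_image_sub_le_of_norm_hasFDerivWithin_le hg hb
    (Metric.mem_closedBall_self (norm_nonneg v)) (y := x + v) (by simp)
  simp only [g, add_sub_cancel_left, sub_self, map_zero, Real.norm_eq_abs] at hfin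
  calc _ = |f (x + v) - fderiv ℝ f x v - 1 / 2 * D v v - (f x - 0 - 1 / 2 * 0)| := by
        congr 1; ring
    _ ≤ ε * ‖v‖ * ‖v‖ := by simpa using hfin
    _ = _ := by ring

theorem setIntegral_closedBall_comp {ι F : Type*} [Fintype ι] [NormedAddCommGroup F]
    [NormedSpace ℝ F] (T : EuclideanSpace ℝ ι ≃ₗᵢ[ℝ] EuclideanSpace ℝ ι) (r : ℝ)
    (f : EuclideanSpace ℝ ι → F) :
    ∫ t in Metric.closedBall 0 r, f (T t) ∂volume = ∫ t in Metric.closedBall 0 r, f t ∂volume := by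
  have h := T.measurePreserving.setIntegral_preimage_emb T.toHomeomorph.measurableEmbedding f
    (Metric.closedBall 0 r)
  rwa [T.preimage_closedBall, map_zero] at h

/-- The ball is invariant under reflections, which kill the mixed moments, and under coordinate
swaps, which equate the diagonal ones; only the trace of `Q` survives. -/
theorem exists_integral_bilin_closedBall : ∃ c : ℝ, 0 < c ∧
    ∀ Q : EuclideanSpace ℝ (Fin 4) →L[ℝ] EuclideanSpace ℝ (Fin 4) →L[ℝ] ℝ,
      ∫ t in Metric.closedBall 0 1, Q t t ∂volume =
        c * ∑ m, Q (EuclideanSpace.single m 1) (EuclideanSpace.single m 1) := by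
  let B : Set (EuclideanSpace ℝ (Fin 4)) := Metric.closedBall 0 1
  have hB : IsCompact B := isCompact_closedBall _ _
  have hint : ∀ i j : Fin 4, IntegrableOn (fun t : EuclideanSpace ℝ (Fin 4) => t i * t j) B volume :=
    fun i j => (by fun_prop : Continuous fun t : EuclideanSpace ℝ (Fin 4) => t i * t j).continuousOn.integrableOn_compact hB
  have hoff : ∀ i j : Fin 4, i ≠ j → ∫ t in B, t i * t j ∂volume = 0 := by
    intro i j hij
    let T : EuclideanSpace ℝ (Fin 4) ≃ₗᵢ[ℝ] EuclideanSpace ℝ (Fin 4) :=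
      LinearIsometryEquiv.piLpCongrRight 2 fun k =>
        if k = i then LinearIsometryEquiv.neg ℝ else LinearIsometryEquiv.refl ℝ ℝ
    have h := setIntegral_closedBall_comp T 1 fun t => t i * t j
    have hT : ∀ t : EuclideanSpace ℝ (Fin 4), T t i * T t j = -(t i * t j) := by
      intro t
      have h1 : T t i = - t i := by simp [T]
      have h2 : T t j = t j := by simp [T, hij.symm]
      rw [h1, h2]; ring
    simp only [hT, integral_neg] at h
    exact self_eq_neg.1 h.symm
  have hdiag : ∀ i : Fin 4, ∫ t in B, t i * t i ∂volume = ∫ t in B, t 0 * t 0 ∂volume := by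
    intro i
    let T : EuclideanSpace ℝ (Fin 4) ≃ₗᵢ[ℝ] EuclideanSpace ℝ (Fin 4) :=
      LinearIsometryEquiv.piLpCongrLeft 2 ℝ ℝ (Equiv.swap 0 i)
    have h := setIntegral_closedBall_comp T 1 fun t => t 0 * t 0
    have hT : ∀ t : EuclideanSpace ℝ (Fin 4), T t 0 = t i := by
      intro t
      simp [T, LinearIsometryEquiv.piLpCongrLeft_apply, Equiv.piCongrLeft'_apply]
    simp only [hT] at h
    exact h
  refine ⟨∫ t in B, t 0 * t 0 ∂volume, ?_, ?_⟩
  · refine (setIntegral_pos_iff_support_of_nonneg_ae ?_ (hint 0 0)).2 ?_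
    · exact Filter.Eventually.of_forall fun t => mul_self_nonneg (t 0)
    · refine lt_of_lt_of_le (Metric.measure_ball_pos volume
        (EuclideanSpace.single 0 (1 / 2) : EuclideanSpace ℝ (Fin 4)) (by norm_num : (0 : ℝ) < 1 / 2))
        (measure_mono fun t ht => ?_)
      rw [mem_ball_iff_norm] at ht
      have h3 : ‖(EuclideanSpace.single 0 (1 / 2) : EuclideanSpace ℝ (Fin 4))‖ = 1 / 2 := by simp
      refine ⟨fun h0 => ?_, ?_⟩
      · have h5 : t 0 = 0 := mul_self_eq_zero.1 h0
        have h4 := PiLp.norm_apply_le (t - EuclideanSpace.single 0 (1 / 2)) 0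
        rw [PiLp.sub_apply, h5] at h4
        simp at h4
        norm_num at ht
        linarith
      · have h4 := norm_sub_norm_le t (EuclideanSpace.single 0 (1 / 2))
        exact mem_closedBall_zero_iff.2 (by linarith)
  · intro Q
    have hQ : ∀ t : EuclideanSpace ℝ (Fin 4), Q t t = ∑ i, ∑ j, t i * t j *
        Q (EuclideanSpace.single i 1) (EuclideanSpace.single j 1) := by
      intro t
      have ht : t = ∑ i, t i • EuclideanSpace.single i (1 : ℝ) := by
        ext j; simp [Finset.sum_apply, Pi.single_apply]
      conv_lhs => rw [ht]
      simp only [map_sum, map_smul, sum_apply, smul_apply,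
        smul_eq_mul, Finset.mul_sum]
      rw [Finset.sum_comm]
      refine Finset.sum_congr rfl fun i _ => Finset.sum_congr rfl fun j _ => by ring
    rw [integral_congr_ae (Filter.Eventually.of_forall hQ), integral_finsetSum _ fun i _ => integrable_finsetSum _ fun j _ => (hint i j).mul_const _,
      Finset.mul_sum]
    refine Finset.sum_congr rfl fun i _ => ?_
    rw [integral_finsetSum _ fun j _ => (hint i j).mul_const _, Finset.sum_eq_single i]
    · rw [integral_mul_const, hdiag]
    · intro j _ hj
      rw [integral_mul_const, hoff i j hj.symm, zero_mul]
    · simp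

theorem toQuat_single (p : Fin n × Fin 4) :
    toQuat (EuclideanSpace.single p 1) = Pi.single p.1 (unitQ p.2) := by
  obtain ⟨l, m⟩ := p
  funext k
  by_cases h : k = l
  · subst h
    rw [Pi.single_eq_same]
    fin_cases m <;> simp [toQuat, unitQ] <;> rfl
  · rw [Pi.single_eq_of_ne h]
    ext <;> simp [toQuat, h] <;> rfl

theorem rmulMatrix_mulVec (m : Fin 4) (b : Fin n × Fin 4 → ℝ) :
    (rmulMatrix n m).mulVec b = hmul (WithLp.toLp 2 b) (EuclideanSpace.single m 1) := by
  have hb : WithLp.toLp 2 b = ∑ p, b p • EuclideanSpace.single p (1 : ℝ) := by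
    ext j; simp [Finset.sum_apply, Pi.single_apply]
  have hq : quatOf (EuclideanSpace.single m 1) = unitQ m := by
    fin_cases m <;> simp [quatOf, unitQ] <;> rfl
  have h := map_sum ((hmulₗ n).flip (EuclideanSpace.single m 1))
    (fun p => b p • EuclideanSpace.single p (1 : ℝ)) Finset.univ
  rw [← hb] at h
  change hmul (WithLp.toLp 2 b) (EuclideanSpace.single m 1) = _ at h
  rw [h]
  ext r
  simp only [map_smul, WithLp.ofLp_sum, Finset.sum_apply]
  rw [Matrix.mulVec, dotProduct]
  refine Finset.sum_congr rfl fun p _ => ?_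
  have : (hmulₗ n).flip (EuclideanSpace.single m 1) (EuclideanSpace.single p 1) =
      hmul (EuclideanSpace.single p 1) (EuclideanSpace.single m 1) := rfl
  rw [this, hmul, toQuat_single, hq]
  simp [rmulMatrix, mul_comm]

theorem dotProduct_hessMatrix_mulVec {f : HSpace n → ℝ} {x : HSpace n} (hf : ContDiffAt ℝ 2 f x)
    (v w : HSpace n) : (v : Fin n × Fin 4 → ℝ) ⬝ᵥ (hessMatrix f x).mulVec w =
      fderiv ℝ (fderiv ℝ f) x v w := by
  have hd : DifferentiableAt ℝ (fderiv ℝ f) x :=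
    (hf.fderiv_right (m := 1) (by norm_num)).differentiableAt (by norm_num)
  have h : ∀ p q, hessMatrix f x p q = fderiv ℝ (fderiv ℝ f) x (EuclideanSpace.single p 1)
      (EuclideanSpace.single q 1) := by
    intro p q
    have := (hd.hasFDerivAt.clm_apply (hasFDerivAt_const (EuclideanSpace.single q (1 : ℝ)) x)).fderiv
    rw [hessMatrix, Matrix.of_apply, pd, show pd q f = fun y => fderiv ℝ f y
      (EuclideanSpace.single q 1) from rfl, this]
    simp
  have hb : ∀ b : HSpace n, b = ∑ p, b p • EuclideanSpace.single p (1 : ℝ) := by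
    intro b; ext j; simp [Finset.sum_apply, Pi.single_apply]
  conv_rhs => rw [hb v, hb w]
  simp only [map_sum, map_smul, sum_apply, smul_apply,
    smul_eq_mul, ← h, Matrix.mulVec, dotProduct, Finset.mul_sum]
  rw [Finset.sum_comm]
  refine Finset.sum_congr rfl fun i _ => Finset.sum_congr rfl fun j _ => by ring

/-- A function which is subharmonic at `x` along the right quaternionic lines has a strongly
positive Hessian form at `x`. -/
theorem hessForm_mem_SP_of_le_average {f : HSpace n → ℝ} {x : HSpace n} (hf : ContDiffAt ℝ 2 f x)
    (h : ∀ b : HSpace n, ∀ᶠ s in 𝓝[>] (0 : ℝ),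
      IntegrableOn (fun t => f (x + hmul (s • b) t)) (Metric.closedBall 0 1) volume ∧
      f x ≤ ⨍ t in Metric.closedBall 0 1, f (x + hmul (s • b) t) ∂volume) :
    hessForm (hessMatrix f x) ∈ SP n 1 := by
  obtain ⟨c, hc, hmom⟩ := exists_integral_bilin_closedBall
  refine hessForm_mem_SP (hessMatrix_isSymm hf) fun b => ?_
  simp only [rmulMatrix_mulVec, dotProduct_hessMatrix_mulVec hf]
  set b' : HSpace n := WithLp.toLp 2 b
  set D := fderiv ℝ (fderiv ℝ f) x
  let B : Set (EuclideanSpace ℝ (Fin 4)) := Metric.closedBall 0 1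
  have hB : volume B ≠ ⊤ := measure_closedBall_lt_top.ne
  have hBpos : 0 < volume.real B := by
    rw [measureReal_def, ENNReal.toReal_pos_iff]
    exact ⟨Metric.measure_closedBall_pos _ _ one_pos, hB.lt_top⟩
  have hBc : IsCompact B := isCompact_closedBall _ _
  let Q : EuclideanSpace ℝ (Fin 4) →L[ℝ] EuclideanSpace ℝ (Fin 4) →L[ℝ] ℝ :=
    D.bilinearComp (hmulL n b') (hmulL n b')
  have hQ := hmom Q
  have hQi : IntegrableOn (fun t => Q t t) B volume :=
    (by fun_prop : Continuous fun t => Q t t).continuousOn.integrableOn_compact hBc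
  -- The trace to be shown nonnegative is a positive multiple of this integral.
  suffices hpos : 0 ≤ ∫ t in B, Q t t ∂volume by
    rw [hQ] at hpos
    exact nonneg_of_mul_nonneg_right hpos hc
  by_contra! hneg
  -- With `ε` this small the Taylor error cannot compensate a negative quadratic term; the linear
  -- term integrates to zero by symmetry, contradicting the sub-mean inequality for small `s`.
  obtain ⟨ε, hε, hεlt⟩ : ∃ ε > 0, ε * (‖b'‖ ^ 2 * volume.real B) < - (1 / 2 * ∫ t in B, Q t t ∂volume) := by
    have h0 : 0 < - (1 / 2 * ∫ t in B, Q t t ∂volume) := by linarith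
    have : Filter.Tendsto (fun ε : ℝ => ε * (‖b'‖ ^ 2 * volume.real B)) (𝓝 0)
        (𝓝 (0 * (‖b'‖ ^ 2 * volume.real B))) :=
      (continuous_id.mul continuous_const).tendsto 0
    rw [zero_mul] at this
    have h3 := (this.mono_left (nhdsWithin_le_nhds (s := Ioi 0))).eventually (gt_mem_nhds h0)
    obtain ⟨ε, h1, h2⟩ := (h3.and self_mem_nhdsWithin).exists
    exact ⟨ε, h2, h1⟩
  obtain ⟨δ, hδ, htay⟩ := exists_abs_taylor_two_le hf hε
  have hev : ∀ᶠ s in 𝓝[>] (0 : ℝ), s * ‖b'‖ ≤ δ := by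
    have : Filter.Tendsto (fun s : ℝ => s * ‖b'‖) (𝓝[>] 0) (𝓝 (0 * ‖b'‖)) :=
      ((continuous_id.mul continuous_const).tendsto 0).mono_left nhdsWithin_le_nhds
    rw [zero_mul] at this
    exact (this.eventually (gt_mem_nhds hδ)).mono fun s hs => hs.le
  obtain ⟨s, ⟨⟨hi, hle⟩, hsδ⟩, hs⟩ := (((h b').and hev).and self_mem_nhdsWithin).exists
  let ℓ : EuclideanSpace ℝ (Fin 4) →L[ℝ] ℝ := (fderiv ℝ f x).comp (hmulL n b')
  have hℓ : ∫ t in B, ℓ t ∂volume = 0 := by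
    have := setIntegral_closedBall_comp (LinearIsometryEquiv.neg ℝ (E := EuclideanSpace ℝ (Fin 4))) 1 ℓ
    simp only [LinearIsometryEquiv.coe_neg, map_neg, integral_neg] at this
    exact self_eq_neg.1 this.symm
  have hℓi : IntegrableOn (fun t => ℓ t) B volume :=
    ℓ.continuous.continuousOn.integrableOn_compact hBc
  have hpt : ∀ t ∈ B, f (x + hmul (s • b') t) ≤
      (f x + ε * (s ^ 2 * ‖b'‖ ^ 2)) + (s * ℓ t + s ^ 2 * (1 / 2) * Q t t) := by
    intro t ht
    rw [mem_closedBall_zero_iff] at ht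
    have hst : hmul (s • b') t = s • hmul b' t := by
      rw [← hmulL_apply, map_smul]; rfl
    have hnorm : ‖hmul (s • b') t‖ ≤ s * ‖b'‖ := by
      rw [norm_hmul, norm_smul, Real.norm_of_nonneg hs.le]
      exact mul_le_of_le_one_right (by positivity) ht
    have h1 := (abs_le.1 (htay _ (hnorm.trans hsδ))).2
    have h2 : ‖hmul (s • b') t‖ ^ 2 ≤ s ^ 2 * ‖b'‖ ^ 2 := by
      rw [← mul_pow]; gcongr
    have h3 : fderiv ℝ f x (hmul (s • b') t) = s * ℓ t := by rw [hst, map_smul]; rfl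
    have h4 : fderiv ℝ (fderiv ℝ f) x (hmul (s • b') t) (hmul (s • b') t) = s ^ 2 * Q t t := by
      rw [hst, map_smul, map_smul, smul_apply, smul_smul, smul_eq_mul, sq]; rfl
    rw [h3, h4] at h1
    nlinarith [mul_le_mul_of_nonneg_left h2 hε.le]
  have hBm : MeasurableSet B := measurableSet_closedBall
  have hci : ∀ a : ℝ, IntegrableOn (fun _ : EuclideanSpace ℝ (Fin 4) => a) B volume := fun a =>
    integrableOn_const hB
  have hG : IntegrableOn (fun t => s * ℓ t + s ^ 2 * (1 / 2) * Q t t) B volume :=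
    (hℓi.const_mul s).add (hQi.const_mul _)
  have h5 : ∫ t in B, f (x + hmul (s • b') t) ∂volume ≤ ∫ t in B, ((f x + ε * (s ^ 2 * ‖b'‖ ^ 2)) +
      (s * ℓ t + s ^ 2 * (1 / 2) * Q t t)) ∂volume :=
    setIntegral_mono_on hi ((hci _).add hG) hBm hpt
  rw [integral_add (hci _) hG, integral_add (hℓi.const_mul s) (hQi.const_mul _),
    integral_const_mul, integral_const_mul, hℓ, setIntegral_const, smul_eq_mul] at h5
  rw [setAverage_eq, smul_eq_mul, ← div_eq_inv_mul, le_div_iff₀ hBpos] at hle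
  have hs2 : 0 < s ^ 2 := by positivity
  nlinarith

end QPlurisubharmonic

end

noncomputable section

open scoped ContDiff Topology Convolution


namespace QPlurisubharmonic

variable {n : ℕ} {Ω : Opens (HSpace n)}

/-! ### Mollification -/

/-- A sequence of bump functions whose supports shrink to the origin. -/
def bump (n j : ℕ) : ContDiffBump (0 : HSpace n) where
  rIn := 1 / ((j : ℝ) + 1) / 2
  rOut := 1 / ((j : ℝ) + 1)
  rIn_pos := by positivity
  rIn_lt_rOut := half_lt_self (by positivity)

theorem tendsto_rOut_bump (n : ℕ) :
    Filter.Tendsto (fun j => (bump n j).rOut) Filter.atTop (𝓝 0) :=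
  tendsto_one_div_add_atTop_nhds_zero_nat

/-- Convolution with the `j`-th bump function. -/
def mollify (j : ℕ) (f : HSpace n → ℝ) : HSpace n → ℝ :=
  (bump n j).normed volume ⋆[ContinuousLinearMap.lsmul ℝ ℝ, volume] f

theorem mollify_apply (j : ℕ) (f : HSpace n → ℝ) (x : HSpace n) :
    mollify j f x = ∫ s, (bump n j).normed volume s * f (x - s) ∂volume := rfl

theorem contDiff_mollify (j : ℕ) {f : HSpace n → ℝ} (hf : LocallyIntegrable f volume) :
    ContDiff ℝ ∞ (mollify j f) :=
  (bump n j).hasCompactSupport_normed.contDiff_convolution_left _ (bump n j).contDiff_normed hf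

theorem abs_mollify_le (j : ℕ) {f : HSpace n → ℝ} {M : ℝ} (h : ∀ᵐ y ∂volume, |f y| ≤ M)
    (x : HSpace n) : |mollify j f x| ≤ M := by
  have hi : Integrable ((bump n j).normed volume) volume :=
    (bump n j).continuous_normed.integrable_of_hasCompactSupport (bump n j).hasCompactSupport_normed
  have h2 : ∀ᵐ s ∂volume, |f (x - s)| ≤ M :=
    (Measure.measurePreserving_sub_left volume x).quasiMeasurePreserving.ae h
  rw [mollify_apply, ← Real.norm_eq_abs]
  refine (norm_integral_le_of_norm_le (hi.mul_const M) ?_).trans ?_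
  · filter_upwards [h2] with s hs
    rw [norm_mul, Real.norm_of_nonneg ((bump n j).nonneg_normed s)]
    exact mul_le_mul_of_nonneg_left hs ((bump n j).nonneg_normed s)
  · rw [integral_mul_const, ContDiffBump.integral_normed, one_mul]

theorem tendsto_mollify_of_continuous {f : HSpace n → ℝ} (hf : Continuous f) (x : HSpace n) :
    Filter.Tendsto (fun j => mollify j f x) Filter.atTop (𝓝 (f x)) :=
  ContDiffBump.convolution_tendsto_right_of_continuous (tendsto_rOut_bump n) hf x

theorem tendsto_mollify_of_average {f : HSpace n → ℝ} (hf : LocallyIntegrable f volume)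
    {x : HSpace n} (h : Filter.Tendsto
      (fun r => ⨍ y in Metric.closedBall x r, ‖f y - f x‖ ∂volume) (𝓝[>] 0) (𝓝 0)) :
    Filter.Tendsto (fun j => mollify j f x) Filter.atTop (𝓝 (f x)) := by
  simp only [mollify, convolution_eq_swap, ContinuousLinearMap.lsmul_apply]
  have hφ' : Filter.Tendsto (fun j ↦ (bump n j).rOut) Filter.atTop (𝓝[>] 0) :=
    tendsto_nhdsWithin_iff.2
      ⟨tendsto_rOut_bump n, Filter.Eventually.of_forall fun j ↦ (bump n j).rOut_pos⟩
  -- The inner radius of the bump is half the outer one, so its density is at most this power of 2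
  -- over the volume of the outer ball.
  apply tendsto_integral_smul_of_tendsto_average_norm_sub (2 ^ (Module.finrank ℝ (HSpace n)))
    (h.comp hφ')
  · filter_upwards with i using hf.integrableOn_isCompact (isCompact_closedBall _ _)
  · apply tendsto_const_nhds.congr (fun i ↦ ?_)
    rw [← integral_neg_eq_self]
    simp only [sub_neg_eq_add, integral_add_left_eq_self, ContDiffBump.integral_normed]
  · filter_upwards with i
    change Function.support ((ContDiffBump.normed (bump n i) volume) ∘ (fun y ↦ x - y)) ⊆
      Metric.closedBall x (bump n i).rOut
    simp only [Function.support_comp_eq_preimage, ContDiffBump.support_normed_eq]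
    intro y hy
    simp only [mem_preimage, Metric.mem_ball, dist_zero_right] at hy
    simpa [dist_eq_norm_sub'] using hy.le
  · filter_upwards with i y
    rw [abs_of_nonneg (ContDiffBump.nonneg_normed _ _), Measure.addHaar_real_closedBall_center]
    refine (bump n i).normed_le_div_measure_closedBall_rOut _ _ ?_ _
    simp only [bump]
    linarith

theorem pd_mollify (j : ℕ) {f : HSpace n → ℝ} (hf : ContDiff ℝ 1 f) (hc : HasCompactSupport f)
    (p : Fin n × Fin 4) : pd p (mollify j f) = mollify j (pd p f) := by
  funext x
  have h := hc.hasFDerivAt_convolution_right (ContinuousLinearMap.lsmul ℝ ℝ)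
    ((bump n j).continuous_normed (μ := volume)).locallyIntegrable (μ := volume) hf x
  have hi : ConvolutionExistsAt ((bump n j).normed volume) (fderiv ℝ f) x
      ((ContinuousLinearMap.lsmul ℝ ℝ).precompR (HSpace n)) volume :=
    (hc.fderiv ℝ).convolutionExists_right (μ := volume) _
      ((bump n j).continuous_normed (μ := volume)).locallyIntegrable
      (hf.continuous_fderiv (by simp)) x
  rw [pd, mollify, h.fderiv, convolution]
  rw [ContinuousLinearMap.integral_apply hi]
  rfl

theorem integral_mul_setIntegral_swap {φ f : HSpace n → ℝ} (hi : Integrable φ volume)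
    (hf : Measurable f) {M : ℝ} (hM : ∀ y, |f y| ≤ M) (x b : HSpace n) :
    Integrable (fun s => φ s * ∫ t in Metric.closedBall 0 1, f (x - s + hmul b t) ∂volume) volume ∧
    ∫ s, φ s * ∫ t in Metric.closedBall 0 1, f (x - s + hmul b t) ∂volume ∂volume =
      ∫ t in Metric.closedBall 0 1, ∫ s, φ s * f (x + hmul b t - s) ∂volume ∂volume := by
  let B : Set (EuclideanSpace ℝ (Fin 4)) := Metric.closedBall 0 1
  have : IsFiniteMeasure ((volume : Measure (EuclideanSpace ℝ (Fin 4))).restrict B) :=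
    ⟨by rw [Measure.restrict_apply_univ]; exact measure_closedBall_lt_top⟩
  have hmeas : Measurable fun p : HSpace n × EuclideanSpace ℝ (Fin 4) =>
      f (x - p.1 + hmul b p.2) := by
    refine hf.comp ((measurable_fst.const_sub x).add ?_)
    exact (hmulL n b).continuous.measurable.comp measurable_snd
  have hφ : Integrable (fun p : HSpace n × EuclideanSpace ℝ (Fin 4) => φ p.1)
      (volume.prod ((volume : Measure (EuclideanSpace ℝ (Fin 4))).restrict B)) := hi.comp_fst _
  have hprod : Integrable (fun p : HSpace n × EuclideanSpace ℝ (Fin 4) =>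
      φ p.1 * f (x - p.1 + hmul b p.2))
      (volume.prod ((volume : Measure (EuclideanSpace ℝ (Fin 4))).restrict B)) :=
    Integrable.mul_bdd (c := M) hφ hmeas.aestronglyMeasurable
      (Filter.Eventually.of_forall fun p => hM _)
  constructor
  · refine hprod.integral_prod_left.congr (Filter.Eventually.of_forall fun s => ?_)
    exact integral_const_mul (φ s) fun t => f (x - s + hmul b t)
  · calc _ = ∫ s, ∫ t in B, φ s * f (x - s + hmul b t) ∂volume ∂volume := by
          simp only [integral_const_mul, B]
      _ = ∫ t in B, ∫ s, φ s * f (x - s + hmul b t) ∂volume ∂volume :=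
          integral_integral_swap hprod
      _ = _ := by
          refine integral_congr_ae (Filter.Eventually.of_forall fun t => ?_)
          refine integral_congr_ae (Filter.Eventually.of_forall fun s => ?_)
          simp only [sub_add_eq_add_sub]

/-- A mollification averages translates of `f`; each translate by `s` in the support of the bump
satisfies the sub-mean inequality, the slack `rOut` keeping the translated ball inside `W`. -/
theorem IsPSH.mollify_le_average {W : Opens (HSpace n)} {f : HSpace n → ℝ} (hW : IsPSH W f)
    (hf : Measurable f) {M : ℝ} (hM : ∀ y, |f y| ≤ M) {j : ℕ} {x b : HSpace n} {ρ : ℝ}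
    (hx : Metric.closedBall x ((bump n j).rOut + ρ) ⊆ W) (hb : ‖b‖ ≤ ρ) :
    mollify j f x ≤ ⨍ t in Metric.closedBall 0 1, mollify j f (x + hmul b t) ∂volume := by
  let B : Set (EuclideanSpace ℝ (Fin 4)) := Metric.closedBall 0 1
  have hB : volume B ≠ ⊤ := measure_closedBall_lt_top.ne
  have hBpos : 0 < volume.real B := by
    rw [measureReal_def, ENNReal.toReal_pos_iff]
    exact ⟨Metric.measure_closedBall_pos _ _ one_pos, hB.lt_top⟩
  have hi : Integrable ((bump n j).normed volume) volume :=
    (bump n j).continuous_normed.integrable_of_hasCompactSupport (bump n j).hasCompactSupport_normed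
  obtain ⟨h1, h2⟩ := integral_mul_setIntegral_swap hi hf hM x b
  have h3 : Integrable (fun s => (bump n j).normed volume s * f (x - s)) volume :=
    hi.mul_bdd (c := M) (hf.comp (measurable_const.sub measurable_id)).aestronglyMeasurable
      (Filter.Eventually.of_forall fun p => hM _)
  rw [setAverage_eq, smul_eq_mul, ← div_eq_inv_mul, le_div_iff₀ hBpos]
  simp only [mollify_apply]
  rw [← h2, ← integral_mul_const]
  refine integral_mono (h3.mul_const _) h1 fun s => ?_
  simp only
  rw [mul_assoc]
  by_cases hs : s ∈ Function.support ((bump n j).normed volume)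
  · rw [ContDiffBump.support_normed_eq, mem_ball_zero_iff] at hs
    refine mul_le_mul_of_nonneg_left ?_ ((bump n j).nonneg_normed s)
    have hsub : Metric.closedBall (x - s) ρ ⊆ W := by
      refine Subset.trans ?_ hx
      refine Metric.closedBall_subset_closedBall' ?_
      rw [dist_eq_norm, sub_sub_cancel_left, norm_neg]
      linarith
    have h4 := (hW.line_integrable hb hsub).2
    rw [setAverage_eq, smul_eq_mul, ← div_eq_inv_mul, le_div_iff₀ hBpos] at h4
    exact h4
  · rw [Function.notMem_support.1 hs, zero_mul, zero_mul]

theorem _root_.UpperSemicontinuousOn.congr_of_eqOn {α : Type*} [TopologicalSpace α] {u v : α → ℝ}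
    {s : Set α} (hu : UpperSemicontinuousOn u s) (h : ∀ x ∈ s, v x = u x) :
    UpperSemicontinuousOn v s := by
  intro x hx y hy
  rw [h x hx] at hy
  filter_upwards [hu x hx y hy, self_mem_nhdsWithin] with z hz hzs
  rwa [h z hzs]

/-- Allows `u` to be replaced by its indicator on the interior of `K`, which is measurable and
bounded on the whole space and can be convolved. -/
theorem IsPSH.mono_congr {W : Opens (HSpace n)} {u v : HSpace n → ℝ} (hu : IsPSH Ω u) (hW : W ≤ Ω)
    (h : ∀ x ∈ W, v x = u x) : IsPSH W v := by
  refine ⟨?_, fun a b => ?_⟩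
  · exact (hu.usc.mono hW).congr_of_eqOn h
  · have h0 := hu.subharmonic a b
    refine ⟨?_, fun x r hr hx => ?_, fun x r hr hx => ?_⟩
    · exact UpperSemicontinuousOn.congr_of_eqOn (h0.usc.mono fun t ht => hW ht) fun t ht => h _ ht
    · exact (h0.integrableOn x r hr fun t ht => hW (hx ht)).congr_fun
        (fun t ht => (h _ (hx ht)).symm) measurableSet_closedBall
    · rw [h _ (hx (Metric.mem_closedBall_self hr.le))]
      refine (h0.le_average x r hr fun t ht => hW (hx ht)).trans_eq ?_
      rw [setAverage_eq, setAverage_eq,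
        setIntegral_congr_fun measurableSet_closedBall fun t ht => (h _ (hx ht)).symm]

theorem IsPSH.tendsto_average {u : HSpace n → ℝ} (hu : IsPSH Ω u) (hm : Measurable u)
    {x : HSpace n} (hx : x ∈ Ω) :
    Filter.Tendsto (fun r => ⨍ y in Metric.closedBall x r, ‖u y - u x‖ ∂volume) (𝓝[>] 0) (𝓝 0) := by
  obtain ⟨C, hC, h⟩ := IsPSH.exists_lintegral_enorm_sub_le n
  rw [Metric.tendsto_nhds]
  intro ε hε
  obtain ⟨r₀, hr₀, -, hr⟩ := h Ω u hu x hx (ε / 2 / C) (by positivity)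
  filter_upwards [Ioc_mem_nhdsGT hr₀] with r hrr
  have h1 := hr r hrr.1 hrr.2
  have hV : 0 < volume.real (Metric.closedBall x r) := by
    rw [measureReal_def, ENNReal.toReal_pos_iff]
    exact ⟨Metric.measure_closedBall_pos _ _ hrr.1, measure_closedBall_lt_top⟩
  have h2 : ∫ y in Metric.closedBall x r, ‖u y - u x‖ ∂volume ≤
      ε / 2 * volume.real (Metric.closedBall x r) := by
    rw [integral_norm_eq_lintegral_enorm (hm.sub_const _).aestronglyMeasurable]
    rw [mul_div_cancel₀ _ hC.ne'] at h1
    refine (ENNReal.toReal_mono (ENNReal.mul_ne_top ENNReal.ofReal_ne_top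
      measure_closedBall_lt_top.ne) h1).trans_eq ?_
    rw [ENNReal.toReal_mul, ENNReal.toReal_ofReal (by positivity), measureReal_def]
  have h3 : 0 ≤ ∫ y in Metric.closedBall x r, ‖u y - u x‖ ∂volume :=
    integral_nonneg fun _ => norm_nonneg _
  rw [dist_zero_right, setAverage_eq, smul_eq_mul, norm_mul, norm_inv, Real.norm_of_nonneg hV.le,
    Real.norm_of_nonneg h3, ← div_eq_inv_mul, div_lt_iff₀ hV]
  nlinarith

theorem locallyIntegrable_of_ae_abs_le {u : HSpace n → ℝ} (hm : Measurable u) {M : ℝ}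
    (hM : ∀ᵐ y ∂volume, |u y| ≤ M) :
    LocallyIntegrable u (volume : Measure (HSpace n)) :=
  ((locallyIntegrable_const M).mono hm.aestronglyMeasurable
    (hM.mono fun _ hy => hy.trans (le_abs_self M)))

theorem IsPSH.measurable_indicator_of_isOpen {u : HSpace n → ℝ} (hu : IsPSH Ω u)
    {W : Set (HSpace n)} (hW : IsOpen W) (hWΩ : W ⊆ Ω) : Measurable (indicator W u) := by
  have h : indicator W u = indicator W (indicator (Ω : Set (HSpace n)) u) := by
    rw [indicator_indicator, inter_eq_left.2 hWΩ]
  rw [h]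
  exact hu.measurable_indicator.indicator hW.measurableSet

theorem ae_abs_indicator_le_supNorm {u : HSpace n → ℝ} (hb : IsLocallyBounded Ω u)
    {K : Set (HSpace n)} (hK : IsCompact K) (hKΩ : K ⊆ Ω) :
    ∀ᵐ y ∂volume, |indicator (interior K) u y| ≤ supNorm K u := by
  have h1 := hb K hK hKΩ
  have h2 : ∀ᵐ y ∂(volume.restrict K), |u y| ≤ supNorm K u := by
    have h3 := ae_le_eLpNormEssSup (f := u) (μ := volume.restrict K)
    filter_upwards [h3] with y hy
    rw [← eLpNorm_exponent_top] at hy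
    have := ENNReal.toReal_mono h1.2.ne hy
    rwa [toReal_enorm] at this
  rw [ae_restrict_iff' hK.measurableSet] at h2
  filter_upwards [h2] with y hy
  by_cases h : y ∈ interior K
  · rw [indicator_of_mem h]
    exact hy (interior_subset h)
  · rw [indicator_of_notMem h, abs_zero]
    exact ENNReal.toReal_nonneg

/-- The essential bound holds at every interior point, because mollifications obey it everywhere and
converge to `u x` at every such point. A bound almost everywhere for Lebesgue measure would not
suffice against the measures of a current. -/
theorem IsPSH.abs_le_supNorm {u : HSpace n → ℝ} (hu : IsPSH Ω u) (hb : IsLocallyBounded Ω u)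
    {K : Set (HSpace n)} (hK : IsCompact K) (hKΩ : K ⊆ Ω) {x : HSpace n} (hx : x ∈ interior K) :
    |u x| ≤ supNorm K u := by
  let W : Opens (HSpace n) := ⟨interior K, isOpen_interior⟩
  have hWΩ : interior K ⊆ Ω := interior_subset.trans hKΩ
  have hm := hu.measurable_indicator_of_isOpen isOpen_interior hWΩ
  have hae := ae_abs_indicator_le_supNorm hb hK hKΩ
  have hW : IsPSH W (indicator (interior K) u) :=
    hu.mono_congr hWΩ fun y hy => indicator_of_mem hy u
  have ht := tendsto_mollify_of_average (locallyIntegrable_of_ae_abs_le hm hae)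
    (hW.tendsto_average hm (x := x) hx)
  rw [indicator_of_mem hx] at ht
  exact le_of_tendsto ht.abs (Filter.Eventually.of_forall fun j => abs_mollify_le j hae x)

/-- Regularization of locally bounded plurisubharmonic functions. -/
theorem IsPSH.exists_regularization {u : HSpace n → ℝ} (hu : IsPSH Ω u)
    (hb : IsLocallyBounded Ω u) {K : Set (HSpace n)} (hK : IsCompact K) (hKΩ : K ⊆ Ω) :
    ∃ v : ℕ → HSpace n → ℝ, (∀ j, ContDiff ℝ ∞ (v j)) ∧ (∀ j x, |v j x| ≤ supNorm K u) ∧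
      (∀ x ∈ interior K, Filter.Tendsto (fun j => v j x) Filter.atTop (𝓝 (u x))) ∧
      ∀ K' : Set (HSpace n), IsCompact K' → K' ⊆ interior K →
        ∀ᶠ j in Filter.atTop, ∀ x ∈ K', hessForm (hessMatrix (v j) x) ∈ SP n 1 := by
  let W : Opens (HSpace n) := ⟨interior K, isOpen_interior⟩
  have hWΩ : interior K ⊆ Ω := interior_subset.trans hKΩ
  let f := indicator (interior K) u
  have hm : Measurable f := hu.measurable_indicator_of_isOpen isOpen_interior hWΩ
  have hM : ∀ y, |f y| ≤ supNorm K u := by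
    intro y
    by_cases h : y ∈ interior K
    · simp only [f]
      rw [indicator_of_mem h]
      exact hu.abs_le_supNorm hb hK hKΩ h
    · simp only [f]
      rw [indicator_of_notMem h, abs_zero]
      exact ENNReal.toReal_nonneg
  have hW : IsPSH W f := hu.mono_congr hWΩ fun y hy => indicator_of_mem hy u
  have hli := locallyIntegrable_of_ae_abs_le hm (Filter.Eventually.of_forall hM)
  have hsmooth := fun j => contDiff_mollify j hli
  refine ⟨fun j => mollify j f, hsmooth,
    fun j => abs_mollify_le j (Filter.Eventually.of_forall hM), fun x hx => ?_, fun K' hK' hKK' => ?_⟩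
  · have ht := tendsto_mollify_of_average hli (hW.tendsto_average hm (x := x) hx)
    simp only [f] at ht ⊢
    rwa [indicator_of_mem hx] at ht
  · obtain ⟨δ, hδ, hsub⟩ := hK'.exists_cthickening_subset_open isOpen_interior hKK'
    -- Half of the margin `δ` absorbs the support of the bump, the other half the piece of the right
    -- line.
    filter_upwards [(tendsto_rOut_bump n).eventually (gt_mem_nhds (half_pos hδ))] with j hj x hx
    refine hessForm_mem_SP_of_le_average ((hsmooth j).contDiffAt.of_le two_le_infty) fun b => ?_
    have hev : ∀ᶠ s in 𝓝[>] (0 : ℝ), ‖s • b‖ < δ / 2 := by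
      have : Filter.Tendsto (fun s : ℝ => ‖s • b‖) (𝓝[>] 0) (𝓝 ‖(0 : ℝ) • b‖) :=
        ((continuous_id.smul continuous_const).norm.tendsto 0).mono_left nhdsWithin_le_nhds
      rw [zero_smul, norm_zero] at this
      exact this.eventually (gt_mem_nhds (half_pos hδ))
    filter_upwards [hev] with s hs
    refine ⟨?_, hW.mollify_le_average hm hM (ρ := δ / 2) ?_ hs.le⟩
    · exact ((hsmooth j).continuous.comp (continuous_const.add
        (hmulL n (s • b)).continuous)).continuousOn.integrableOn_compact (isCompact_closedBall _ _)
    · refine Subset.trans ?_ hsub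
      refine (Metric.closedBall_subset_closedBall (by linarith : _ ≤ δ)).trans ?_
      exact Metric.closedBall_subset_cthickening hx δ

end QPlurisubharmonic

end

noncomputable section

open scoped ContDiff Topology Manifold


namespace QPlurisubharmonic

variable {n : ℕ} {Ω : Opens (HSpace n)}

/-! ### Cutoff functions and regularization of `C²` functions -/

/-- Equality to `1` holds near each point of `K`, so that derivatives at points of `K` are also
unaffected by the cutoff. -/
theorem exists_cutoff {K U : Set (HSpace n)} (hK : IsCompact K) (hU : IsOpen U) (hKU : K ⊆ U) :
    ∃ χ : HSpace n → ℝ, ContDiff ℝ ∞ χ ∧ HasCompactSupport χ ∧ tsupport χ ⊆ U ∧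
      (∀ x, 0 ≤ χ x) ∧ (∀ x, χ x ≤ 1) ∧ ∀ x ∈ K, χ =ᶠ[𝓝 x] fun _ => 1 := by
  obtain ⟨S, hS, hKS, hSU⟩ := exists_compact_between hK hU hKU
  obtain ⟨f, h1, h0, hf⟩ := exists_contMDiffMap_one_nhds_of_subset_interior 𝓘(ℝ, HSpace n)
    (n := (⊤ : ℕ∞)) hK.isClosed hKS
  have hsupp : tsupport f ⊆ S :=
    closure_minimal (fun x hx => by_contra fun h => hx (h0 x h)) hS.isClosed
  exact ⟨f, f.contMDiff.contDiff, HasCompactSupport.of_support_subset_isCompact hS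
    (subset_closure.trans hsupp), hsupp.trans hSU, fun x => (hf x).1, fun x => (hf x).2,
    fun x hx => (Filter.eventually_of_mem (mem_nhdsSet_iff_forall.1 h1 x hx) fun y hy => hy)⟩

theorem _root_.Filter.EventuallyEq.pd_eventuallyEq {E : Type*} [NormedAddCommGroup E]
    [NormedSpace ℝ E] {f g : HSpace n → E} {x : HSpace n} (h : f =ᶠ[𝓝 x] g)
    (p : Fin n × Fin 4) : pd p f =ᶠ[𝓝 x] pd p g := by
  filter_upwards [h.fderiv (𝕜 := ℝ)] with y hy
  rw [pd, pd, hy]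

theorem hessMatrix_congr {f g : HSpace n → ℝ} {x : HSpace n} (h : f =ᶠ[𝓝 x] g) :
    hessMatrix f x = hessMatrix g x := by
  ext p q
  exact ((h.pd_eventuallyEq q).pd_eventuallyEq p).eq_of_nhds

theorem hasCompactSupport_pd {f : HSpace n → ℝ} (hf : HasCompactSupport f) (p : Fin n × Fin 4) :
    HasCompactSupport (pd p f) :=
  (hf.fderiv ℝ).comp_left (g := fun L : HSpace n →L[ℝ] ℝ => L (EuclideanSpace.single p 1)) rfl

theorem contDiff_pd_of_succ {f : HSpace n → ℝ} {k m : WithTop ℕ∞} (hf : ContDiff ℝ m f)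
    (h : k + 1 ≤ m) (p : Fin n × Fin 4) : ContDiff ℝ k (pd p f) :=
  (hf.fderiv_right h).clm_apply contDiff_const

/-- Here the Hessians must converge as well. After multiplication by a cutoff the function is `C²`
with compact support, so second derivatives commute with mollification and converge boundedly. -/
theorem exists_contDiff_two_regularization {u : HSpace n → ℝ} (hu : ContDiffOn ℝ 2 u Ω)
    {K : Set (HSpace n)} (hK : IsCompact K) (hKΩ : K ⊆ Ω) :
    ∃ (v : ℕ → HSpace n → ℝ) (M : ℝ), (∀ j, ContDiff ℝ ∞ (v j)) ∧ (∀ j x, |v j x| ≤ M) ∧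
      (∀ j x p q, |hessMatrix (v j) x p q| ≤ M) ∧
      ∀ x ∈ K, Filter.Tendsto (fun j => v j x) Filter.atTop (𝓝 (u x)) ∧
        ∀ p q, Filter.Tendsto (fun j => hessMatrix (v j) x p q) Filter.atTop
          (𝓝 (hessMatrix u x p q)) := by
  obtain ⟨χ, hχ, hχc, hχΩ, -, -, hχ1⟩ := exists_cutoff hK Ω.isOpen hKΩ
  let f : HSpace n → ℝ := fun x => χ x * u x
  have hfc : HasCompactSupport f := hχc.mul_right
  have hf : ContDiff ℝ 2 f := by
    refine contDiff_iff_contDiffAt.2 fun x => ?_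
    by_cases hx : x ∈ tsupport f
    swap
    · exact contDiffAt_const.congr_of_eventuallyEq (notMem_tsupport_iff_eventuallyEq.1 hx)
    have hxΩ : x ∈ Ω := hχΩ (closure_mono (Function.support_mul_subset_left χ u) hx)
    exact (hχ.of_le two_le_infty).contDiffAt.mul (hu.contDiffAt (Ω.isOpen.mem_nhds hxΩ))
  have hfu : ∀ x ∈ K, f =ᶠ[𝓝 x] u := fun x hx => (hχ1 x hx).mono fun y hy => by
    simp only [f, hy, one_mul]
  have hp : ∀ q, ContDiff ℝ 1 (pd q f) := fun q => contDiff_pd_of_succ hf (by norm_num) q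
  have hpq : ∀ p q, Continuous (pd p (pd q f)) := fun p q =>
    (contDiff_pd_of_succ (k := 0) (hp q) (by norm_num) p).continuous
  have hhess : ∀ j x p q, hessMatrix (mollify j f) x p q = mollify j (pd p (pd q f)) x := by
    intro j x p q
    rw [hessMatrix, Matrix.of_apply, pd_mollify j (hf.of_le (by norm_num)) hfc,
      pd_mollify j (hp q) (hasCompactSupport_pd hfc q)]
  obtain ⟨M₀, hM₀⟩ := hfc.exists_bound_of_continuous hf.continuous
  have hb : ∀ p q, ∃ C, ∀ x, ‖pd p (pd q f) x‖ ≤ C := fun p q =>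
    (hasCompactSupport_pd (hasCompactSupport_pd hfc q) p).exists_bound_of_continuous (hpq p q)
  choose C hC using hb
  have hC0 : ∀ p q, 0 ≤ C p q := fun p q => (norm_nonneg _).trans (hC p q 0)
  have hM0 : 0 ≤ M₀ := (norm_nonneg _).trans (hM₀ 0)
  refine ⟨fun j => mollify j f, M₀ + ∑ p, ∑ q, C p q,
    fun j => contDiff_mollify j hf.continuous.locallyIntegrable, fun j x => ?_, fun j x p q => ?_,
    fun x hx => ⟨?_, fun p q => ?_⟩⟩
  · refine (abs_mollify_le j (Filter.Eventually.of_forall hM₀) x).trans ?_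
    exact le_add_of_nonneg_right (Finset.sum_nonneg fun p _ => Finset.sum_nonneg fun q _ => hC0 p q)
  · rw [hhess]
    refine (abs_mollify_le j (Filter.Eventually.of_forall (hC p q)) x).trans ?_
    have h1 := Finset.single_le_sum (f := fun q => C p q) (fun q _ => hC0 p q) (Finset.mem_univ q)
    have h2 := Finset.single_le_sum (f := fun p => ∑ q, C p q)
      (fun p _ => Finset.sum_nonneg fun q _ => hC0 p q) (Finset.mem_univ p)
    linarith
  · rw [← (hfu x hx).eq_of_nhds]
    exact tendsto_mollify_of_continuous hf.continuous x
  · simp only [hhess]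
    rw [← hessMatrix_congr (hfu x hx)]
    exact tendsto_mollify_of_continuous (hpq p q) x

theorem IsPSH.hessForm_mem_SP {u : HSpace n → ℝ} (hu : IsPSH Ω u) (hc : ContDiffOn ℝ 2 u Ω)
    {x : HSpace n} (hx : x ∈ Ω) : hessForm (hessMatrix u x) ∈ SP n 1 := by
  refine hessForm_mem_SP_of_le_average (hc.contDiffAt (Ω.isOpen.mem_nhds hx)) fun b => ?_
  obtain ⟨r, hr, hsub⟩ := Metric.nhds_basis_closedBall.mem_iff.1 (Ω.isOpen.mem_nhds hx)
  have : Filter.Tendsto (fun s : ℝ => ‖s • b‖) (𝓝[>] 0) (𝓝 ‖(0 : ℝ) • b‖) :=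
    ((continuous_id.smul continuous_const).norm.tendsto 0).mono_left nhdsWithin_le_nhds
  rw [zero_smul, norm_zero] at this
  filter_upwards [this.eventually (gt_mem_nhds hr)] with s hs
  exact hu.line_integrable hs.le hsub

theorem isLocallyBounded_of_contDiffOn {u : HSpace n → ℝ} (hc : ContDiffOn ℝ 2 u Ω) :
    IsLocallyBounded Ω u := by
  intro K hK hKΩ
  have hcont := hc.continuousOn.mono hKΩ
  obtain ⟨C, hC⟩ := hK.exists_bound_of_continuousOn hcont
  exact memLp_top_of_bound (hcont.aestronglyMeasurable hK.measurableSet) C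
    ((ae_restrict_mem hK.measurableSet).mono fun x hx => hC x hx)

end QPlurisubharmonic

end

noncomputable section

open scoped ContDiff Topology CompactlySupported


namespace QPlurisubharmonic

variable {n : ℕ} {Ω : Opens (HSpace n)}

/-! ### Positive functionals on test functions are measures -/

/-- A real test function, as a complex one. -/
def ofRealTest : 𝓓(Ω, ℝ) →ₗ[ℝ] 𝓓(Ω, ℂ) :=
  (TestFunction.postcompCLM (n := ⊤) (Ω := Ω) Complex.ofRealCLM).toLinearMap

theorem ofRealTest_apply (f : 𝓓(Ω, ℝ)) (x : HSpace n) : ofRealTest f x = (f x : ℂ) := rfl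

theorem isCompact_preimage_val {K : Set (HSpace n)} (hK : IsCompact K) (hKΩ : K ⊆ Ω) :
    IsCompact ((Subtype.val : Ω → HSpace n) ⁻¹' K) := by
  refine Topology.IsInducing.isCompact_preimage_iff Topology.IsInducing.subtypeVal ?_ |>.2 hK
  intro x hx
  exact ⟨⟨x, hKΩ hx⟩, rfl⟩

theorem integrable_of_tsupport_subset {E : Type*} [NormedAddCommGroup E] {ν : Measure (HSpace n)}
    (hν : ∀ K : Set (HSpace n), IsCompact K → K ⊆ Ω → ν K < ⊤) {f : HSpace n → E}
    (hf : Continuous f) (hc : HasCompactSupport f) (hs : tsupport f ⊆ Ω) : Integrable f ν := by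
  rw [← integrableOn_iff_integrable_of_support_subset (subset_tsupport f)]
  exact hf.continuousOn.integrableOn_of_subset_isCompact hc (isClosed_tsupport f).measurableSet
    Subset.rfl (hν _ hc hs).ne

/-- A real test function, as a compactly supported continuous function on `Ω`. -/
def restrictTest : 𝓓(Ω, ℝ) →ₗ[ℝ] C_c(Ω, ℝ) where
  toFun f :=
    { toFun := fun x => f x
      continuous_toFun := f.contDiff.continuous.comp continuous_subtype_val
      hasCompactSupport' := by
        refine HasCompactSupport.intro (K := Subtype.val ⁻¹' tsupport f) ?_ fun x hx => ?_
        · exact isCompact_preimage_val f.hasCompactSupport f.tsupport_subset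
        · exact image_eq_zero_of_notMem_tsupport hx }
  map_add' _ _ := rfl
  map_smul' _ _ := rfl

theorem restrictTest_injective : Function.Injective (restrictTest (Ω := Ω)) := by
  intro f g h
  ext1 x
  by_cases hx : x ∈ Ω
  · exact DFunLike.congr_fun h ⟨x, hx⟩
  · rw [image_eq_zero_of_notMem_tsupport fun h => hx (f.tsupport_subset h),
      image_eq_zero_of_notMem_tsupport fun h => hx (g.tsupport_subset h)]

/-- A cutoff function, as a test function. -/
theorem exists_cutoffTest {K : Set (HSpace n)} (hK : IsCompact K) (hKΩ : K ⊆ Ω) :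
    ∃ χ : 𝓓(Ω, ℝ), (∀ x, 0 ≤ χ x) ∧ (∀ x, χ x ≤ 1) ∧ ∀ x ∈ K, χ x = 1 := by
  obtain ⟨χ, h1, h2, h3, h4, h5, h6⟩ := exists_cutoff hK Ω.isOpen hKΩ
  exact ⟨⟨χ, h1, h2, h3⟩, h4, h5, fun x hx => (h6 x hx).eq_of_nhds⟩

theorem sigmaFinite_of_finite_on_compacts {ν : Measure (HSpace n)}
    (h1 : ∀ K : Set (HSpace n), IsCompact K → K ⊆ Ω → ν K < ⊤)
    (h2 : ν (Ω : Set (HSpace n))ᶜ = 0) : SigmaFinite ν := by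
  have : LocallyCompactSpace Ω := Ω.isOpen.locallyCompactSpace
  refine Measure.sigmaFinite_of_countable (S := insert (Ω : Set (HSpace n))ᶜ
    (range fun k => Subtype.val '' compactCovering Ω k)) ((countable_range _).insert _) ?_ ?_
  · rintro s (rfl | ⟨k, rfl⟩)
    · rw [h2]; exact ENNReal.zero_lt_top
    · exact h1 _ ((isCompact_compactCovering Ω k).image continuous_subtype_val)
        (by rintro _ ⟨x, -, rfl⟩; exact x.2)
  · rw [sUnion_insert, sUnion_range, ← image_iUnion, iUnion_compactCovering, image_univ,
      Subtype.range_coe_subtype]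
    exact compl_union_self _

/-- Test functions are smooth, while the Riesz–Markov theorem needs all of `C_c(Ω)`. The M. Riesz
extension theorem extends `Λ` positively, and the measure on `Ω` is then pushed forward to the
ambient space. -/
theorem exists_measure_of_nonneg_real (Λ : 𝓓(Ω, ℝ) →ₗ[ℝ] ℝ)
    (hΛ : ∀ f : 𝓓(Ω, ℝ), (∀ x, 0 ≤ f x) → 0 ≤ Λ f) :
    ∃ ν : Measure (HSpace n), (∀ K : Set (HSpace n), IsCompact K → K ⊆ Ω → ν K < ⊤) ∧
      ν (Ω : Set (HSpace n))ᶜ = 0 ∧ ∀ f : 𝓓(Ω, ℝ), Λ f = ∫ x, f x ∂ν := by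
  have : LocallyCompactSpace Ω := Ω.isOpen.locallyCompactSpace
  let e := LinearEquiv.ofInjective (restrictTest (Ω := Ω)) restrictTest_injective
  let P : C_c(Ω, ℝ) →ₗ.[ℝ] ℝ := ⟨LinearMap.range (restrictTest (Ω := Ω)), Λ ∘ₗ e.symm.toLinearMap⟩
  have hP : ∀ f : 𝓓(Ω, ℝ), P (e f) = Λ f := fun f => by
    change Λ (e.symm (e f)) = _
    rw [LinearEquiv.symm_apply_apply]
  have he : ∀ (f : 𝓓(Ω, ℝ)) (x : Ω), (e f : C_c(Ω, ℝ)) x = f x := fun f x => rfl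
  let S : PointedCone ℝ C_c(Ω, ℝ) :=
    { carrier := {g | ∀ x, 0 ≤ g x}
      add_mem' := fun {a b} ha hb x => add_nonneg (ha x) (hb x)
      zero_mem' := fun x => le_rfl
      smul_mem' := fun c a ha x => mul_nonneg c.2 (ha x) }
  obtain ⟨g, hg1, hg2⟩ := riesz_extension S P (by
    rintro ⟨_, f, rfl⟩ hf
    have h1 : P ⟨restrictTest f, f, rfl⟩ = Λ f := hP f
    rw [h1]
    refine hΛ f fun x => ?_
    by_cases hx : x ∈ Ω
    · exact hf ⟨x, hx⟩
    · rw [image_eq_zero_of_notMem_tsupport fun h => hx (f.tsupport_subset h)]) (by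
    intro y
    obtain ⟨C, hC⟩ := y.hasCompactSupport.exists_bound_of_continuous y.continuous
    have hC0 : 0 ≤ max C 0 := le_max_right _ _
    obtain ⟨χ, hχ0, -, hχ1⟩ := exists_cutoffTest (Ω := Ω)
      (y.hasCompactSupport.isCompact.image continuous_subtype_val)
      (by rintro _ ⟨x, -, rfl⟩; exact x.2)
    -- Cofinality: a multiple of a cutoff equal to `1` on the support of `y` dominates `-y`.
    refine ⟨e ((max C 0) • χ), fun x => ?_⟩
    change 0 ≤ max C 0 * χ x + y x
    by_cases hx : x ∈ tsupport y
    · rw [hχ1 x ⟨x, hx, rfl⟩, mul_one]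
      have := (abs_le.1 (hC x)).1
      linarith [le_max_left C 0]
    · rw [image_eq_zero_of_notMem_tsupport hx, add_zero]
      exact mul_nonneg hC0 (hχ0 x))
  let G : C_c(Ω, ℝ) →ₚ[ℝ] ℝ := PositiveLinearMap.mk₀ g fun f hf => hg2 f hf
  let μ := RealRMK.rieszMeasure G
  refine ⟨μ.map Subtype.val, fun K hK hKΩ => ?_, ?_, fun f => ?_⟩
  · rw [Measure.map_apply measurable_subtype_coe hK.measurableSet]
    refine IsCompact.measure_lt_top ?_
    exact isCompact_preimage_val hK hKΩ
  · rw [Measure.map_apply measurable_subtype_coe Ω.isOpen.measurableSet.compl]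
    convert measure_empty (μ := μ)
    ext x
    simp
  · have hemb : MeasurableEmbedding (Subtype.val : Ω → HSpace n) :=
      MeasurableEmbedding.subtype_coe Ω.isOpen.measurableSet
    rw [hemb.integral_map]
    have h1 := RealRMK.integral_rieszMeasure G (restrictTest f)
    have h2 : G (restrictTest f) = Λ f := (hg1 (e f)).trans (hP f)
    rw [← h2, ← h1]
    rfl

/-- A positive functional on complex test functions is the integral for a Radon measure. -/
theorem exists_measure_of_nonneg (Λ : 𝓓(Ω, ℂ) →ₗ[ℂ] ℂ)
    (hΛ : ∀ f : 𝓓(Ω, ℂ), (∀ x, 0 ≤ f x) → 0 ≤ Λ f) :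
    ∃ ν : Measure (HSpace n), (∀ K : Set (HSpace n), IsCompact K → K ⊆ Ω → ν K < ⊤) ∧
      ν (Ω : Set (HSpace n))ᶜ = 0 ∧ ∀ f : 𝓓(Ω, ℂ), Λ f = ∫ x, f x ∂ν := by
  let Λr : 𝓓(Ω, ℝ) →ₗ[ℝ] ℝ := Complex.reLm ∘ₗ (Λ.restrictScalars ℝ) ∘ₗ ofRealTest
  have hpos : ∀ f : 𝓓(Ω, ℝ), (∀ x, 0 ≤ f x) → 0 ≤ Λ (ofRealTest f) := fun f hf =>
    hΛ _ fun x => by rw [ofRealTest_apply]; exact_mod_cast hf x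
  -- A real test function is the difference of the nonnegative functions `C χ + f` and `C χ`, on
  -- both of which `Λ` is real.
  have him : ∀ f : 𝓓(Ω, ℝ), (Λ (ofRealTest f)).im = 0 := by
    intro f
    obtain ⟨C, hC⟩ := f.hasCompactSupport.exists_bound_of_continuous f.contDiff.continuous
    have hC0 : 0 ≤ C := (norm_nonneg _).trans (hC 0)
    obtain ⟨χ, hχ0, -, hχ1⟩ := exists_cutoffTest (Ω := Ω) f.hasCompactSupport f.tsupport_subset
    have h1 := hpos (C • χ) fun x => mul_nonneg hC0 (hχ0 x)
    have h2 := hpos (C • χ + f) fun x => by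
      change 0 ≤ C * χ x + f x
      by_cases hx : x ∈ tsupport f
      · rw [hχ1 x hx, mul_one]
        linarith [(abs_le.1 (hC x)).1]
      · rw [image_eq_zero_of_notMem_tsupport hx, add_zero]
        exact mul_nonneg hC0 (hχ0 x)
    rw [map_add, map_add] at h2
    have h3 := (Complex.nonneg_iff.1 h1).2
    have h4 := (Complex.nonneg_iff.1 h2).2
    rw [Complex.add_im, ← h3, zero_add] at h4
    exact h4.symm
  have hre : ∀ f : 𝓓(Ω, ℝ), Λ (ofRealTest f) = (Λr f : ℝ) := fun f =>
    Complex.ext rfl (by rw [him]; rfl)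
  obtain ⟨ν, h1, h2, h3⟩ := exists_measure_of_nonneg_real Λr fun f hf =>
    (Complex.nonneg_iff.1 (hpos f hf)).1
  refine ⟨ν, h1, h2, fun f => ?_⟩
  let fr : 𝓓(Ω, ℝ) := TestFunction.postcompCLM (n := ⊤) (Ω := Ω) Complex.reCLM f
  let fi : 𝓓(Ω, ℝ) := TestFunction.postcompCLM (n := ⊤) (Ω := Ω) Complex.imCLM f
  have hf : f = ofRealTest fr + Complex.I • ofRealTest fi := by
    ext1 x
    change f x = ((f x).re : ℂ) + Complex.I * ((f x).im : ℂ)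
    rw [mul_comm, Complex.re_add_im]
  have hint : Integrable f ν := integrable_of_tsupport_subset h1 f.contDiff.continuous
    f.hasCompactSupport f.tsupport_subset
  conv_lhs => rw [hf]
  rw [map_add, map_smul, hre, hre, h3, h3, smul_eq_mul]
  have h4 := integral_re_add_im (𝕜 := ℂ) hint
  rw [← h4, mul_comm]
  rfl

end QPlurisubharmonic

end

noncomputable section

open scoped ContDiff Topology


namespace QPlurisubharmonic

variable {n : ℕ} {Ω : Opens (HSpace n)}

/-! ### Currents with measure coefficients -/

theorem wedgeLeft_one (v : Coeff n) : wedgeLeft (1 : Ext n) v = v := by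
  rw [wedgeLeft_apply, one_mul, LinearEquiv.apply_symm_apply]

theorem integrable_topPairing {μ : Measure (HSpace n)} {h : HSpace n → Coeff n}
    (hh : LocallyIntegrableOn h Ω μ) (η : TestForm Ω) :
    Integrable (fun x => topPairing n (η x) (h x)) μ := by
  have hs : Function.support (fun x => topPairing n (η x) (h x)) ⊆ tsupport η := by
    refine subset_trans (fun x hx => ?_) (subset_tsupport η)
    exact fun h0 => hx (by simp [h0])
  rw [← integrableOn_iff_integrable_of_support_subset hs, IntegrableOn, ← memLp_one_iff_integrable]
  have h1 : IntegrableOn h (tsupport η) μ :=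
    hh.integrableOn_compact_subset η.tsupport_subset η.hasCompactSupport
  obtain ⟨C, hC⟩ := η.hasCompactSupport.exists_bound_of_continuous η.contDiff.continuous
  rw [IntegrableOn, ← memLp_one_iff_integrable] at h1
  exact (topPairing n).memLp_of_bilin 1
    (memLp_top_of_bound η.contDiff.continuous.aestronglyMeasurable C
      (Filter.Eventually.of_forall hC)) h1

theorem Current.ofMeasure_apply {μ : Measure (HSpace n)} {h : HSpace n → Coeff n}
    (hh : LocallyIntegrableOn h Ω μ) (η : TestForm Ω) :
    Current.ofMeasure Ω μ h η = ∫ x, topPairing n (η x) (h x) ∂μ :=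
  TestFunction.integralAgainstBilinCLM_eq_integral hh

theorem locallyIntegrableOn_smul {μ : Measure (HSpace n)} {h : HSpace n → Coeff n}
    (hh : LocallyIntegrableOn h Ω μ) {u : HSpace n → ℝ}
    (hu : Measurable (indicator (Ω : Set (HSpace n)) u))
    (hb : ∀ K : Set (HSpace n), IsCompact K → K ⊆ Ω → ∃ C, ∀ x ∈ K, |u x| ≤ C) :
    LocallyIntegrableOn (fun x => (u x : ℂ) • h x) Ω μ := by
  rw [locallyIntegrableOn_iff Ω.isOpen.isLocallyClosed] at hh ⊢
  intro K hKΩ hK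
  obtain ⟨C, hC⟩ := hb K hK hKΩ
  have h1 : AEStronglyMeasurable (fun x => (u x : ℂ)) (μ.restrict K) := by
    have h2 : AEStronglyMeasurable (fun x => ((indicator (Ω : Set (HSpace n)) u x : ℝ) : ℂ))
        (μ.restrict K) := (Complex.measurable_ofReal.comp hu).aestronglyMeasurable
    refine h2.congr ((ae_restrict_mem hK.measurableSet).mono fun x hx => ?_)
    simp only
    rw [indicator_of_mem (hKΩ hx)]
  exact (hh K hKΩ hK).bdd_smul C h1 ((ae_restrict_mem hK.measurableSet).mono fun x hx => by
    rw [Complex.norm_real]; exact hC x hx)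

theorem tendsto_integral_mul_topPairing {μ : Measure (HSpace n)} {h : HSpace n → Coeff n}
    (hh : LocallyIntegrableOn h Ω μ) {g : HSpace n → ℝ} {v : ℕ → HSpace n → ℝ}
    (hv : ∀ j, Continuous (v j)) {M : ℝ} (hM : ∀ j x, |v j x| ≤ M) (η : TestForm Ω)
    (hlim : ∀ x ∈ tsupport η, Filter.Tendsto (fun j => v j x) Filter.atTop (𝓝 (g x))) :
    Filter.Tendsto (fun j => ∫ x, (v j x : ℂ) * topPairing n (η x) (h x) ∂μ) Filter.atTop
      (𝓝 (∫ x, (g x : ℂ) * topPairing n (η x) (h x) ∂μ)) := by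
  have hint := integrable_topPairing hh η
  refine tendsto_integral_of_dominated_convergence
    (fun x => M * ‖topPairing n (η x) (h x)‖) (fun j => ?_) (hint.norm.const_mul M) (fun j => ?_) ?_
  · exact (Complex.continuous_ofReal.comp (hv j)).aestronglyMeasurable.mul hint.aestronglyMeasurable
  · refine Filter.Eventually.of_forall fun x => ?_
    rw [norm_mul, Complex.norm_real]
    exact mul_le_mul_of_nonneg_right (hM j x) (norm_nonneg _)
  · refine Filter.Eventually.of_forall fun x => ?_
    by_cases hx : x ∈ tsupport η
    · exact ((Complex.continuous_ofReal.tendsto _).comp (hlim x hx)).mul_const _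
    · rw [image_eq_zero_of_notMem_tsupport hx]
      simp

/-- The product of a current by a function is the limit of its products by smooth functions which
converge pointwise and boundedly. -/
theorem Current.HasMeasureCoeff.tendsto_mulFun {T : Current Ω} (hT : T.HasMeasureCoeff)
    {u : HSpace n → ℝ} (hu : Measurable (indicator (Ω : Set (HSpace n)) u))
    (hb : ∀ K : Set (HSpace n), IsCompact K → K ⊆ Ω → ∃ C, ∀ x ∈ K, |u x| ≤ C)
    {v : ℕ → HSpace n → ℝ} (hv : ∀ j, ContDiff ℝ ∞ fun x => (v j x : ℂ)) {M : ℝ}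
    (hM : ∀ j x, |v j x| ≤ M) (η : TestForm Ω)
    (hlim : ∀ x ∈ tsupport η, Filter.Tendsto (fun j => v j x) Filter.atTop (𝓝 (u x))) :
    Filter.Tendsto (fun j => T (mulTest (fun x => (v j x : ℂ)) (hv j) 1 η)) Filter.atTop
      (𝓝 (T.mulFun u η)) := by
  -- This is the representation chosen inside `mulFun`; both sides become integrals against the same
  -- measure. The limit also characterizes the product independently of that choice.
  obtain ⟨h1, h2⟩ := hT.choose_spec.choose_spec
  set μ := hT.choose
  set h := hT.choose_spec.choose
  have h3 : T.mulFun u η = ∫ x, (u x : ℂ) * topPairing n (η x) (h x) ∂μ := by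
    rw [Current.mulFun, dif_pos hT, Current.ofMeasure_apply (locallyIntegrableOn_smul h1 hu hb)]
    simp only [map_smul, smul_eq_mul]
    rfl
  have h4 : ∀ j, T (mulTest (fun x => (v j x : ℂ)) (hv j) 1 η) =
      ∫ x, (v j x : ℂ) * topPairing n (η x) (h x) ∂μ := by
    intro j
    conv_lhs => rw [h2]
    rw [Current.ofMeasure_apply h1]
    simp only [mulTest_apply, wedgeLeft_one, map_smul, smul_apply, smul_eq_mul]
    rfl
  rw [h3]
  simp only [h4]
  exact tendsto_integral_mul_topPairing h1
    (fun j => Complex.continuous_re.comp (hv j).continuous) hM η hlim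

/-! ### Positive currents -/

theorem smul_mem_SP {m : ℕ} {c : ℂ} (hc : 0 ≤ c) {w : Ext n} (hw : w ∈ SP n m) :
    c • w ∈ SP n m := by
  obtain ⟨h1, h2⟩ := Complex.nonneg_iff.1 hc
  have : c = (c.re : ℂ) := Complex.ext rfl (by rw [← h2]; rfl)
  rw [this]
  exact real_smul_mem_SP h1 hw

theorem Current.IsPositive.exists_measure {k : ℕ} {T : Current Ω} (hT : T.IsPositive k) {w : Ext n}
    (hw : w ∈ SP n (n - k)) :
    ∃ ν : Measure (HSpace n), (∀ K : Set (HSpace n), IsCompact K → K ⊆ Ω → ν K < ⊤) ∧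
      ν (Ω : Set (HSpace n))ᶜ = 0 ∧ ∀ f : 𝓓(Ω, ℂ), T (constTestForm w f) = ∫ x, f x ∂ν := by
  let Λ : 𝓓(Ω, ℂ) →ₗ[ℂ] ℂ := (T ∘L TestFunction.postcompCLM
    (ContinuousLinearMap.smulRight (1 : ℂ →L[ℂ] ℂ) (coeff n w))).toLinearMap
  refine exists_measure_of_nonneg Λ fun f hf => hT _ fun x => ?_
  change (coeff n).symm (f x • coeff n w) ∈ _
  rw [map_smul, LinearEquiv.symm_apply_apply]
  exact smul_mem_SP (hf x) hw

theorem exists_spanning_SP (n m : ℕ) : ∃ (S : Finset (Ext n)) (c : Finset (Fin (n * 2)) → S → ℂ),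
    (∀ w ∈ S, w ∈ SP n m) ∧
      ∀ I : Finset (Fin (n * 2)), I.card = 2 * m → ∑ w : S, c I w • (w : Ext n) = extBasis n I := by
  have : Module.Finite ℂ (Ext n) := Module.Finite.of_basis (extBasis n)
  obtain ⟨S, hS, hspan⟩ := (Submodule.fg_span_iff_fg_span_finset_subset (R := ℂ)
    (SP n m : Set (Ext n))).1 (IsNoetherian.noetherian _)
  have h : ∀ I : Finset (Fin (n * 2)), ∃ c : S → ℂ, I.card = 2 * m →
      ∑ w : S, c w • (w : Ext n) = extBasis n I := by
    intro I
    by_cases hI : I.card = 2 * m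
    · have h1 := extBasis_mem_spanSP I hI
      rw [spanSP, hspan, Submodule.mem_span_finset'] at h1
      obtain ⟨c, hc⟩ := h1
      exact ⟨c, fun _ => hc⟩
    · exact ⟨0, fun h => absurd h hI⟩
  choose c hc using h
  exact ⟨S, c, fun w hw => hS hw, hc⟩

theorem locallyIntegrableOn_rnDeriv {ν μ : Measure (HSpace n)}
    (hν : ∀ K : Set (HSpace n), IsCompact K → K ⊆ Ω → ν K < ⊤) :
    LocallyIntegrableOn (fun x => (ν.rnDeriv μ x).toReal) Ω μ := by
  rw [locallyIntegrableOn_iff Ω.isOpen.isLocallyClosed]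
  intro K hKΩ hK
  refine integrable_toReal_of_lintegral_ne_top (Measure.measurable_rnDeriv _ _).aemeasurable ?_
  exact ((Measure.setLIntegral_rnDeriv_le K).trans_lt (hν K hK hKΩ)).ne

/-- The relevant component of a test form is a finite sum `∑ f_w w` with `w` strongly positive and
each `f_w` linear in the coefficients of the form. Positivity makes `f ↦ T(f w)` a measure `ν w`,
and Radon–Nikodym densities express all of them against one measure. -/
theorem Current.IsPositive.hasMeasureCoeff {k : ℕ} {T : Current Ω} (hT : T.IsPositive k)
    (hd : T.HasDim (2 * (n - k))) : T.HasMeasureCoeff := by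
  obtain ⟨S, c, hS, hc⟩ := exists_spanning_SP n (n - k)
  have hν := fun w : S => hT.exists_measure (hS w w.2)
  choose ν hν1 hν2 hν3 using hν
  have hσ : ∀ w, SigmaFinite (ν w) := fun w => sigmaFinite_of_finite_on_compacts (hν1 w) (hν2 w)
  let μ : Measure (HSpace n) := Measure.sum ν
  have hac : ∀ w, ν w ≪ μ := fun w => Measure.absolutelyContinuous_of_le (Measure.le_sum ν w)
  let r : S → HSpace n → ℝ := fun w x => ((ν w).rnDeriv μ x).toReal
  have hr : ∀ w, LocallyIntegrableOn (r w) Ω μ := fun w => locallyIntegrableOn_rnDeriv (hν1 w)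
  have hψ := fun I : Finset (Fin (n * 2)) => exists_dual_basis (n := n) I
  choose ψ hψ using hψ
  let A : Finset (Finset (Fin (n * 2))) := Finset.univ.filter fun I => I.card = 2 * (n - k)
  -- Pairing with `Ψ w` extracts the coefficient function `f_w` of the test form.
  let Ψ : S → Coeff n := fun w => ∑ I ∈ A, c I w • ψ I
  have hΨ : ∀ w φ, topPairing n φ (Ψ w) = ∑ I ∈ A, c I w * φ I := by
    intro w φ
    simp only [Ψ, map_sum, map_smul, hψ, smul_eq_mul]
  have hterm : ∀ w, LocallyIntegrableOn (fun x => (r w x) • Ψ w) Ω μ := by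
    intro w
    rw [locallyIntegrableOn_iff Ω.isOpen.isLocallyClosed] at *
    intro K hKΩ hK
    exact ((locallyIntegrableOn_iff Ω.isOpen.isLocallyClosed).1 (hr w) K hKΩ hK).smul_const (Ψ w)
  let h : HSpace n → Coeff n := fun x => ∑ w, r w x • Ψ w
  have hh : LocallyIntegrableOn h Ω μ := by
    rw [locallyIntegrableOn_iff Ω.isOpen.isLocallyClosed]
    intro K hKΩ hK
    exact integrable_finsetSum _ fun w _ => (hterm w).integrableOn_compact_subset hKΩ hK
  refine ⟨μ, h, hh, ?_⟩
  ext1 η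
  let f : S → 𝓓(Ω, ℂ) := fun w => TestFunction.postcompCLM ((topPairing n).flip (Ψ w)) η
  have hf : ∀ w x, f w x = topPairing n (η x) (Ψ w) := fun w x => rfl
  have h1 : T η = ∑ w : S, T (constTestForm (w : Ext n) (f w)) := by
    rw [← map_sum, ← sub_eq_zero, ← map_sub]
    -- The expansion recovers only the component of degree `2(n - k)`; the others are invisible to
    -- `T`.
    refine hd _ fun x => symm_mem_degCompl_iff.2 fun I hI => ?_
    have h2 : ((η - ∑ w : S, constTestForm (w : Ext n) (f w) : TestForm Ω) x) =
        η x - ∑ w : S, f w x • coeff n (w : Ext n) := by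
      have h5 := testForm_sum_apply Finset.univ (fun w : S => constTestForm (w : Ext n) (f w)) x
      change η x - (∑ w : S, constTestForm (w : Ext n) (f w) : TestForm Ω) x = _
      rw [h5]
      rfl
    rw [h2]
    have h3 : ∑ w : S, f w x • coeff n (w : Ext n) = ∑ J ∈ A, η x J • coeff n (extBasis n J) := by
      simp only [hf, hΨ, Finset.sum_smul]
      rw [Finset.sum_comm]
      refine Finset.sum_congr rfl fun J hJ => ?_
      rw [← hc J (Finset.mem_filter.1 hJ).2, map_sum, Finset.smul_sum]
      refine Finset.sum_congr rfl fun w _ => ?_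
      rw [map_smul, smul_smul, mul_comm (c J w)]
    rw [h3, Pi.sub_apply, Finset.sum_apply, Finset.sum_eq_single_of_mem I (by simp [A, hI])]
    · rw [coeff_extBasis]; simp
    · intro J _ hJ
      rw [coeff_extBasis]; simp [hJ.symm]
  rw [h1, Current.ofMeasure_apply hh]
  have h4 : ∀ x, topPairing n (η x) (h x) = ∑ w, topPairing n (η x) (r w x • Ψ w) := fun x => by
    simp only [h, map_sum]
  simp only [h4]
  rw [integral_finsetSum _ fun w _ => integrable_topPairing (hterm w) η]
  refine Finset.sum_congr rfl fun w _ => ?_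
  rw [hν3, ← integral_rnDeriv_smul (hac w)]
  refine integral_congr_ae (Filter.Eventually.of_forall fun x => ?_)
  simp only [hf, r]
  rw [← Complex.coe_smul, ← Complex.coe_smul, map_smul]

theorem Current.IsPositive.exists_isMassMeasure {k : ℕ} {T : Current Ω} (hT : T.IsPositive k) :
    ∃ ν : Measure (HSpace n), T.IsMassMeasure (n - k) ν := by
  obtain ⟨ν, h1, -, h3⟩ := hT.exists_measure (beta_pow_mem_SP n (n - k))
  exact ⟨ν, h1, h3⟩

end QPlurisubharmonic

end

noncomputable section

open scoped ContDiff Topology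


namespace QPlurisubharmonic

variable {n : ℕ} {Ω : Opens (HSpace n)}

/-! ### Positivity of the products `△u₁ ∧ … ∧ △u_k` -/

theorem tsupport_dTest_subset (α : Fin 2) (η : TestForm Ω) : tsupport (dTest Ω α η) ⊆ tsupport η := by
  intro x hx
  by_contra h
  refine notMem_tsupport_iff_eventuallyEq.2 ?_ hx
  filter_upwards [(notMem_tsupport_iff_eventuallyEq.1 h).eventually_nhds] with y hy
  rw [dTest_apply_pd, Pi.zero_apply]
  refine Finset.sum_eq_zero fun p _ => ?_
  have h0 : (η : HSpace n → Coeff n) =ᶠ[𝓝 y] fun _ => 0 := hy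
  rw [(h0.pd_eventuallyEq p).eq_of_nhds]
  simp [pd]

theorem IsPSH.exists_abs_le {u : HSpace n → ℝ} (hu : IsPSH Ω u) (hb : IsLocallyBounded Ω u)
    (K : Set (HSpace n)) (hK : IsCompact K) (hKΩ : K ⊆ Ω) : ∃ C, ∀ x ∈ K, |u x| ≤ C := by
  obtain ⟨K', hK', hKK', hK'Ω⟩ := exists_compact_between hK Ω.isOpen hKΩ
  exact ⟨supNorm K' u, fun x hx => hu.abs_le_supNorm hb hK' hK'Ω (hKK' hx)⟩

theorem contDiff_ofReal_comp {v : HSpace n → ℝ} (hv : ContDiff ℝ ∞ v) :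
    ContDiff ℝ ∞ fun x => (v x : ℂ) :=
  Complex.ofRealCLM.contDiff.comp hv

/-- `△(uT)` is the limit of the currents `△u_j ∧ T`, for smooth functions `u_j` converging to `u`. -/
theorem Current.IsClosed.tendsto_bastonMul {T : Current Ω} (hT : T.IsClosed)
    (hm : T.HasMeasureCoeff) {u : HSpace n → ℝ} (hu : IsPSH Ω u) (hb : IsLocallyBounded Ω u)
    {v : ℕ → HSpace n → ℝ} (hv : ∀ j, ContDiff ℝ ∞ (v j)) {M : ℝ} (hM : ∀ j x, |v j x| ≤ M)
    (η : TestForm Ω)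
    (hlim : ∀ x ∈ tsupport η, Filter.Tendsto (fun j => v j x) Filter.atTop (𝓝 (u x))) :
    Filter.Tendsto (fun j => T (bastonMul (v j) (hv j) η)) Filter.atTop
      (𝓝 ((T.mulFun u).baston η)) := by
  have h := hm.tendsto_mulFun hu.measurable_indicator (hu.exists_abs_le hb)
    (fun j => contDiff_ofReal_comp (hv j)) hM (dTest Ω 0 (dTest Ω 1 η)) fun x hx =>
      hlim x (tsupport_dTest_subset 1 η (tsupport_dTest_subset 0 _ hx))
  exact h.congr fun j => hT.apply_mul_baston (v j) (hv j) (contDiff_ofReal_comp (hv j)) η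

/-- The value on `η` is the limit of `T(△v_j ∧ η)`, and `△v_j ∧ η` has strongly positive values for
large `j`: on the compact support of `η` the regularizations have strongly positive Hessian forms,
and elsewhere the product vanishes. -/
theorem Current.IsPositive.mulFun_baston {k : ℕ} (hk : k < n) {T : Current Ω}
    (hT : T.IsClosed) (hm : T.HasMeasureCoeff) (hp : T.IsPositive k) {u : HSpace n → ℝ}
    (hu : IsPSH Ω u) (hb : IsLocallyBounded Ω u) : (T.mulFun u).baston.IsPositive (k + 1) := by
  intro η hη
  obtain ⟨K, hK, hηK, hKΩ⟩ := exists_compact_between η.hasCompactSupport Ω.isOpen η.tsupport_subset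
  obtain ⟨v, hv, hM, hlim, hSP⟩ := hu.exists_regularization hb hK hKΩ
  refine ge_of_tendsto (hT.tendsto_bastonMul hm hu hb hv hM η fun x hx => hlim x (hηK hx)) ?_
  filter_upwards [hSP _ η.hasCompactSupport hηK] with j hj
  refine hp _ fun x => ?_
  rw [bastonMul_apply]
  by_cases hx : x ∈ tsupport η
  · rw [wedgeLeft_apply, LinearEquiv.symm_apply_apply]
    have h := SP_one_mul_mem (hj x hx) (hη x)
    rwa [show n - (k + 1) + 1 = n - k by omega] at h
  · rw [image_eq_zero_of_notMem_tsupport hx, map_zero, map_zero]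
    exact zero_mem _

theorem Current.HasDim.mulFun_baston {p : ℕ} {T : Current Ω} (hd : T.HasDim (p + 2))
    (hm : T.HasMeasureCoeff) {u : HSpace n → ℝ} (hu : IsPSH Ω u) (hb : IsLocallyBounded Ω u) :
    (T.mulFun u).baston.HasDim p := by
  intro η hη
  obtain ⟨K, hK, hηK, hKΩ⟩ := exists_compact_between η.hasCompactSupport Ω.isOpen η.tsupport_subset
  obtain ⟨v, hv, hM, hlim, -⟩ := hu.exists_regularization hb hK hKΩ
  have h := hm.tendsto_mulFun hu.measurable_indicator (hu.exists_abs_le hb)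
    (fun j => contDiff_ofReal_comp (hv j)) hM (dTest Ω 0 (dTest Ω 1 η)) fun x hx =>
      hlim x (hηK (tsupport_dTest_subset 1 η (tsupport_dTest_subset 0 _ hx)))
  refine tendsto_nhds_unique h (tendsto_const_nhds.congr fun j => (hd _ fun x => ?_).symm)
  rw [mulTest_apply, wedgeLeft_one, map_smul]
  exact Submodule.smul_mem _ _ (dTest_mem_degCompl 0 (dTest_mem_degCompl 1 hη) x)

theorem Current.one_apply (η : TestForm Ω) :
    Current.one Ω η = ∫ x, topCoeff ((coeff n).symm (η x)) ∂volume := by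
  rw [Current.one, Current.ofMeasure_apply ((locallyIntegrable_const _).locallyIntegrableOn _)]
  simp only [topPairing_apply, LinearEquiv.symm_apply_apply, one_mul]

theorem integral_nonneg_complex {α : Type*} [MeasurableSpace α] {μ : Measure α} {f : α → ℂ}
    (hf : ∀ x, 0 ≤ f x) : 0 ≤ ∫ x, f x ∂μ := by
  have h : f = fun x => ((f x).re : ℂ) := funext fun x =>
    Complex.ext rfl (by rw [← (Complex.nonneg_iff.1 (hf x)).2]; rfl)
  rw [h, integral_complex_ofReal]
  exact_mod_cast integral_nonneg fun x => (Complex.nonneg_iff.1 (hf x)).1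

theorem Current.isPositive_one : (Current.one Ω).IsPositive 0 := by
  intro η hη
  rw [Current.one_apply]
  exact integral_nonneg_complex fun x => topCoeff_nonneg_of_mem_SP (hη x)

theorem Current.hasDim_one : (Current.one Ω).HasDim (2 * n) := by
  intro η hη
  rw [Current.one_apply]
  simp only [topCoeff_eq_zero_of_mem_degCompl (hη _), integral_zero]

/-- The products `△u₁ ∧ … ∧ △u_k` are closed positive `2k`-currents. -/
theorem bastonProduct_properties (us : List (HSpace n → ℝ)) (hlen : us.length ≤ n)
    (hu : ∀ u ∈ us, IsPSH Ω u) (hb : ∀ u ∈ us, IsLocallyBounded Ω u) :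
    (bastonProduct Ω us).IsClosed ∧ (bastonProduct Ω us).IsPositive us.length ∧
      (bastonProduct Ω us).HasDim (2 * (n - us.length)) := by
  induction us with
  | nil => exact ⟨Current.isClosed_one, Current.isPositive_one, Current.hasDim_one⟩
  | cons u us ih =>
    rw [List.length_cons] at hlen
    obtain ⟨h1, h2, h3⟩ := ih (by omega) (fun w hw => hu w (List.mem_cons_of_mem _ hw))
      fun w hw => hb w (List.mem_cons_of_mem _ hw)
    have hm := h2.hasMeasureCoeff h3
    have hu' := hu u List.mem_cons_self
    have hb' := hb u List.mem_cons_self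
    refine ⟨Current.isClosed_baston _, h2.mulFun_baston hlen h1 hm hu' hb', ?_⟩
    refine Current.HasDim.mulFun_baston ?_ hm hu' hb'
    rwa [List.length_cons, show 2 * (n - (us.length + 1)) + 2 = 2 * (n - us.length) by omega]

theorem hasMeasureCoeff_bastonProduct (us : List (HSpace n → ℝ)) (hlen : us.length ≤ n)
    (hu : ∀ u ∈ us, IsPSH Ω u) (hb : ∀ u ∈ us, IsLocallyBounded Ω u) :
    (bastonProduct Ω us).HasMeasureCoeff :=
  have h := bastonProduct_properties us hlen hu hb
  h.2.1.hasMeasureCoeff h.2.2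

/-! ### The Chern–Levine–Nirenberg estimate -/

/-- The test form `χ w`, for a real function `χ` and a constant element `w`. -/
def cutoffForm (Ω : Opens (HSpace n)) (χ : HSpace n → ℝ) (h1 : ContDiff ℝ ∞ χ)
    (h2 : HasCompactSupport χ) (h3 : tsupport χ ⊆ Ω) (w : Ext n) : TestForm Ω :=
  constTestForm w (ofRealTest ⟨χ, h1, h2, h3⟩)

theorem cutoffForm_apply {χ : HSpace n → ℝ} (h1 : ContDiff ℝ ∞ χ)
    (h2 : HasCompactSupport χ) (h3 : tsupport χ ⊆ Ω) (w : Ext n) (x : HSpace n) :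
    cutoffForm Ω χ h1 h2 h3 w x = (χ x : ℂ) • coeff n w := rfl

/-- Since `w` is constant, both derivatives fall on `χ`. -/
theorem dTest_dTest_cutoffForm {χ : HSpace n → ℝ} (h1 : ContDiff ℝ ∞ χ)
    (h2 : HasCompactSupport χ) (h3 : tsupport χ ⊆ Ω) (w : Ext n) (x : HSpace n) :
    dTest Ω 0 (dTest Ω 1 (cutoffForm Ω χ h1 h2 h3 w)) x =
      coeff n (hessForm (hessMatrix χ x) * w) := by
  let L : ℝ →L[ℝ] Coeff n :=
    ContinuousLinearMap.smulRight Complex.ofRealCLM (coeff n w)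
  have hL : ∀ (q : Fin n × Fin 4) (g : HSpace n → ℝ) (y : HSpace n), DifferentiableAt ℝ g y →
      pd q (fun y => L (g y)) y = L (pd q g y) := by
    intro q g y hg
    have := (L.hasFDerivAt.comp y hg.hasFDerivAt).fderiv
    simp only [pd]
    rw [show (fun y => L (g y)) = L ∘ g from rfl, this]
    rfl
  have hp : ∀ q, pd q (cutoffForm Ω χ h1 h2 h3 w) = fun y => L (pd q χ y) := fun q =>
    funext fun y => hL q χ y (h1.contDiffAt.differentiableAt (by simp))
  rw [dTest_dTest_apply, hessForm, Finset.sum_mul, map_sum]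
  refine Finset.sum_congr rfl fun p _ => ?_
  rw [Finset.sum_mul, map_sum]
  refine Finset.sum_congr rfl fun q _ => ?_
  rw [hp, hL p _ x ((contDiff_pd q h1).contDiffAt.differentiableAt (by simp)), smul_mul_assoc,
    map_smul]
  change wedgeLeft _ (((pd p (pd q χ) x : ℝ) : ℂ) • coeff n w) = _
  rw [map_smul, wedgeLeft_apply, LinearEquiv.symm_apply_apply]
  rfl

/-- Each `|b_p b_q|` is at most `‖b‖²`, so the form of `A` is bounded below by minus the sum of the
absolute entries times `‖b‖²`. -/
theorem posSemidef_smul_one_add {ι : Type*} [Fintype ι] [DecidableEq ι] {A : Matrix ι ι ℝ}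
    (hA : A.IsSymm) {c : ℝ} (hc : ∑ p, ∑ q, |A p q| ≤ c) :
    (c • (1 : Matrix ι ι ℝ) + A).PosSemidef := by
  refine Matrix.PosSemidef.of_dotProduct_mulVec_nonneg ?_ fun b => ?_
  · rw [Matrix.IsHermitian, Matrix.conjTranspose_eq_transpose_of_trivial, Matrix.transpose_add,
      Matrix.transpose_smul, Matrix.transpose_one, hA.eq]
  · have hb : 0 ≤ ∑ i, b i ^ 2 := Finset.sum_nonneg fun i _ => sq_nonneg _
    have h1 : -(∑ p, ∑ q, |A p q|) * ∑ i, b i ^ 2 ≤ b ⬝ᵥ A.mulVec b := by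
      have hle : ∀ i, b i ^ 2 ≤ ∑ i, b i ^ 2 := fun i =>
        Finset.single_le_sum (f := fun i => b i ^ 2) (fun i _ => sq_nonneg _) (Finset.mem_univ i)
      simp only [dotProduct, Matrix.mulVec]
      rw [neg_mul, Finset.sum_mul, ← Finset.sum_neg_distrib]
      refine Finset.sum_le_sum fun p _ => ?_
      rw [Finset.sum_mul, ← Finset.sum_neg_distrib, Finset.mul_sum]
      refine Finset.sum_le_sum fun q _ => ?_
      have h2 : |b p * b q| ≤ ∑ i, b i ^ 2 := abs_le.2
        ⟨by nlinarith [hle p, hle q, sq_nonneg (b p + b q)],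
          by nlinarith [hle p, hle q, sq_nonneg (b p - b q)]⟩
      have h3 := mul_le_mul_of_nonneg_left h2 (abs_nonneg (A p q))
      rw [← abs_mul] at h3
      have h4 := neg_abs_le (A p q * (b p * b q))
      linarith [mul_left_comm (b p) (A p q) (b q)]
    rw [star_trivial, Matrix.add_mulVec, Matrix.smul_mulVec, Matrix.one_mulVec, dotProduct_add,
      dotProduct_smul, smul_eq_mul]
    have h2 : b ⬝ᵥ b = ∑ i, b i ^ 2 := by simp [dotProduct, sq]
    rw [h2]
    nlinarith [mul_le_mul_of_nonneg_right hc hb]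

/-- Cutoff functions with support in the interior of `K`. -/
structure IsCutoff (K : Set (HSpace n)) (χ : HSpace n → ℝ) : Prop where
  contDiff : ContDiff ℝ ∞ χ
  hasCompactSupport : HasCompactSupport χ
  tsupport_subset : tsupport χ ⊆ interior K
  nonneg : ∀ x, 0 ≤ χ x

/-- `A χ' β_n` dominates `△χ`. -/
def Dominates (χ' : HSpace n → ℝ) (A : ℝ) (χ : HSpace n → ℝ) : Prop :=
  ∀ x, ((A * χ' x : ℝ) : ℂ) • beta n + hessForm (hessMatrix χ x) ∈ SP n 1 ∧
    ((A * χ' x : ℝ) : ℂ) • beta n - hessForm (hessMatrix χ x) ∈ SP n 1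

theorem IsCutoff.exists_dominates {K : Set (HSpace n)} {χ : HSpace n → ℝ} (hχ : IsCutoff K χ) :
    ∃ χ' A, IsCutoff K χ' ∧ 0 ≤ A ∧ Dominates χ' A χ := by
  obtain ⟨χ', h1, h2, h3, h4, -, h6⟩ :=
    exists_cutoff hχ.hasCompactSupport isOpen_interior hχ.tsupport_subset
  have hcont : ∀ p q, Continuous fun x => hessMatrix χ x p q := fun p q =>
    (contDiff_pd p (contDiff_pd q hχ.contDiff)).continuous
  have hcs : ∀ p q, HasCompactSupport fun x => hessMatrix χ x p q := fun p q =>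
    hasCompactSupport_pd (hasCompactSupport_pd hχ.hasCompactSupport q) p
  have hbd : ∀ p q, ∃ C, ∀ x, |hessMatrix χ x p q| ≤ C := fun p q =>
    (hcs p q).exists_bound_of_continuous (hcont p q)
  choose C hC using hbd
  let c : ℝ := ∑ p, ∑ q, C p q
  have hc : ∀ x, ∑ p, ∑ q, |hessMatrix χ x p q| ≤ c := fun x =>
    Finset.sum_le_sum fun p _ => Finset.sum_le_sum fun q _ => hC p q x
  have hc0 : 0 ≤ c := (Finset.sum_nonneg fun p _ => Finset.sum_nonneg fun q _ => abs_nonneg _).trans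
    (hc 0)
  -- Since `4c β_n` is the form of `c` times the identity, on the support of `χ`, where `χ' = 1`,
  -- the claim is that `c ± Hess χ` is positive semidefinite; off it only a nonnegative multiple of
  -- `β_n` remains.
  refine ⟨χ', 4 * c, ⟨h1, h2, h3, h4⟩, by positivity, fun x => ?_⟩
  by_cases hx : x ∈ tsupport χ
  · have hsymm := hessMatrix_isSymm (hχ.contDiff.contDiffAt.of_le two_le_infty : ContDiffAt ℝ 2 χ x)
    have e1 : ((4 * c * χ' x : ℝ) : ℂ) • beta n = hessForm (c • (1 : Matrix (Fin n × Fin 4) _ ℝ)) := by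
      rw [hessForm_smul, hessForm_one, (h6 x hx).eq_of_nhds, smul_smul]
      congr 1
      push_cast
      ring
    have e2 : -hessForm (hessMatrix χ x) = hessForm (-hessMatrix χ x) := by
      rw [← neg_one_smul ℝ (hessMatrix χ x), hessForm_smul]
      simp
    have hneg : (-hessMatrix χ x).IsSymm := hsymm.neg
    rw [sub_eq_add_neg, e1, e2, ← hessForm_add, ← hessForm_add]
    exact ⟨hessForm_mem_SP_of_posSemidef (posSemidef_smul_one_add hsymm (hc x)),
      hessForm_mem_SP_of_posSemidef (posSemidef_smul_one_add hneg (by simpa using hc x))⟩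
  · have h0 : χ =ᶠ[𝓝 x] fun _ => 0 := notMem_tsupport_iff_eventuallyEq.1 hx
    have h7 : hessForm (hessMatrix χ x) = 0 := by
      rw [hessMatrix_congr h0]
      have : hessMatrix (fun _ : HSpace n => (0 : ℝ)) x = 0 := by
        ext p q
        have h8 : pd q (fun _ : HSpace n => (0 : ℝ)) = fun _ => 0 := funext fun y => by simp [pd]
        rw [hessMatrix, Matrix.of_apply, h8]
        simp [pd]
      rw [this, hessForm_zero]
    rw [h7, add_zero, sub_zero, and_self]
    exact real_smul_mem_SP (mul_nonneg (by positivity) (h4 x)) (beta_mem_SP n)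

/-- The core of the estimate: one function is traded for the factor `A ‖u‖`, one more `β_n`, and a
wider cutoff. The derivatives sit on `χ`, so only the bound `|v_j| ≤ ‖u‖` on the approximants
matters, not their Hessians. -/
theorem mulFun_baston_cutoffForm_le {k : ℕ} (hk : k < n) {T : Current Ω} (hm : T.HasMeasureCoeff)
    (hp : T.IsPositive k) {u : HSpace n → ℝ} (hu : IsPSH Ω u) (hb : IsLocallyBounded Ω u)
    {K : Set (HSpace n)} (hK : IsCompact K) (hKΩ : K ⊆ Ω) {χ χ' : HSpace n → ℝ}
    (hχ : IsCutoff K χ) (hχ' : IsCutoff K χ') {A : ℝ} (hA : Dominates χ' A χ) :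
    (T.mulFun u).baston (cutoffForm Ω χ hχ.contDiff hχ.hasCompactSupport
        (hχ.tsupport_subset.trans (interior_subset.trans hKΩ)) (beta n ^ (n - (k + 1)))) ≤
      ((A * supNorm K u : ℝ) : ℂ) * T (cutoffForm Ω χ' hχ'.contDiff hχ'.hasCompactSupport
        (hχ'.tsupport_subset.trans (interior_subset.trans hKΩ)) (beta n ^ (n - k))) := by
  obtain ⟨v, hv, hM, hlim, -⟩ := hu.exists_regularization hb hK hKΩ
  set m := n - (k + 1) with hmdef
  set η := cutoffForm Ω χ hχ.contDiff hχ.hasCompactSupport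
    (hχ.tsupport_subset.trans (interior_subset.trans hKΩ)) (beta n ^ m)
  have hη : tsupport η ⊆ interior K := by
    refine Subset.trans (closure_mono fun x hx => ?_) hχ.tsupport_subset
    intro h0
    exact hx (by rw [cutoffForm_apply, h0]; simp)
  have h := hm.tendsto_mulFun hu.measurable_indicator (hu.exists_abs_le hb)
    (fun j => contDiff_ofReal_comp (hv j)) hM (dTest Ω 0 (dTest Ω 1 η)) fun x hx =>
      hlim x (hη (tsupport_dTest_subset 1 η (tsupport_dTest_subset 0 _ hx)))
  refine le_of_tendsto' h fun j => ?_
  rw [← sub_nonneg]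
  have hsmul : ∀ (a : ℂ) (G F : TestForm Ω), a * T G - T F = T (a • G - F) := fun a G F => by
    rw [map_sub, map_smul, smul_eq_mul]
  rw [hsmul]
  refine hp _ fun x => ?_
  change (coeff n).symm (((A * supNorm K u : ℝ) : ℂ) • ((χ' x : ℂ) • coeff n (beta n ^ (n - k))) -
    (v j x : ℂ) • wedgeLeft 1 (dTest Ω 0 (dTest Ω 1 η) x)) ∈ _
  rw [wedgeLeft_one, dTest_dTest_cutoffForm, ← map_smul, ← map_smul, ← map_smul, ← map_sub,
    LinearEquiv.symm_apply_apply, show n - k = m + 1 by omega, pow_succ']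
  set M := supNorm K u
  obtain ⟨hv1, hv2⟩ := abs_le.1 (hM j x)
  obtain ⟨hd1, hd2⟩ := hA x
  -- With `a = A χ' β_n` and `h = △χ`, this is `M a - v h = (M+v)/2 · (a - h) + (M-v)/2 · (a + h)`,
  -- and both weights are nonnegative because `|v| ≤ M`.
  have hmem := SP_one_mul_mem (add_mem
    (real_smul_mem_SP (by linarith : 0 ≤ (M + v j x) / 2) hd2)
    (real_smul_mem_SP (by linarith : 0 ≤ (M - v j x) / 2) hd1)) (beta_pow_mem_SP n m)
  convert hmem using 1
  rw [← smul_mul_assoc, ← smul_mul_assoc, ← smul_mul_assoc, ← sub_mul]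
  congr 1
  push_cast
  module

/-- Each removed function moves one step along the chain of cutoffs, so the starting index `i` must
vary in the induction. At the end the current of integration is tested on a cutoff times `β_n^n`. -/
theorem bastonProduct_cutoffForm_le {K : Set (HSpace n)} (hK : IsCompact K) (hKΩ : K ⊆ Ω)
    {χ : ℕ → HSpace n → ℝ} {A : ℕ → ℝ} (hχ : ∀ i, IsCutoff K (χ i)) (hA0 : ∀ i, 0 ≤ A i)
    (hA : ∀ i, Dominates (χ (i + 1)) (A i) (χ i)) (us : List (HSpace n → ℝ)) (hlen : us.length ≤ n)
    (hu : ∀ u ∈ us, IsPSH Ω u) (hb : ∀ u ∈ us, IsLocallyBounded Ω u) (i : ℕ) :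
    bastonProduct Ω us (cutoffForm Ω (χ i) (hχ i).contDiff (hχ i).hasCompactSupport
        ((hχ i).tsupport_subset.trans (interior_subset.trans hKΩ)) (beta n ^ (n - us.length))) ≤
      (((∏ l ∈ Finset.range us.length, A (i + l)) * (us.map (supNorm K)).prod *
        ((∫ x, χ (i + us.length) x ∂volume) * (topCoeff (beta n ^ n)).re) : ℝ) : ℂ) := by
  induction us generalizing i with
  | nil =>
    have ht := topCoeff_nonneg_of_mem_SP (beta_pow_mem_SP n n)
    have htr : topCoeff (beta n ^ n) = ((topCoeff (beta n ^ n)).re : ℂ) :=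
      Complex.ext rfl (by rw [← (Complex.nonneg_iff.1 ht).2]; rfl)
    refine le_of_eq ?_
    change Current.one Ω _ = _
    rw [Current.one_apply]
    simp only [cutoffForm_apply, map_smul, LinearEquiv.symm_apply_apply]
    have h1 : ∀ x, topCoeff ((χ i x : ℂ) • beta n ^ (n - ([] : List (HSpace n → ℝ)).length)) =
        ((χ i x * (topCoeff (beta n ^ n)).re : ℝ) : ℂ) := fun x => by
      rw [← topCoeffₗ_apply, map_smul, topCoeffₗ_apply, List.length_nil, Nat.sub_zero, htr]
      push_cast
      simp
    simp only [h1, integral_complex_ofReal, integral_mul_const]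
    simp
  | cons u us ih =>
    rw [List.length_cons] at hlen
    have hus : ∀ w ∈ us, IsPSH Ω w := fun w hw => hu w (List.mem_cons_of_mem _ hw)
    have hbs : ∀ w ∈ us, IsLocallyBounded Ω w := fun w hw => hb w (List.mem_cons_of_mem _ hw)
    have ih' := ih (by omega) hus hbs (i + 1)
    obtain ⟨-, h2, -⟩ := bastonProduct_properties us (by omega) hus hbs
    have hm := hasMeasureCoeff_bastonProduct us (by omega) hus hbs
    have h1 := mulFun_baston_cutoffForm_le (by omega) hm h2 (hu u List.mem_cons_self)
      (hb u List.mem_cons_self) hK hKΩ (hχ i) (hχ (i + 1)) (hA i)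
    refine h1.trans ((mul_le_mul_of_nonneg_left ih' ?_).trans_eq ?_)
    · exact_mod_cast mul_nonneg (hA0 i) ENNReal.toReal_nonneg
    · rw [← Complex.ofReal_mul]
      congr 1
      rw [List.length_cons, Finset.prod_range_succ', List.map_cons, List.prod_cons, add_zero]
      simp only [show ∀ l, i + 1 + l = i + (l + 1) from fun l => by ring]
      ring

end QPlurisubharmonic

end

noncomputable section

open scoped ContDiff Topology


namespace QPlurisubharmonic

variable {n : ℕ} {Ω : Opens (HSpace n)}

/-! ### Products of `C²` functions -/

theorem contDiffOn_pd {f : HSpace n → ℝ} {k m : WithTop ℕ∞} (hf : ContDiffOn ℝ m f Ω)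
    (h : k + 1 ≤ m) (p : Fin n × Fin 4) : ContDiffOn ℝ k (pd p f) Ω :=
  (hf.fderiv_of_isOpen Ω.isOpen h).clm_apply contDiffOn_const

theorem continuousOn_hessMatrix {u : HSpace n → ℝ} (hu : ContDiffOn ℝ 2 u Ω)
    (p q : Fin n × Fin 4) : ContinuousOn (fun x => hessMatrix u x p q) Ω :=
  (contDiffOn_pd (k := 0) (contDiffOn_pd (k := 1) hu (by norm_num) q) (by norm_num) p).continuousOn

theorem topPairing_wedgeLeft {v : Ext n} (hv : v ∈ SP n 1) (φ ψ : Coeff n) :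
    topPairing n φ (wedgeLeft v ψ) = topPairing n (wedgeLeft v φ) ψ := by
  simp only [topPairing_apply, wedgeLeft_apply, LinearEquiv.symm_apply_apply]
  rw [(commute_SP_one hv _).eq, mul_assoc]

/-- The coefficients of `△u₁ ∧ … ∧ △u_k`. -/
def bastonCoeff (us : List (HSpace n → ℝ)) (x : HSpace n) : Coeff n :=
  coeff n ((us.map fun u => baston u x).prod)

theorem bastonCoeff_cons (u : HSpace n → ℝ) (us : List (HSpace n → ℝ)) (x : HSpace n) :
    bastonCoeff (u :: us) x = wedgeLeft (baston u x) (bastonCoeff us x) := by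
  rw [bastonCoeff, List.map_cons, List.prod_cons, wedgeLeft_apply, bastonCoeff,
    LinearEquiv.symm_apply_apply]

theorem wedgeLeft_hessForm (A : Matrix (Fin n × Fin 4) (Fin n × Fin 4) ℝ) (φ : Coeff n) :
    wedgeLeft (hessForm A) φ =
      ∑ p, ∑ q, (A p q : ℂ) • wedgeLeft (pullback (covec p) 0 * pullback (covec q) 1) φ := by
  simp only [hessForm, wedgeLeft_sum, wedgeLeft_smul]

theorem baston_eq_hessForm_of_mem {u : HSpace n → ℝ} (hu : ContDiffOn ℝ 2 u Ω) {x : HSpace n}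
    (hx : x ∈ Ω) : baston u x = hessForm (hessMatrix u x) :=
  baston_eq_hessForm (hu.contDiffAt (Ω.isOpen.mem_nhds hx))

theorem continuousOn_bastonCoeff (us : List (HSpace n → ℝ)) (hc : ∀ u ∈ us, ContDiffOn ℝ 2 u Ω) :
    ContinuousOn (bastonCoeff us) Ω := by
  induction us with
  | nil =>
    have h : bastonCoeff ([] : List (HSpace n → ℝ)) = fun _ => coeff n 1 := rfl
    rw [h]
    exact continuousOn_const
  | cons u us ih =>
    have h1 := ih fun w hw => hc w (List.mem_cons_of_mem _ hw)
    have hu := hc u List.mem_cons_self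
    have h2 : ContinuousOn (fun x => ∑ p, ∑ q, (hessMatrix u x p q : ℂ) •
        wedgeLeft (pullback (covec p) 0 * pullback (covec q) 1) (bastonCoeff us x)) Ω :=
      continuousOn_finsetSum _ fun p _ => continuousOn_finsetSum _ fun q _ =>
        (Complex.continuous_ofReal.comp_continuousOn (continuousOn_hessMatrix hu p q)).smul
          ((wedgeLeft _).continuous.comp_continuousOn h1)
    refine h2.congr fun x hx => ?_
    rw [bastonCoeff_cons, baston_eq_hessForm_of_mem hu hx, wedgeLeft_hessForm]

/-- In the inductive step the current is the limit of `T(△v_j ∧ η)` for regularizations with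
converging Hessians. Expanding in Hessian entries, dominated convergence yields the pointwise `△u`,
which is then moved to the other factor of the pairing because it is central. -/
theorem bastonProduct_eq_ofMeasure (us : List (HSpace n → ℝ)) (hlen : us.length ≤ n)
    (hu : ∀ u ∈ us, IsPSH Ω u) (hc : ∀ u ∈ us, ContDiffOn ℝ 2 u Ω) :
    bastonProduct Ω us = Current.ofMeasure Ω volume (bastonCoeff us) := by
  induction us with
  | nil => rfl
  | cons u us ih =>
    rw [List.length_cons] at hlen
    have hus : ∀ w ∈ us, IsPSH Ω w := fun w hw => hu w (List.mem_cons_of_mem _ hw)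
    have hcs : ∀ w ∈ us, ContDiffOn ℝ 2 w Ω := fun w hw => hc w (List.mem_cons_of_mem _ hw)
    have hbs : ∀ w ∈ us, IsLocallyBounded Ω w := fun w hw => isLocallyBounded_of_contDiffOn (hcs w hw)
    have hu' := hu u List.mem_cons_self
    have hc' := hc u List.mem_cons_self
    have ih' := ih (by omega) hus hcs
    have hF := continuousOn_bastonCoeff us hcs
    have hFl : LocallyIntegrableOn (bastonCoeff us) Ω volume :=
      hF.locallyIntegrableOn Ω.isOpen.measurableSet
    obtain ⟨h1, -, -⟩ := bastonProduct_properties us (by omega) hus hbs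
    have hm := hasMeasureCoeff_bastonProduct us (by omega) hus hbs
    ext1 η
    obtain ⟨v, M, hv, hM, hM2, hlim⟩ :=
      exists_contDiff_two_regularization hc' η.hasCompactSupport η.tsupport_subset
    have ht := h1.tendsto_bastonMul hm hu' (isLocallyBounded_of_contDiffOn hc') hv hM η
      fun x hx => (hlim x hx).1
    let E : Fin n × Fin 4 → Fin n × Fin 4 → Ext n := fun p q =>
      pullback (covec p) 0 * pullback (covec q) 1
    let ζ : Fin n × Fin 4 → Fin n × Fin 4 → TestForm Ω := fun p q =>
      TestFunction.postcompCLM (wedgeLeft (E p q)) η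
    have hζ : ∀ p q x, ζ p q x = wedgeLeft (E p q) (η x) := fun p q x => rfl
    have hζs : ∀ p q, tsupport (ζ p q) ⊆ tsupport η := fun p q =>
      closure_mono fun x hx h0 => hx (by rw [hζ, h0, map_zero])
    have hsum : ∀ j, bastonProduct Ω us (bastonMul (v j) (hv j) η) = ∑ p, ∑ q,
        ∫ x, (hessMatrix (v j) x p q : ℂ) * topPairing n (ζ p q x) (bastonCoeff us x) ∂volume := by
      intro j
      rw [bastonMul, map_sum]
      refine Finset.sum_congr rfl fun p _ => ?_
      rw [map_sum]
      refine Finset.sum_congr rfl fun q _ => ?_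
      rw [ih', Current.ofMeasure_apply hFl]
      refine integral_congr_ae (Filter.Eventually.of_forall fun x => ?_)
      change topPairing n (((hessMatrix (v j) x p q : ℝ) : ℂ) • wedgeLeft (E p q) (η x))
        (bastonCoeff us x) = (hessMatrix (v j) x p q : ℂ) *
          topPairing n (wedgeLeft (E p q) (η x)) (bastonCoeff us x)
      rw [map_smul, smul_apply, smul_eq_mul]
    have ht2 : Filter.Tendsto (fun j => bastonProduct Ω us (bastonMul (v j) (hv j) η)) Filter.atTop
        (𝓝 (∑ p, ∑ q, ∫ x, (hessMatrix u x p q : ℂ) *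
          topPairing n (ζ p q x) (bastonCoeff us x) ∂volume)) := by
      simp only [hsum]
      refine tendsto_finsetSum _ fun p _ => tendsto_finsetSum _ fun q _ => ?_
      exact tendsto_integral_mul_topPairing hFl
        (fun j => (contDiff_pd p (contDiff_pd q (hv j))).continuous) (fun j x => hM2 j x p q) _
        fun x hx => (hlim x (hζs p q hx)).2 p q
    have hFl' : LocallyIntegrableOn (bastonCoeff (u :: us)) Ω volume :=
      (continuousOn_bastonCoeff _ hc).locallyIntegrableOn Ω.isOpen.measurableSet
    have hint : ∀ p q, Integrable (fun x => (hessMatrix u x p q : ℂ) *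
        topPairing n (ζ p q x) (bastonCoeff us x)) volume := by
      intro p q
      have h2 : LocallyIntegrableOn (fun x => (hessMatrix u x p q : ℂ) • bastonCoeff us x) Ω volume :=
        ((Complex.continuous_ofReal.comp_continuousOn (continuousOn_hessMatrix hc' p q)).smul
          hF).locallyIntegrableOn Ω.isOpen.measurableSet
      refine (integrable_topPairing h2 (ζ p q)).congr (Filter.Eventually.of_forall fun x => ?_)
      simp only [map_smul, smul_eq_mul]
    refine (tendsto_nhds_unique ht ht2).trans ?_
    rw [Current.ofMeasure_apply hFl']
    simp only [← integral_finsetSum _ fun q _ => hint _ q]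
    rw [← integral_finsetSum _ fun p _ => integrable_finsetSum _ fun q _ => hint p q]
    refine integral_congr_ae (Filter.Eventually.of_forall fun x => ?_)
    simp only
    by_cases hx : x ∈ tsupport η
    · have hxΩ := η.tsupport_subset hx
      rw [bastonCoeff_cons, baston_eq_hessForm_of_mem hc' hxΩ,
        topPairing_wedgeLeft (hu'.hessForm_mem_SP hc' hxΩ), wedgeLeft_hessForm]
      simp only [map_sum, sum_apply, map_smul, smul_apply, smul_eq_mul, hζ, E]
    · simp only [hζ, image_eq_zero_of_notMem_tsupport hx, map_zero, zero_apply, mul_zero,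
        Finset.sum_const_zero]

theorem topCoeff_bastonWedge_nonneg {k : ℕ} (hk : k ≤ n) {u : Fin k → HSpace n → ℝ}
    (hu : ∀ i, IsPSH Ω (u i)) (hc : ∀ i, ContDiffOn ℝ 2 (u i) Ω) {x : HSpace n} (hx : x ∈ Ω) :
    0 ≤ topCoeff (bastonWedge u x * beta n ^ (n - k)) := by
  refine topCoeff_nonneg_of_mem_SP ?_
  have h := list_prod_mul_mem_SP (List.ofFn fun i => baston (u i) x) (fun v hv => by
    obtain ⟨i, rfl⟩ := List.mem_ofFn.1 hv
    rw [baston_eq_hessForm_of_mem (hc i) hx]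
    exact (hu i).hessForm_mem_SP (hc i) hx) (beta_pow_mem_SP n (n - k))
  rwa [List.length_ofFn, Nat.sub_add_cancel hk] at h

theorem bastonCoeff_ofFn {k : ℕ} (u : Fin k → HSpace n → ℝ) (x : HSpace n) :
    (coeff n).symm (bastonCoeff (List.ofFn u) x) = bastonWedge u x := by
  rw [bastonCoeff, LinearEquiv.symm_apply_apply, List.map_ofFn]
  rfl

theorem formMass_bastonWedge_nonneg {k : ℕ} (hk : k ≤ n) {u : Fin k → HSpace n → ℝ}
    (hu : ∀ i, IsPSH Ω (u i)) (hc : ∀ i, ContDiffOn ℝ 2 (u i) Ω) {L : Set (HSpace n)}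
    (hL : IsCompact L) (hLΩ : L ⊆ Ω) : 0 ≤ formMass L (n - k) (bastonWedge u) := by
  have h : formMass L (n - k) (bastonWedge u) =
      ∫ x, indicator L (fun x => topCoeff (bastonWedge u x * beta n ^ (n - k))) x ∂volume :=
    (integral_indicator hL.measurableSet).symm
  rw [h]
  refine integral_nonneg_complex fun x => ?_
  by_cases hx : x ∈ L
  · rw [indicator_of_mem hx]
    exact topCoeff_bastonWedge_nonneg hk hu hc (hLΩ hx)
  · rw [indicator_of_notMem hx]

/-- The density is nonnegative on `Ω`, so replacing the indicator of `L` by a cutoff equal to `1` on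
`L` only increases the integral. -/
theorem formMass_bastonWedge_le {k : ℕ} (hk : k ≤ n) {u : Fin k → HSpace n → ℝ}
    (hu : ∀ i, IsPSH Ω (u i)) (hc : ∀ i, ContDiffOn ℝ 2 (u i) Ω) {L : Set (HSpace n)}
    (hL : IsCompact L) {χ : HSpace n → ℝ} (h1 : ContDiff ℝ ∞ χ)
    (h2 : HasCompactSupport χ) (h3 : tsupport χ ⊆ Ω) (h0 : ∀ x, 0 ≤ χ x) (hχL : ∀ x ∈ L, χ x = 1) :
    formMass L (n - k) (bastonWedge u) ≤
      bastonProduct Ω (List.ofFn u) (cutoffForm Ω χ h1 h2 h3 (beta n ^ (n - k))) := by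
  have hcs : ∀ w ∈ List.ofFn u, ContDiffOn ℝ 2 w Ω := fun w hw => by
    obtain ⟨i, rfl⟩ := List.mem_ofFn.1 hw
    exact hc i
  have hFl : LocallyIntegrableOn (bastonCoeff (List.ofFn u)) Ω volume :=
    (continuousOn_bastonCoeff _ hcs).locallyIntegrableOn Ω.isOpen.measurableSet
  let g : HSpace n → ℂ := fun x => topCoeff (bastonWedge u x * beta n ^ (n - k))
  have hpair : ∀ x, topPairing n (cutoffForm Ω χ h1 h2 h3 (beta n ^ (n - k)) x)
      (bastonCoeff (List.ofFn u) x) = (χ x : ℂ) * g x := by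
    intro x
    rw [cutoffForm_apply, map_smul, smul_apply, topPairing_apply, bastonCoeff_ofFn,
      LinearEquiv.symm_apply_apply, smul_eq_mul]
  have hint := integrable_topPairing hFl (cutoffForm Ω χ h1 h2 h3 (beta n ^ (n - k)))
  simp only [hpair] at hint
  rw [bastonProduct_eq_ofMeasure _ (by simpa using hk) (fun w hw => by
    obtain ⟨i, rfl⟩ := List.mem_ofFn.1 hw
    exact hu i) hcs, Current.ofMeasure_apply hFl]
  simp only [hpair]
  have hLint : formMass L (n - k) (bastonWedge u) = ∫ x, indicator L (fun x => (χ x : ℂ) * g x) x := by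
    rw [integral_indicator hL.measurableSet]
    refine setIntegral_congr_fun hL.measurableSet fun x hx => ?_
    simp only [hχL x hx, Complex.ofReal_one, one_mul, g]
  rw [hLint, ← sub_nonneg, ← integral_sub hint (hint.indicator hL.measurableSet)]
  refine integral_nonneg_complex fun x => ?_
  by_cases hx : x ∈ L
  · rw [indicator_of_mem hx, sub_self]
  · rw [indicator_of_notMem hx, sub_zero]
    by_cases hxs : x ∈ tsupport χ
    · exact mul_nonneg (by exact_mod_cast h0 x) (topCoeff_bastonWedge_nonneg hk hu hc (h3 hxs))
    · rw [image_eq_zero_of_notMem_tsupport hxs, Complex.ofReal_zero, zero_mul]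

theorem Current.IsMassMeasure.le_of_cutoffForm_le {T : Current Ω} {p : ℕ} {ν : Measure (HSpace n)}
    (hν : T.IsMassMeasure p ν) {L : Set (HSpace n)} (hL : IsCompact L) {χ : HSpace n → ℝ}
    (h1 : ContDiff ℝ ∞ χ) (h2 : HasCompactSupport χ) (h3 : tsupport χ ⊆ Ω) (h0 : ∀ x, 0 ≤ χ x)
    (hχL : ∀ x ∈ L, χ x = 1) {c : ℝ} (hc : T (cutoffForm Ω χ h1 h2 h3 (beta n ^ p)) ≤ (c : ℂ)) :
    ν L ≤ ENNReal.ofReal c := by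
  have h4 : T (cutoffForm Ω χ h1 h2 h3 (beta n ^ p)) = ((∫ x, χ x ∂ν : ℝ) : ℂ) := by
    rw [cutoffForm, hν.eq_integral, ← integral_complex_ofReal]
    rfl
  rw [h4, Complex.real_le_real] at hc
  have hint : Integrable χ ν := integrable_of_tsupport_subset hν.finite h1.continuous h2 h3
  refine le_trans ?_ (ENNReal.ofReal_le_ofReal hc)
  rw [ofReal_integral_eq_lintegral_ofReal hint (Filter.Eventually.of_forall h0)]
  calc ν L = ∫⁻ x in L, 1 ∂ν := by rw [setLIntegral_one]
    _ = ∫⁻ x in L, ENNReal.ofReal (χ x) ∂ν :=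
      setLIntegral_congr_fun hL.measurableSet fun x hx => by simp [hχL x hx]
    _ ≤ ∫⁻ x, ENNReal.ofReal (χ x) ∂ν := setLIntegral_le_lintegral _ _

/-- The Chern–Levine–Nirenberg estimate, in terms of a cutoff function. -/
theorem exists_cutoff_bastonProduct_le {K L : Set (HSpace n)} (hK : IsCompact K)
    (hL : IsCompact L) (hLK : L ⊆ interior K) : ∃ (χ : HSpace n → ℝ) (hχ : IsCutoff K χ) (C : ℝ),
      0 < C ∧ (∀ x ∈ L, χ x = 1) ∧ ∀ (Ω : Opens (HSpace n)) (hKΩ : K ⊆ Ω)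
        (us : List (HSpace n → ℝ)), us.length ≤ n → (∀ u ∈ us, IsPSH Ω u) →
        (∀ u ∈ us, IsLocallyBounded Ω u) →
        bastonProduct Ω us (cutoffForm Ω χ hχ.contDiff hχ.hasCompactSupport
          (hχ.tsupport_subset.trans (interior_subset.trans hKΩ)) (beta n ^ (n - us.length))) ≤
        ((C * (us.map (supNorm K)).prod : ℝ) : ℂ) := by
  obtain ⟨χ₀, g1, g2, g3, g4, -, g6⟩ := exists_cutoff hL isOpen_interior hLK
  have hnext := fun χ : {χ : HSpace n → ℝ // IsCutoff K χ} => χ.2.exists_dominates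
  choose next A hnext hA0 hdom using hnext
  -- Iterating the choice of a dominating cutoff gives a chain supported in the interior of `K`,
  -- fixed before `Ω` and the functions appear; this is why the constant depends only on `K` and
  -- `L`.
  let s : ℕ → {χ : HSpace n → ℝ // IsCutoff K χ} := fun i =>
    (fun χ => ⟨next χ, hnext χ⟩)^[i] ⟨χ₀, g1, g2, g3, g4⟩
  have hs : ∀ i, (s (i + 1) : HSpace n → ℝ) = next (s i) := fun i => by
    simp only [s, Function.iterate_succ_apply']
  have ht := (Complex.nonneg_iff.1 (topCoeff_nonneg_of_mem_SP (beta_pow_mem_SP n n))).1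
  let c : ℕ → ℝ := fun k => (∏ l ∈ Finset.range k, A (s l)) *
    ((∫ x, (s k : HSpace n → ℝ) x ∂volume) * (topCoeff (beta n ^ n)).re)
  have hc0 : ∀ k, 0 ≤ c k := fun k => mul_nonneg (Finset.prod_nonneg fun l _ => hA0 _)
    (mul_nonneg (integral_nonneg (s k).2.nonneg) ht)
  -- Summing the nonnegative constants over `k ≤ n` gives one constant for all `k`; the `+ 1` makes
  -- it positive.
  refine ⟨χ₀, ⟨g1, g2, g3, g4⟩, ∑ k ∈ Finset.range (n + 1), c k + 1,
    add_pos_of_nonneg_of_pos (Finset.sum_nonneg fun k _ => hc0 k) one_pos,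
    fun x hx => (g6 x hx).eq_of_nhds, fun Ω hKΩ us hlen hu hb => ?_⟩
  have h := bastonProduct_cutoffForm_le hK hKΩ (χ := fun i => (s i : HSpace n → ℝ))
    (A := fun i => A (s i)) (fun i => (s i).2) (fun i => hA0 _)
    (fun i => by rw [hs]; exact hdom (s i)) us hlen hu hb 0
  refine h.trans ?_
  rw [Complex.real_le_real]
  have hprod : 0 ≤ (us.map (supNorm K)).prod := List.prod_nonneg fun a ha => by
    obtain ⟨u, -, rfl⟩ := List.mem_map.1 ha
    exact ENNReal.toReal_nonneg
  have h5 : c us.length ≤ ∑ k ∈ Finset.range (n + 1), c k + 1 :=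
    (Finset.single_le_sum (f := c) (s := Finset.range (n + 1)) (fun k _ => hc0 k)
      (Finset.mem_range.2 (by omega))).trans (by linarith)
  refine le_trans (le_of_eq ?_) (mul_le_mul_of_nonneg_right h5 hprod)
  simp only [c, zero_add]
  ring

end QPlurisubharmonic

end

/-! ### The Chern–Levine–Nirenberg estimate for `C²` and for locally bounded functions. -/

theorem proposition3p10 (n : ℕ) (K L : Set (QPlurisubharmonic.HSpace n))
    (hK : IsCompact K) (hL : IsCompact L) (hLK : L ⊆ interior K) :
    ∃ C : ℝ, 0 < C ∧
      ∀ Ω : Opens (QPlurisubharmonic.HSpace n), K ⊆ Ω →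
      ∀ k : ℕ, k ≤ n → ∀ u : Fin k → QPlurisubharmonic.HSpace n → ℝ,
        (∀ i, QPlurisubharmonic.IsPSH Ω (u i)) →
        ((∀ i, ContDiffOn ℝ 2 (u i) Ω) →
          0 ≤ QPlurisubharmonic.formMass L (n - k) (QPlurisubharmonic.bastonWedge u) ∧
          QPlurisubharmonic.formMass L (n - k) (QPlurisubharmonic.bastonWedge u) ≤
            ((C * ∏ i, QPlurisubharmonic.supNorm K (u i) : ℝ) : ℂ)) ∧
        ((∀ i, QPlurisubharmonic.IsLocallyBounded Ω (u i)) →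
          (QPlurisubharmonic.bastonProduct Ω (List.ofFn u)).HasMeasureCoeff ∧
          (QPlurisubharmonic.bastonProduct Ω (List.ofFn u)).IsPositive k ∧
          ∃ ν : Measure (QPlurisubharmonic.HSpace n),
            (QPlurisubharmonic.bastonProduct Ω (List.ofFn u)).IsMassMeasure (n - k) ν ∧
            ν L ≤ ENNReal.ofReal (C * ∏ i, QPlurisubharmonic.supNorm K (u i))) := by
  obtain ⟨χ, hχ, C, hC, hχL, hmain⟩ :=
    QPlurisubharmonic.exists_cutoff_bastonProduct_le hK hL hLK
  refine ⟨C, hC, fun Ω hKΩ k hk u hu => ?_⟩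
  have hmem : ∀ {P : (QPlurisubharmonic.HSpace n → ℝ) → Prop}, (∀ i, P (u i)) →
      ∀ w ∈ List.ofFn u, P w := by
    intro P h w hw
    obtain ⟨i, rfl⟩ := List.mem_ofFn.1 hw
    exact h i
  have hlen : (List.ofFn u).length = k := List.length_ofFn
  have hprod : ((List.ofFn u).map (QPlurisubharmonic.supNorm K)).prod =
      ∏ i, QPlurisubharmonic.supNorm K (u i) := by
    rw [List.map_ofFn, List.prod_ofFn]
    rfl
  have hχΩ : tsupport χ ⊆ Ω := hχ.tsupport_subset.trans (interior_subset.trans hKΩ)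
  have hle : (∀ i, QPlurisubharmonic.IsLocallyBounded Ω (u i)) →
      QPlurisubharmonic.bastonProduct Ω (List.ofFn u)
        (QPlurisubharmonic.cutoffForm Ω χ hχ.contDiff hχ.hasCompactSupport hχΩ
          (QPlurisubharmonic.beta n ^ (n - k))) ≤
        ((C * ∏ i, QPlurisubharmonic.supNorm K (u i) : ℝ) : ℂ) := by
    intro hb
    have h := hmain Ω hKΩ (List.ofFn u) (hlen.trans_le hk) (hmem hu) (hmem hb)
    rwa [hprod, hlen] at h
  refine ⟨fun hc => ⟨?_, ?_⟩, fun hb => ?_⟩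
  · exact QPlurisubharmonic.formMass_bastonWedge_nonneg hk hu hc hL
      (hLK.trans (interior_subset.trans hKΩ))
  · exact (QPlurisubharmonic.formMass_bastonWedge_le hk hu hc hL hχ.contDiff hχ.hasCompactSupport
      hχΩ hχ.nonneg hχL).trans
        (hle fun i => QPlurisubharmonic.isLocallyBounded_of_contDiffOn (hc i))
  · have hpos := (QPlurisubharmonic.bastonProduct_properties (List.ofFn u) (hlen.trans_le hk)
      (hmem hu) (hmem hb)).2.1
    rw [hlen] at hpos
    obtain ⟨ν, hν⟩ := hpos.exists_isMassMeasure
    exact ⟨QPlurisubharmonic.hasMeasureCoeff_bastonProduct _ (hlen.trans_le hk) (hmem hu) (hmem hb),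
      hpos, ν, hν, hν.le_of_cutoffForm_le hL hχ.contDiff hχ.hasCompactSupport hχΩ hχ.nonneg hχL
        (hle hb)⟩
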